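/- Let $\alpha,\beta>-1$, let $j\ge 1$ be an integer, $\gamma\in\mathbb{R}$, $M>0$, and let $\{M_n\}_{n\ge0}$ be nonnegative real numbers with $\lim_{n\to\infty}M_n n^{\gamma}=M$. For each $n$ let $Q_n$ be a polynomial of degree $n$ that is orthogonal to all polynomials of degree less than $n$ with respect to $$(f,g)_{S,n}=\int_{-1}^1 f(x)g(x)(1-x)^{\alpha}(1+x)^{\beta}\,dx+M_n f^{(j)}(1)g^{(j)}(1)$$ (such $Q_n$ is unique up to a nonzero constant factor). Let $J_\nu$ be the Bessel function of the first kind of order $\nu$. For a sequence $\theta=(\theta_i)_{i\ge 0}$ put $$F_{\theta}(x)=\sum_{i=0}^{j+1}b_i2^i\left(\frac x2\right)^{-\alpha}J_{\alpha+2i}(x),\qquad b_i=(-1)^i\,\frac{\theta_i-\Gamma(\alpha+i+1)\sum_{k=0}^{i-1}b_k\binom ik\frac{(-1)^kk!\,2^k}{\Gamma(\alpha+i+k+1)}}{i!\,\frac{2^i\Gamma(\alpha+i+1)}{\Gamma(\alpha+2i+1)}},\quad 0\le i\le j+1.$$ Let $D=\Gamma^2(\alpha+j+1)\,2^{\alpha+\beta+2j+1}(\alpha+2j+1)$;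 let $\varphi_{\alpha,j}=F_\theta$ with $\theta_i=\frac{i-j}{\alpha+j+i+1}$, and let $\psi_{\alpha,j}=F_\theta$ with $\theta_i=\frac{M(i-j)+D(\alpha+j+i+1)}{(\alpha+j+i+1)(M+D)}$. Put $$V=\frac{2^{\alpha+\beta+2j+1}(\alpha+j+1)(\alpha+2j+1)\Gamma^2(\alpha+j+1)}{j}.$$ Then, for every $n$, $Q_n$ has $n$ distinct real zeros $y_{n,1}>y_{n,2}>\dots>y_{n,n}$; each of the functions $J_\alpha$, $\varphi_{\alpha,j}$, $\psi_{\alpha,j}$ has, in the respective case below, an $i$-th positive zero (distinct zeros being numbered in increasing order) for every $i\ge1$, denoted $j_{\alpha,i}$, $s_{\alpha,i}$, $t_{\alpha,i}$ respectively; and the following hold. 1. If $\gamma>2(\alpha+2j+1)$, then $\lim_{n\to\infty}n\sqrt{2(1-y_{n,i})}=j_{\alpha,i}$ for all $i\ge1$. 2. If $\gamma<2(\alpha+2j+1)$, then $\lim_{n\to\infty}y_{n,1}=1$ and $\lim_{n\to\infty}n\sqrt{2(1-y_{n,i})}=s_{\alpha,i-1}$ for all $i\ge2$. 3. If $\gamma=2(\alpha+2j+1)$,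 then: (a) if $M<V$, then $y_{n,1}\le1$ for all sufficiently large $n$, and $\lim_{n\to\infty}n\sqrt{2(1-y_{n,i})}=t_{\alpha,i}$ for all $i\ge1$; (b) if $M>V$, then $\lim_{n\to\infty}y_{n,1}=1$ and $\lim_{n\to\infty}n\sqrt{2(1-y_{n,i})}=t_{\alpha,i-1}$ for all $i\ge2$; (c) if $M=V$, then $\lim_{n\to\infty}n\sqrt{2|1-y_{n,1}|}=0$ and $\lim_{n\to\infty}n\sqrt{2(1-y_{n,i})}=t_{\alpha,i-1}$ for all $i\ge2$. -/

import Mathlib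

open Polynomial Filter Topology Set

noncomputable section

/-- The discrete Jacobi-Sobolev bilinear form
`∫_{-1}^{1} p q (1-x)^α (1+x)^β dx + m p^{(j)}(1) q^{(j)}(1)` on real polynomials. -/
def jacobiSobolevForm (α β : ℝ) (j : ℕ) (m : ℝ) (p q : ℝ[X]) : ℝ :=
  (∫ x in (-1 : ℝ)..1, p.eval x * q.eval x * (1 - x) ^ α * (1 + x) ^ β)
    + m * (derivative^[j] p).eval 1 * (derivative^[j] q).eval 1

/-- `p` is an orthogonal polynomial of degree `n` for the form above: it has degree exactly `n`
and is orthogonal to every polynomial of smaller degree. -/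
def IsJacobiSobolevOP (α β : ℝ) (j : ℕ) (m : ℝ) (n : ℕ) (p : ℝ[X]) : Prop :=
  p.degree = n ∧ ∀ q : ℝ[X], q.degree < n → jacobiSobolevForm α β j m p q = 0

/-- `y 1 > y 2 > ⋯ > y n` are the zeros of the degree `n` polynomial `p`
(so all `n` zeros of `p` are real and simple). -/
def IsZeroList (p : ℝ[X]) (n : ℕ) (y : ℕ → ℝ) : Prop :=
  StrictAntiOn y (Icc 1 n) ∧ ∀ x : ℝ, p.IsRoot x ↔ ∃ i ∈ Icc 1 n, y i = x

/-- The Bessel function of the first kind `J_α(x)`, used for `x > 0` and `α > -1`. -/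
def besselJ (α x : ℝ) : ℝ :=
  ∑' k : ℕ, (-1 : ℝ) ^ k / ((k.factorial : ℝ) * Real.Gamma (k + α + 1))
    * (x / 2) ^ (2 * (k : ℝ) + α)

/-- The coefficients `b_i` computed recursively from a sequence `θ`. -/
def limitCoeff (α : ℝ) (θ : ℕ → ℝ) : ℕ → ℝ
  | i => (-1 : ℝ) ^ i *
      (θ i - Real.Gamma (α + i + 1) *
        ∑ k : Fin i, limitCoeff α θ k * (i.choose k : ℝ) *
          ((-1 : ℝ) ^ (k : ℕ) * ((k : ℕ).factorial : ℝ) * 2 ^ (k : ℕ)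
            / Real.Gamma (α + i + (k : ℕ) + 1)))
      / ((i.factorial : ℝ) * (2 ^ i * Real.Gamma (α + i + 1) / Real.Gamma (α + 2 * i + 1)))
  decreasing_by exact k.isLt

/-- `∑_{i=0}^{j+1} b_i 2^i (x/2)^{-α} J_{α+2i}(x)` with the coefficients `b_i` built from `θ`. -/
def besselCombination (α : ℝ) (j : ℕ) (θ : ℕ → ℝ) (x : ℝ) : ℝ :=
  ∑ i ∈ Finset.range (j + 2),
    limitCoeff α θ i * 2 ^ i * (x / 2) ^ (-α) * besselJ (α + 2 * i) x

/-- The function `φ_{α,j}`. -/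
def varphiFun (α : ℝ) (j : ℕ) : ℝ → ℝ :=
  besselCombination α j fun i => ((i : ℝ) - j) / (α + j + i + 1)

/-- The constant `Γ²(α+j+1) 2^{α+β+2j+1} (α+2j+1)`. -/
def massConst (α β : ℝ) (j : ℕ) : ℝ :=
  Real.Gamma (α + j + 1) ^ 2 * (2 : ℝ) ^ (α + β + 2 * j + 1) * (α + 2 * j + 1)

/-- The function `ψ_{α,j}` (it also depends on `β` and `M`). -/
def psiFun (α β : ℝ) (j : ℕ) (M : ℝ) : ℝ → ℝ :=
  besselCombination α j fun i =>
    (M * ((i : ℝ) - j) + massConst α β j * (α + j + i + 1))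
      / ((α + j + i + 1) * (M + massConst α β j))

/-- The threshold `2^{α+β+2j+1} (α+j+1) (α+2j+1) Γ²(α+j+1) / j`. -/
def massThreshold (α β : ℝ) (j : ℕ) : ℝ :=
  (2 : ℝ) ^ (α + β + 2 * j + 1) * (α + j + 1) * (α + 2 * j + 1)
    * Real.Gamma (α + j + 1) ^ 2 / j

/-- `t` is the `i`-th positive zero of `f` (`i ≥ 1`, in increasing order): `t` is a positive zero
and exactly `i` zeros of `f` lie in `(0, t]`. -/
def IsNthPosZero (f : ℝ → ℝ) (i : ℕ) (t : ℝ) : Prop :=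
  0 < t ∧ f t = 0 ∧ {s : ℝ | 0 < s ∧ s ≤ t ∧ f s = 0}.encard = i

end

/-!
In the variable `t = (1 - x) / 2` the form is a Jacobi functional plus a mass on the `j`-th
coefficients, so its orthogonal polynomial is `R_n - λ_n K_n`, with `R_n` the Jacobi polynomial and
`K_n` the kernel polynomial representing the `j`-th coefficient. In the scale `w = 4 n² t` both
terms converge coefficientwise, with an entire dominating series, and the limit depends on the
masses only through the limit `c ∈ [0, 1]` of `μ_n K / (1 + μ_n K)`, where `μ_n` is the transformed
mass and `K` the `j`-th coefficient of `K_n`: one has `c = 0`, `c = 1`, or `c = M / (M + D)` in the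
three ranges of `γ`. Undoing the recursion for `b_i` identifies the limit as
`∑ a_i (1 - c (α+2j+1) / (α+j+1+i)) w^i`, where `∑ a_i w^i` is the normalized Bessel series, with
`J_α`, `φ` and `ψ` at `w = x²`.

A sign-change count shows that all zeros in `t` are real and simple and that all but the least are
positive. No zero is lost or merged in the limit. The limit has exponential type zero and
coefficients of eventually alternating sign, so it is not a polynomial times an exponential, as it
would be if only finitely many zeros stayed bounded. And its zeros in `[0, ∞)` are simple: a double
zero would be a zero of the Laguerre expression `(θp)² - p θ²p`, `θ = w d/dw`, of the kernel series,
and then a double zero of the Bessel series. Whether the least zero has a positive limit is read off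
from the sign of the limit function at `0`, which changes exactly at `M = V`.
-/

noncomputable section

/-- The sum `∑ a_l w^l` of the power series with coefficients `a`, as a function of a real `w`. -/
def seriesSum (a : ℕ → ℝ) (w : ℝ) : ℝ := ∑' l, a l * w ^ l

lemma seriesSum_zero (a : ℕ → ℝ) : seriesSum a 0 = a 0 := by
  rw [seriesSum, tsum_eq_single 0 fun l hl => by rw [zero_pow hl, mul_zero], pow_zero, mul_one]

/-- Coefficient sequences of the power series that converge absolutely on the whole line. -/
def IsEntireSeq (a : ℕ → ℝ) : Prop := ∀ r : ℝ, 0 ≤ r → Summable fun l => |a l| * r ^ l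

/-- The coefficients of the derivative of a power series. -/
def derivSeq (a : ℕ → ℝ) (l : ℕ) : ℝ := (l + 1) * a (l + 1)

lemma seriesSum_const_mul (c : ℝ) (a : ℕ → ℝ) (w : ℝ) :
    seriesSum (fun l => c * a l) w = c * seriesSum a w := by
  simp only [seriesSum, ← tsum_mul_left, mul_assoc]

lemma seriesSum_coeff (p : ℝ[X]) (w : ℝ) : seriesSum p.coeff w = p.eval w := by
  rw [seriesSum, eval_eq_sum, Polynomial.sum, tsum_eq_sum]
  intro l hl
  rw [notMem_support_iff.1 hl, zero_mul]

lemma derivSeq_coeff (p : ℝ[X]) : derivSeq p.coeff = (derivative p).coeff := by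
  ext l
  rw [derivSeq, coeff_derivative, mul_comm]

namespace IsEntireSeq

variable {a b : ℕ → ℝ}

lemma of_abs_le (hb : IsEntireSeq b) (h : ∀ l, |a l| ≤ |b l|) : IsEntireSeq a := fun r hr =>
  (hb r hr).of_nonneg_of_le (fun l => by positivity)
    fun l => mul_le_mul_of_nonneg_right (h l) (by positivity)

lemma hasSum (ha : IsEntireSeq a) (w : ℝ) : HasSum (fun l => a l * w ^ l) (seriesSum a w) := by
  refine (Summable.of_norm ?_).hasSum
  simpa only [Real.norm_eq_abs, abs_mul, abs_pow] using ha |w| (abs_nonneg w)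

lemma const_mul (ha : IsEntireSeq a) (c : ℝ) : IsEntireSeq fun l => c * a l := fun r hr =>
  ((ha r hr).mul_left |c|).congr fun l => by rw [abs_mul, mul_assoc]

lemma add (ha : IsEntireSeq a) (hb : IsEntireSeq b) : IsEntireSeq fun l => a l + b l :=
  fun r hr => ((ha r hr).add (hb r hr)).of_nonneg_of_le (fun l => by positivity) fun l => by
    rw [← add_mul]
    exact mul_le_mul_of_nonneg_right (abs_add_le _ _) (by positivity)

lemma derivSeq (ha : IsEntireSeq a) : IsEntireSeq (derivSeq a) := by
  intro r hr
  have hsum := (summable_nat_add_iff 1).2 (ha (2 * max r 1) (by positivity))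
  refine hsum.of_nonneg_of_le (fun l => by positivity) fun l => ?_
  have hl : (l : ℝ) + 1 ≤ 2 ^ (l + 1) := by
    exact_mod_cast (Nat.lt_two_pow_self (n := l + 1)).le
  have hr1 : r ^ l ≤ max r 1 ^ (l + 1) :=
    (pow_le_pow_left₀ hr (le_max_left r 1) l).trans
      (pow_le_pow_right₀ (le_max_right r 1) (Nat.le_succ l))
  calc |_root_.derivSeq a l| * r ^ l = |a (l + 1)| * ((l + 1) * r ^ l) := by
        rw [_root_.derivSeq, abs_mul, abs_of_nonneg (by positivity : (0 : ℝ) ≤ l + 1)]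
        ring
    _ ≤ |a (l + 1)| * (2 ^ (l + 1) * max r 1 ^ (l + 1)) := by gcongr
    _ = |a (l + 1)| * (2 * max r 1) ^ (l + 1) := by rw [mul_pow]

lemma natCast_mul (ha : IsEntireSeq a) : IsEntireSeq fun l => l * a l := by
  intro r hr
  refine (summable_nat_add_iff 1).1 (((ha.derivSeq r hr).mul_left r).congr fun l => ?_)
  simp only [_root_.derivSeq, Nat.cast_succ]
  ring

lemma hasSum_deriv (ha : IsEntireSeq a) (w : ℝ) :
    HasSum (fun l : ℕ => a l * (l * w ^ (l - 1))) (seriesSum (_root_.derivSeq a) w) := by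
  have h := (hasSum_nat_add_iff (f := fun l : ℕ => a l * (l * w ^ (l - 1))) 1).1
    ((ha.derivSeq.hasSum w).congr_fun fun l => ?_)
  · simpa using h
  · simp only [_root_.derivSeq, Nat.add_sub_cancel, Nat.cast_succ]
    ring

lemma seriesSum_natCast_mul (ha : IsEntireSeq a) (w : ℝ) :
    seriesSum (fun l => l * a l) w = w * seriesSum (_root_.derivSeq a) w := by
  refine (((ha.hasSum_deriv w).mul_left w).congr_fun fun l => ?_).tsum_eq
  rcases l with _ | l
  · simp
  · rw [Nat.add_sub_cancel, pow_succ]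
    ring

lemma seriesSum_add (ha : IsEntireSeq a) (hb : IsEntireSeq b) (w : ℝ) :
    seriesSum (fun l => a l + b l) w = seriesSum a w + seriesSum b w :=
  (((ha.hasSum w).add (hb.hasSum w)).congr_fun fun _ => add_mul _ _ _).tsum_eq

lemma hasDerivAt (ha : IsEntireSeq a) (w : ℝ) :
    HasDerivAt (seriesSum a) (seriesSum (_root_.derivSeq a) w) w := by
  have hball : ∀ {y : ℝ}, y ∈ Metric.ball 0 (|w| + 1) ↔ |y| < |w| + 1 := by
    simp
  rw [← (ha.hasSum_deriv w).tsum_eq]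
  refine hasDerivAt_tsum_of_isPreconnected (ha.hasSum_deriv (|w| + 1)).summable.abs
    Metric.isOpen_ball (convex_ball 0 _).isPreconnected
    (fun l y _ => (hasDerivAt_pow l y).const_mul (a l)) (fun l y hy => ?_)
    (hball.2 (by rw [abs_zero]; positivity)) (ha.hasSum 0).summable (hball.2 (lt_add_one _))
  have hy' : |y| ≤ |(|w| + 1)| := (hball.1 hy).le.trans (le_abs_self _)
  simp only [Real.norm_eq_abs, abs_mul, abs_pow]
  gcongr ?_ * (?_ * ?_ ^ _)

lemma continuous (ha : IsEntireSeq a) : Continuous (seriesSum a) :=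
  continuous_iff_continuousAt.2 fun w => (ha.hasDerivAt w).continuousAt

end IsEntireSeq

/-- Coefficientwise convergence `a n → b` of power series along the filter `F`, dominated by the
entire series `C`. -/
structure DominatedTendsto {ι : Type*} (F : Filter ι) (a : ι → ℕ → ℝ) (b C : ℕ → ℝ) : Prop where
  isEntireSeq_bound : IsEntireSeq C
  eventually_abs_le : ∀ᶠ n in F, ∀ l, |a n l| ≤ C l
  tendsto_coeff : ∀ l, Tendsto (fun n => a n l) F (𝓝 (b l))

namespace DominatedTendsto

variable {ι : Type*} {F : Filter ι} {a : ι → ℕ → ℝ} {b C : ℕ → ℝ}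

lemma mono (h : DominatedTendsto F a b C) {F' : Filter ι} (hF : F' ≤ F) :
    DominatedTendsto F' a b C :=
  ⟨h.1, hF h.2, fun l => (h.3 l).mono_left hF⟩

lemma congr' (h : DominatedTendsto F a b C) {a' : ι → ℕ → ℝ}
    (ha : ∀ᶠ n in F, ∀ l, a n l = a' n l) : DominatedTendsto F a' b C where
  isEntireSeq_bound := h.isEntireSeq_bound
  eventually_abs_le := by
    filter_upwards [h.eventually_abs_le, ha] with n hn ha l
    exact ha l ▸ hn l
  tendsto_coeff l := (h.tendsto_coeff l).congr' (ha.mono fun _ hn => hn l)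

lemma abs_le [F.NeBot] (h : DominatedTendsto F a b C) (l : ℕ) : |b l| ≤ C l :=
  le_of_tendsto (h.tendsto_coeff l).abs (h.eventually_abs_le.mono fun _ hn => hn l)

lemma isEntireSeq [F.NeBot] (h : DominatedTendsto F a b C) : IsEntireSeq b :=
  h.isEntireSeq_bound.of_abs_le fun l => (h.abs_le l).trans (le_abs_self _)

lemma derivSeq (h : DominatedTendsto F a b C) :
    DominatedTendsto F (fun n => derivSeq (a n)) (derivSeq b) (derivSeq C) where
  isEntireSeq_bound := h.isEntireSeq_bound.derivSeq
  eventually_abs_le := h.eventually_abs_le.mono fun n hn l => by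
    rw [_root_.derivSeq, abs_mul, abs_of_nonneg (by positivity : (0 : ℝ) ≤ l + 1)]
    exact mul_le_mul_of_nonneg_left (hn _) (by positivity)
  tendsto_coeff l := (h.tendsto_coeff (l + 1)).const_mul _

lemma natCast_mul (h : DominatedTendsto F a b C) :
    DominatedTendsto F (fun n l => l * a n l) (fun l => l * b l) (fun l => l * C l) where
  isEntireSeq_bound := h.isEntireSeq_bound.natCast_mul
  eventually_abs_le := h.eventually_abs_le.mono fun n hn l => by
    rw [abs_mul, Nat.abs_cast]
    exact mul_le_mul_of_nonneg_left (hn _) l.cast_nonneg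
  tendsto_coeff l := (h.tendsto_coeff l).const_mul _

lemma tendsto_seriesSum (h : DominatedTendsto F a b C) {w : ι → ℝ} {w₀ : ℝ}
    (hw : Tendsto w F (𝓝 w₀)) :
    Tendsto (fun n => seriesSum (a n) (w n)) F (𝓝 (seriesSum b w₀)) := by
  have hbdd : ∀ᶠ n in F, |w n| ≤ |w₀| + 1 :=
    (hw.abs.eventually (gt_mem_nhds (lt_add_one |w₀|))).mono fun n hn => hn.le
  refine tendsto_tsum_of_dominated_convergence (h.isEntireSeq_bound (|w₀| + 1) (by positivity))
    (fun l => (h.tendsto_coeff l).mul (hw.pow l)) ?_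
  filter_upwards [hbdd, h.eventually_abs_le] with n hn hC l
  rw [Real.norm_eq_abs, abs_mul, abs_pow]
  have hC' : |a n l| ≤ |C l| := (hC l).trans (le_abs_self _)
  gcongr ?_ * ?_ ^ _

lemma tendsto_eval {p : ι → ℝ[X]} (h : DominatedTendsto F (fun n => (p n).coeff) b C)
    {w : ι → ℝ} {w₀ : ℝ} (hw : Tendsto w F (𝓝 w₀)) :
    Tendsto (fun n => (p n).eval (w n)) F (𝓝 (seriesSum b w₀)) := by
  simpa only [seriesSum_coeff] using h.tendsto_seriesSum hw

end DominatedTendsto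

section Growth

open Asymptotics

/-- The power series with coefficients `b` has exponential type zero: it is `O(exp (ε |w|))` for
every `ε > 0`. The condition is stated on the coefficients. -/
def HasExpTypeZero (b : ℕ → ℝ) : Prop :=
  ∀ ε > 0, ∃ K, ∀ l, |b l| * (l.factorial : ℝ) ≤ K * ε ^ l

lemma HasExpTypeZero.isLittleO_exp {b : ℕ → ℝ} (hb : HasExpTypeZero b) {ε : ℝ} (hε : 0 < ε) :
    (fun v => seriesSum b (-v)) =o[atTop] fun v => Real.exp (ε * v) := by
  obtain ⟨K, hK⟩ := hb (ε / 2) (half_pos hε)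
  have hbound : ∀ v : ℝ, 0 ≤ v → ‖seriesSum b (-v)‖ ≤ K * ‖Real.exp (ε / 2 * v)‖ := by
    intro v hv
    have hexp : HasSum (fun l : ℕ => K * ((ε / 2 * v) ^ l / l.factorial))
        (K * Real.exp (ε / 2 * v)) := by
      rw [Real.exp_eq_exp_ℝ]
      exact (NormedSpace.expSeries_div_hasSum_exp (ε / 2 * v)).mul_left K
    rw [Real.norm_eq_abs (Real.exp _), Real.abs_exp]
    refine tsum_of_norm_bounded hexp fun l => ?_
    have hbl : |b l| ≤ K * (ε / 2) ^ l / l.factorial := (le_div_iff₀ (by positivity)).2 (hK l)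
    calc ‖b l * (-v) ^ l‖ = |b l| * v ^ l := by
          rw [norm_mul, norm_pow, norm_neg, Real.norm_eq_abs, Real.norm_of_nonneg hv]
      _ ≤ K * (ε / 2) ^ l / l.factorial * v ^ l := by gcongr
      _ = K * ((ε / 2 * v) ^ l / l.factorial) := by rw [mul_pow]; ring
  have hhalf : (fun v => seriesSum b (-v)) =O[atTop] fun v => Real.exp (ε / 2 * v) :=
    IsBigO.of_bound K ((eventually_ge_atTop 0).mono hbound)
  refine hhalf.trans_isLittleO (Real.isLittleO_exp_comp_exp_comp.2 ?_)
  have hsub : ∀ v : ℝ, ε / 2 * v = ε * v - ε / 2 * v := fun v => by ring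
  exact (tendsto_id.const_mul_atTop (half_pos hε)).congr hsub

lemma HasExpTypeZero.base_le_one {b : ℕ → ℝ} (hb : HasExpTypeZero b) {v c K : ℝ} (hK : 0 < K)
    (hc : 0 < c) (hle : ∀ t ≥ 0, K * c ^ t ≤ seriesSum b (-(v + t))) : c ≤ 1 := by
  by_contra! hc1
  have hlog := Real.log_pos hc1
  have hsmall := (hb.isLittleO_exp hlog).def (c := K * Real.exp (-(Real.log c * v)) / 2)
    (by positivity)
  have hshift : Tendsto (fun t : ℝ => v + t) atTop atTop :=
    tendsto_atTop_add_const_left _ v tendsto_id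
  obtain ⟨t, hlt, ht⟩ := ((hshift.eventually hsmall).and (eventually_ge_atTop 0)).exists
  have hexp : Real.exp (-(Real.log c * v)) * Real.exp (Real.log c * (v + t)) = c ^ t := by
    rw [← Real.exp_add, Real.rpow_def_of_pos hc]
    ring_nf
  have hbound := calc K * c ^ t ≤ ‖seriesSum b (-(v + t))‖ := (hle t ht).trans (le_abs_self _)
    _ ≤ K * Real.exp (-(Real.log c * v)) / 2 * Real.exp (Real.log c * (v + t)) := by
        simpa only [Real.norm_eq_abs, Real.abs_exp] using hlt
    _ = K * c ^ t / 2 := by rw [← hexp]; ring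
  linarith [mul_pos hK (Real.rpow_pos_of_pos hc t)]

namespace IsEntireSeq

variable {b : ℕ → ℝ}

lemma sum_range_le_of_alternating (hb : IsEntireSeq b) {m : ℕ}
    (hpos : ∀ l ≥ m, 0 < (-1) ^ l * b l) {v : ℝ} (hv : 0 ≤ v) :
    ∑ l ∈ Finset.range m, (-1) ^ l * b l * v ^ l ≤ seriesSum b (-v) := by
  have hsum : HasSum (fun l => (-1) ^ l * b l * v ^ l) (seriesSum b (-v)) :=
    (hb.hasSum (-v)).congr_fun fun l => by rw [neg_pow]; ring
  refine sum_le_hasSum _ (fun l hl => ?_) hsum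
  exact mul_nonneg (hpos l (not_lt.1 fun h => hl (Finset.mem_range.2 h))).le (pow_nonneg hv l)

lemma eventually_mul_pow_le_of_alternating (hb : IsEntireSeq b)
    (hpos : ∀ᶠ l in atTop, 0 < (-1) ^ l * b l) (K : ℝ) (N : ℕ) :
    ∀ᶠ v in atTop, K * v ^ N ≤ seriesSum b (-v) := by
  obtain ⟨m, hm⟩ := eventually_atTop.1 (hpos.and (eventually_gt_atTop N))
  obtain ⟨hlead, hN⟩ := hm m le_rfl
  set low : ℝ[X] := ∑ l ∈ Finset.range m, C ((-1) ^ l * b l) * X ^ l - C K * X ^ N with hlow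
  have hsum : (∑ l ∈ Finset.range m, C ((-1) ^ l * b l) * X ^ l).degree < (m : WithBot ℕ) :=
    (degree_lt_iff_coeff_zero _ _).2 fun k hk => by
      simp only [finsetSum_coeff, coeff_C_mul_X_pow]
      exact Finset.sum_eq_zero fun l hl =>
        if_neg ((Finset.mem_range.1 hl).trans_le hk).ne'
  have hdeg : low.degree < (C ((-1) ^ m * b m) * X ^ m).degree := by
    rw [degree_C_mul_X_pow m hlead.ne']
    exact (degree_sub_le _ _).trans_lt (max_lt hsum
      ((degree_C_mul_X_pow_le N K).trans_lt (WithBot.coe_lt_coe.2 hN)))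
  have hlim := tendsto_atTop_of_leadingCoeff_nonneg (low + C ((-1) ^ m * b m) * X ^ m)
    (by
      rw [degree_add_eq_right_of_degree_lt hdeg, degree_C_mul_X_pow m hlead.ne']
      exact WithBot.coe_lt_coe.2 (N.zero_le.trans_lt hN))
    (by
      rw [leadingCoeff_add_of_degree_lt hdeg, leadingCoeff_C_mul_X_pow]
      exact hlead.le)
  filter_upwards [hlim.eventually_ge_atTop 0, eventually_ge_atTop 0] with v hv hv0
  have hle := hb.sum_range_le_of_alternating
    (fun l hl => (hm l (m.le_succ.trans hl)).1) hv0
  rw [Finset.sum_range_succ] at hle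
  simp only [hlow, eval_add, eval_sub, eval_finsetSum, eval_mul, eval_C, eval_pow, eval_X] at hv
  linarith

lemma eventually_pos_of_alternating (hb : IsEntireSeq b)
    (hpos : ∀ᶠ l in atTop, 0 < (-1) ^ l * b l) : ∀ᶠ v in atTop, 0 < seriesSum b (-v) :=
  (hb.eventually_mul_pow_le_of_alternating hpos 1 0).mono fun v hv =>
    zero_lt_one.trans_le (by simpa using hv)

lemma not_le_mul_pow_of_alternating (hb : IsEntireSeq b)
    (hpos : ∀ᶠ l in atTop, 0 < (-1) ^ l * b l) {v K : ℝ} {N : ℕ} :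
    ¬ ∀ t ≥ 0, seriesSum b (-(v + t)) ≤ K * (1 + t) ^ N := by
  intro hle
  have hgrow := hb.eventually_mul_pow_le_of_alternating hpos ((|K| + 1) * 2 ^ N) N
  have hshift : Tendsto (fun t : ℝ => v + t) atTop atTop :=
    tendsto_atTop_add_const_left _ v tendsto_id
  obtain ⟨t, hgt, ht⟩ := ((hshift.eventually hgrow).and
    (eventually_ge_atTop (max 0 (1 - 2 * v)))).exists
  obtain ⟨ht0, htv⟩ := max_le_iff.1 ht
  have hpow : (1 + t) ^ N ≤ 2 ^ N * (v + t) ^ N := by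
    rw [← mul_pow]
    exact pow_le_pow_left₀ (by linarith) (by linarith) N
  have hpow0 : 0 < (1 + t) ^ N := by positivity
  have hle' := calc (|K| + 1) * (1 + t) ^ N
      ≤ (|K| + 1) * (2 ^ N * (v + t) ^ N) := by gcongr
    _ ≤ K * (1 + t) ^ N := by rw [← mul_assoc]; exact hgt.trans (hle t ht0)
  have hK := le_of_mul_le_mul_right hle' hpow0
  linarith [le_abs_self K]

end IsEntireSeq

end Growth

section Products

lemma one_add_mul_le_rpow {x e t : ℝ} (hx : 0 ≤ x) (hxe : x ≤ e) (ht : 0 ≤ t) :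
    1 + t * x ≤ (1 + x) ^ (t * (1 + e)) := by
  have h1x : 0 < 1 + x := by positivity
  have hlog0 : 0 ≤ Real.log (1 + x) := Real.log_nonneg (by linarith)
  have hlog : x ≤ (1 + e) * Real.log (1 + x) := calc
    x = (1 + x) * (1 - (1 + x)⁻¹) := by field_simp; ring
    _ ≤ (1 + x) * Real.log (1 + x) := by gcongr; exact Real.one_sub_inv_le_log_of_pos h1x
    _ ≤ (1 + e) * Real.log (1 + x) := by gcongr
  calc 1 + t * x ≤ Real.exp (t * x) := by linarith [Real.add_one_le_exp (t * x)]
    _ ≤ Real.exp (t * ((1 + e) * Real.log (1 + x))) := by gcongr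
    _ = (1 + x) ^ (t * (1 + e)) := by rw [Real.rpow_def_of_pos h1x]; ring_nf

lemma rpow_le_one_add_mul {x e t : ℝ} (hx : 0 ≤ x) (hxe : x ≤ e) (ht : 0 ≤ t) :
    (1 + x) ^ (t / (1 + t * e)) ≤ 1 + t * x := by
  rcases ht.eq_or_lt with rfl | ht
  · simp
  have he : 0 ≤ e := hx.trans hxe
  have h := one_add_mul_le_rpow (t := t⁻¹) (by positivity : 0 ≤ t * x)
    (by gcongr : t * x ≤ t * e) (by positivity)
  rw [inv_mul_cancel_left₀ ht.ne'] at h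
  calc (1 + x) ^ (t / (1 + t * e))
      ≤ ((1 + t * x) ^ (t⁻¹ * (1 + t * e))) ^ (t / (1 + t * e)) := by gcongr
    _ = 1 + t * x := by
        rw [← Real.rpow_mul (by positivity)]
        have hexp : t⁻¹ * (1 + t * e) * (t / (1 + t * e)) = 1 := by field_simp
        rw [hexp, Real.rpow_one]

/- As the `x n k` tend to `0` uniformly in `k`, the factor `1 + t x` is squeezed between powers of
`1 + x` whose exponents tend to `t`. -/
lemma tendsto_prod_one_add_mul {ι κ : Type*} {F : Filter ι} {s : ι → Finset κ} {x : ι → κ → ℝ}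
    {e : ι → ℝ} {c t : ℝ} (he : Tendsto e F (𝓝 0))
    (hx : ∀ᶠ n in F, ∀ k ∈ s n, 0 ≤ x n k ∧ x n k ≤ e n) (hc : 0 < c)
    (h : Tendsto (fun n => ∏ k ∈ s n, (1 + x n k)) F (𝓝 c)) (ht : 0 ≤ t) :
    Tendsto (fun n => ∏ k ∈ s n, (1 + t * x n k)) F (𝓝 (c ^ t)) := by
  have hlow : Tendsto (fun n => t / (1 + t * e n)) F (𝓝 t) := by
    have hden : Tendsto (fun n => 1 + t * e n) F (𝓝 1) := by
      simpa using (he.const_mul t).const_add 1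
    simpa only [div_one, Pi.div_def] using (tendsto_const_nhds (x := t)).div hden one_ne_zero
  have hupp : Tendsto (fun n => t * (1 + e n)) F (𝓝 t) := by
    simpa using (he.const_add 1).const_mul t
  refine tendsto_of_tendsto_of_tendsto_of_le_of_le' (h.rpow hlow (Or.inl hc.ne'))
    (h.rpow hupp (Or.inl hc.ne')) ?_ ?_
  · filter_upwards [hx] with n hn
    have hnonneg : ∀ k ∈ s n, 0 ≤ 1 + x n k := fun k hk => add_nonneg zero_le_one (hn k hk).1
    rw [← Real.finsetProd_rpow _ _ hnonneg]
    exact Finset.prod_le_prod (fun k hk => Real.rpow_nonneg (hnonneg k hk) _)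
      fun k hk => rpow_le_one_add_mul (hn k hk).1 (hn k hk).2 ht
  · filter_upwards [hx] with n hn
    rw [← Real.finsetProd_rpow _ _ fun k hk => add_nonneg zero_le_one (hn k hk).1]
    exact Finset.prod_le_prod
      (fun k hk => add_nonneg zero_le_one (mul_nonneg ht (hn k hk).1))
      fun k hk => one_add_mul_le_rpow (hn k hk).1 (hn k hk).2 ht

end Products

section RootLimits

/-- The polynomials `p n` have the roots `w n 0 < ⋯ < w n (n - 1)`, of which only the first may fail
to be positive, and converge to the entire series with coefficients `b`. The conditions on `b` are
those under which no root is lost in the limit: the coefficients eventually alternate, the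
exponential type is zero, and the zeros in `[0, ∞)` are simple. -/
structure AlternatingLimit (F : Filter ℕ) (p : ℕ → ℝ[X]) (w : ℕ → ℕ → ℝ) (b C : ℕ → ℝ) : Prop where
  le_atTop : F ≤ atTop
  dominated : DominatedTendsto F (fun n => (p n).coeff) b C
  eval_eq_prod : ∀ᶠ n in F, ∃ c > 0, ∀ x, (p n).eval x = c * ∏ k ∈ Finset.range n, (w n k - x)
  strictMonoOn : ∀ᶠ n in F, StrictMonoOn (w n) (Iio n)
  root_pos : ∀ᶠ n in F, ∀ k, 0 < k → k < n → 0 < w n k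
  coeff_alternating : ∀ᶠ l in atTop, 0 < (-1) ^ l * b l
  coeff_alternating_of_zero : b 0 = 0 → ∀ l ≥ 1, 0 < (-1) ^ l * b l
  expTypeZero : HasExpTypeZero b
  simple : ∀ x, 0 ≤ x → seriesSum b x = 0 → seriesSum (derivSeq b) x ≠ 0

namespace AlternatingLimit

variable {F : Filter ℕ} {p : ℕ → ℝ[X]} {w : ℕ → ℕ → ℝ} {b C : ℕ → ℝ}

lemma mono (h : AlternatingLimit F p w b C) {G : Filter ℕ} (hG : G ≤ F) :
    AlternatingLimit G p w b C where
  le_atTop := hG.trans h.le_atTop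
  dominated := h.dominated.mono hG
  eval_eq_prod := hG h.eval_eq_prod
  strictMonoOn := hG h.strictMonoOn
  root_pos := hG h.root_pos
  coeff_alternating := h.coeff_alternating
  coeff_alternating_of_zero := h.coeff_alternating_of_zero
  expTypeZero := h.expTypeZero
  simple := h.simple

lemma isRoot_iff (h : AlternatingLimit F p w b C) :
    ∀ᶠ n in F, ∀ x, (p n).eval x = 0 ↔ ∃ k < n, w n k = x := by
  filter_upwards [h.eval_eq_prod] with n ⟨c, hc, he⟩ x
  simp only [he, mul_eq_zero, hc.ne', false_or, Finset.prod_eq_zero_iff, Finset.mem_range,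
    sub_eq_zero]

lemma lt_root_zero (h : AlternatingLimit F p w b C) {x : ℝ} (hx : x ≤ 0)
    (hpos : 0 < seriesSum b x) : ∀ᶠ n in F, x < w n 0 := by
  filter_upwards [h.eval_eq_prod, h.root_pos, h.le_atTop (eventually_gt_atTop 0),
    (h.dominated.tendsto_eval tendsto_const_nhds).eventually (lt_mem_nhds hpos)]
    with n ⟨c, hc, he⟩ hp hn hx0
  by_contra! hle
  rw [he, Finset.range_eq_Ico, Finset.prod_eq_prod_Ico_succ_bot hn] at hx0
  have htail : 0 ≤ ∏ k ∈ Finset.Ico (0 + 1) n, (w n k - x) := Finset.prod_nonneg fun k hk =>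
    sub_nonneg.2 (hx.trans (hp k (Finset.mem_Ico.1 hk).1 (Finset.mem_Ico.1 hk).2).le)
  exact hx0.not_ge (mul_nonpos_of_nonneg_of_nonpos hc.le
    (mul_nonpos_of_nonpos_of_nonneg (sub_nonpos.2 hle) htail))

lemma root_zero_lt (h : AlternatingLimit F p w b C) {x : ℝ} (hneg : seriesSum b x < 0) :
    ∀ᶠ n in F, w n 0 < x := by
  filter_upwards [h.eval_eq_prod, h.strictMonoOn,
    (h.dominated.tendsto_eval tendsto_const_nhds).eventually (gt_mem_nhds hneg)]
    with n ⟨c, hc, he⟩ hmono hx0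
  by_contra! hle
  rw [he] at hx0
  refine hx0.not_ge (mul_nonneg hc.le (Finset.prod_nonneg fun k hk => sub_nonneg.2 ?_))
  have hk' := Finset.mem_range.1 hk
  exact hle.trans (hmono.monotoneOn (mem_Iio.2 (k.zero_le.trans_lt hk')) hk' k.zero_le)

lemma eval_neg_add (h : AlternatingLimit F p w b C) {v : ℝ}
    (hv : ∀ᶠ n in F, ∀ k < n, 1 ≤ w n k + v) :
    ∀ᶠ n in F, ∀ t, (p n).eval (-(v + t))
      = (p n).eval (-v) * ∏ k ∈ Finset.range n, (1 + t * (w n k + v)⁻¹) := by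
  filter_upwards [h.eval_eq_prod, hv] with n ⟨c, _, he⟩ hn t
  rw [he, he, mul_assoc, ← Finset.prod_mul_distrib]
  congr 1
  refine Finset.prod_congr rfl fun k hk => ?_
  have hne : w n k + v ≠ 0 := (zero_lt_one.trans_le (hn k (Finset.mem_range.1 hk))).ne'
  field_simp
  ring

section Factorization

variable [F.NeBot] {ζ : ℕ → ℝ} {N : ℕ}

lemma exists_shift (h : AlternatingLimit F p w b C) :
    ∃ v, 0 < seriesSum b (-v) ∧ ∀ᶠ n in F, ∀ k < n, 1 ≤ w n k + v := by
  have hpos := h.dominated.isEntireSeq.eventually_pos_of_alternating h.coeff_alternating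
  obtain ⟨v, hv⟩ := eventually_atTop.1 (hpos.and (eventually_ge_atTop 0))
  refine ⟨v + 1, (hv _ (by linarith)).1, ?_⟩
  filter_upwards [h.lt_root_zero (neg_nonpos.2 (hv v le_rfl).2) (hv v le_rfl).1, h.strictMonoOn]
    with n hn hmono k hk
  have hle := hmono.monotoneOn (mem_Iio.2 (k.zero_le.trans_lt hk)) hk k.zero_le
  linarith

lemma one_le_limit_add (h : AlternatingLimit F p w b C) {v : ℝ}
    (hv : ∀ᶠ n in F, ∀ k < n, 1 ≤ w n k + v) {k : ℕ} {z : ℝ}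
    (hz : Tendsto (fun n => w n k) F (𝓝 z)) : 1 ≤ z + v := by
  refine ge_of_tendsto (hz.add_const v) ?_
  filter_upwards [hv, h.le_atTop (eventually_gt_atTop k)] with n hn hk using hn k hk

lemma tendsto_prod_Ico (h : AlternatingLimit F p w b C)
    (hζ : ∀ k < N, Tendsto (fun n => w n k) F (𝓝 (ζ k))) {v : ℝ} (hpos : 0 < seriesSum b (-v))
    (hv : ∀ᶠ n in F, ∀ k < n, 1 ≤ w n k + v) {t : ℝ} (ht : 0 ≤ t) :
    Tendsto (fun n => ∏ k ∈ Finset.Ico N n, (1 + t * (w n k + v)⁻¹)) F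
      (𝓝 (seriesSum b (-(v + t))
        / (seriesSum b (-v) * ∏ k ∈ Finset.range N, (1 + t * (ζ k + v)⁻¹)))) := by
  have hζv : ∀ k < N, 0 < ζ k + v := fun k hk =>
    zero_lt_one.trans_le (h.one_le_limit_add hv (hζ k hk))
  have hnear : Tendsto (fun n => ∏ k ∈ Finset.range N, (1 + t * (w n k + v)⁻¹)) F
      (𝓝 (∏ k ∈ Finset.range N, (1 + t * (ζ k + v)⁻¹))) :=
    tendsto_finsetProd _ fun k hk =>
      ((((hζ k (Finset.mem_range.1 hk)).add_const v).inv₀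
        (hζv k (Finset.mem_range.1 hk)).ne').const_mul t).const_add 1
  have hnear0 : 0 < ∏ k ∈ Finset.range N, (1 + t * (ζ k + v)⁻¹) := Finset.prod_pos fun k hk => by
    have := hζv k (Finset.mem_range.1 hk)
    positivity
  have heval := h.dominated.tendsto_eval (tendsto_const_nhds (x := -v))
  refine ((h.dominated.tendsto_eval tendsto_const_nhds).div (heval.mul hnear)
    (mul_pos hpos hnear0).ne').congr' ?_
  filter_upwards [h.eval_neg_add hv, h.le_atTop (eventually_ge_atTop N),
    heval.eventually (lt_mem_nhds hpos), hnear.eventually (lt_mem_nhds hnear0)]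
    with n hfac hN hp0 hnear_pos
  rw [Pi.div_apply, hfac t, ← Finset.prod_range_mul_prod_Ico _ hN, ← mul_assoc,
    mul_div_cancel_left₀ _ (mul_pos hp0 hnear_pos).ne']

/-- If the roots from the `N`-th on escape to infinity, they contribute only an exponential
factor to the limit. -/
lemma exists_factorization (h : AlternatingLimit F p w b C)
    (hζ : ∀ k < N, Tendsto (fun n => w n k) F (𝓝 (ζ k)))
    (hN : Tendsto (fun n => w n N) F atTop) :
    ∃ v, 0 < seriesSum b (-v) ∧ (∀ k < N, 1 ≤ ζ k + v) ∧ ∃ c > 0, ∀ t ≥ 0,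
      seriesSum b (-(v + t))
        = seriesSum b (-v) * (∏ k ∈ Finset.range N, (1 + t * (ζ k + v)⁻¹)) * c ^ t := by
  obtain ⟨v, hpos, hv⟩ := h.exists_shift
  have hζv : ∀ k < N, 1 ≤ ζ k + v := fun k hk => h.one_le_limit_add hv (hζ k hk)
  have hsmall : Tendsto (fun n => (w n N + v)⁻¹) F (𝓝 0) :=
    (tendsto_atTop_add_const_right F v hN).inv_tendsto_atTop
  have hbound : ∀ᶠ n in F, ∀ k ∈ Finset.Ico N n,
      0 ≤ (w n k + v)⁻¹ ∧ (w n k + v)⁻¹ ≤ (w n N + v)⁻¹ := by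
    filter_upwards [hv, h.strictMonoOn] with n hn hmono k hk
    obtain ⟨hNk, hkn⟩ := Finset.mem_Ico.1 hk
    have hk0 := zero_lt_one.trans_le (hn k hkn)
    have hN0 := zero_lt_one.trans_le (hn N (hNk.trans_lt hkn))
    have hle := hmono.monotoneOn (mem_Iio.2 (hNk.trans_lt hkn)) hkn hNk
    exact ⟨by positivity, by gcongr⟩
  obtain ⟨c, hc⟩ : ∃ c, Tendsto (fun n => ∏ k ∈ Finset.Ico N n, (1 + (w n k + v)⁻¹)) F (𝓝 c) :=
    ⟨_, by simpa only [one_mul] using h.tendsto_prod_Ico hζ hpos hv zero_le_one⟩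
  have hc1 : 1 ≤ c := ge_of_tendsto hc (hbound.mono fun n hn =>
    Finset.one_le_prod fun k hk => le_add_of_nonneg_right (hn k hk).1)
  refine ⟨v, hpos, hζv, c, zero_lt_one.trans_le hc1, fun t ht => ?_⟩
  have hlim := tendsto_nhds_unique (h.tendsto_prod_Ico hζ hpos hv ht)
    (tendsto_prod_one_add_mul hsmall hbound (zero_lt_one.trans_le hc1) hc ht)
  have hnear : 0 < ∏ k ∈ Finset.range N, (1 + t * (ζ k + v)⁻¹) := Finset.prod_pos fun k hk => by
    have := zero_lt_one.trans_le (hζv k (Finset.mem_range.1 hk))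
    positivity
  rw [← hlim, mul_div_cancel₀ _ (mul_pos hpos hnear).ne']

lemma not_tendsto_root_atTop (h : AlternatingLimit F p w b C)
    (hζ : ∀ k < N, Tendsto (fun n => w n k) F (𝓝 (ζ k))) :
    ¬ Tendsto (fun n => w n N) F atTop := by
  intro hN
  obtain ⟨v, hpos, hζv, c, hc, hfac⟩ := h.exists_factorization hζ hN
  have hfactor : ∀ t ≥ 0, ∀ k ∈ Finset.range N,
      1 ≤ 1 + t * (ζ k + v)⁻¹ ∧ 1 + t * (ζ k + v)⁻¹ ≤ 1 + t := by
    intro t ht k hk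
    have hk1 := hζv k (Finset.mem_range.1 hk)
    have := zero_lt_one.trans_le hk1
    exact ⟨le_add_of_nonneg_right (by positivity),
      add_le_add_right (mul_le_of_le_one_right ht (inv_le_one_of_one_le₀ hk1)) 1⟩
  have hlower : ∀ t ≥ 0, seriesSum b (-v) * c ^ t ≤ seriesSum b (-(v + t)) := by
    intro t ht
    rw [hfac t ht]
    have hone := Finset.one_le_prod fun k hk => (hfactor t ht k hk).1
    exact mul_le_mul_of_nonneg_right (le_mul_of_one_le_right hpos.le hone) (by positivity)
  have hc1 : c ≤ 1 := h.expTypeZero.base_le_one hpos hc hlower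
  refine h.dominated.isEntireSeq.not_le_mul_pow_of_alternating h.coeff_alternating
    (v := v) (K := seriesSum b (-v)) (N := N) fun t ht => ?_
  have hprod : ∏ k ∈ Finset.range N, (1 + t * (ζ k + v)⁻¹) ≤ (1 + t) ^ N := by
    simpa using Finset.prod_le_prod
      (fun k hk => zero_le_one.trans (hfactor t ht k hk).1) fun k hk => (hfactor t ht k hk).2
  rw [hfac t ht]
  calc _ ≤ seriesSum b (-v) * (∏ k ∈ Finset.range N, (1 + t * (ζ k + v)⁻¹)) * 1 := by
        have := Finset.prod_nonneg fun k hk => zero_le_one.trans (hfactor t ht k hk).1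
        gcongr
        exact Real.rpow_le_one hc.le hc1 ht
    _ ≤ seriesSum b (-v) * (1 + t) ^ N := by rw [mul_one]; gcongr

end Factorization

lemma exists_tendsto_root {U : Ultrafilter ℕ} (h : AlternatingLimit U p w b C) (k : ℕ) :
    ∃ z, Tendsto (fun n => w n k) U (𝓝 z) := by
  induction k using Nat.strong_induction_on with
  | _ k ih =>
    choose! ζ hζ using ih
    have hnot := h.not_tendsto_root_atTop hζ
    simp only [tendsto_atTop, not_forall, ← Ultrafilter.eventually_not, not_le] at hnot
    obtain ⟨K, hK⟩ := hnot
    obtain ⟨v, -, hv⟩ := h.exists_shift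
    have hmem : ∀ᶠ n in (U : Filter ℕ), w n k ∈ Icc (1 - v) K := by
      filter_upwards [hK, hv, h.le_atTop (eventually_gt_atTop k)]
        with n hn hvn hkn
      exact ⟨sub_le_iff_le_add.2 (hvn k hkn), hn.le⟩
    obtain ⟨z, -, hz⟩ := isCompact_Icc.ultrafilter_le_nhds (U.map fun n => w n k)
      (le_principal_iff.2 hmem)
    exact ⟨z, hz⟩

lemma tendsto_root_div (h : AlternatingLimit F p w b C) (k : ℕ) {u : ℕ → ℝ}
    (hu : Tendsto u F atTop) : Tendsto (fun n => w n k / u n) F (𝓝 0) := by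
  refine (tendsto_iff_ultrafilter _ _ _).2 fun U hU => ?_
  obtain ⟨z, hz⟩ := (h.mono hU).exists_tendsto_root k
  exact hz.div_atTop (hu.mono_left hU)

section Limits

variable [F.NeBot] {ζ : ℕ → ℝ}

lemma seriesSum_limit (h : AlternatingLimit F p w b C) {k : ℕ} {z : ℝ}
    (hz : Tendsto (fun n => w n k) F (𝓝 z)) : seriesSum b z = 0 := by
  refine tendsto_nhds_unique ((h.dominated.tendsto_eval hz).congr' ?_) tendsto_const_nhds
  filter_upwards [h.isRoot_iff, h.le_atTop (eventually_gt_atTop k)] with n hn hk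
  exact (hn _).2 ⟨k, hk, rfl⟩

lemma limit_nonneg (h : AlternatingLimit F p w b C) {k : ℕ} (hk : 0 < k) {z : ℝ}
    (hz : Tendsto (fun n => w n k) F (𝓝 z)) : 0 ≤ z := by
  refine ge_of_tendsto hz ?_
  filter_upwards [h.root_pos, h.le_atTop (eventually_gt_atTop k)] with n hn hkn
  exact (hn k hk hkn).le

/-- Two roots with a common limit would make the limit a double zero, by Rolle's theorem. -/
lemma strictMono_limit (h : AlternatingLimit F p w b C)
    (hζ : ∀ k, Tendsto (fun n => w n k) F (𝓝 (ζ k))) : StrictMono ζ := by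
  refine strictMono_nat_of_lt_succ fun k => lt_of_le_of_ne ?_ fun heq => ?_
  · refine le_of_tendsto_of_tendsto (hζ k) (hζ (k + 1)) ?_
    filter_upwards [h.strictMonoOn, h.le_atTop (eventually_gt_atTop (k + 1))] with n hmono hk
    exact (hmono (k.lt_succ_self.trans hk) hk k.lt_succ_self).le
  have hrolle : ∀ᶠ n in F, ∃ x ∈ Ioo (w n k) (w n (k + 1)), (derivative (p n)).eval x = 0 := by
    filter_upwards [h.strictMonoOn, h.isRoot_iff, h.le_atTop (eventually_gt_atTop (k + 1))]
      with n hmono hroot hk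
    refine exists_hasDerivAt_eq_zero (hmono (k.lt_succ_self.trans hk) hk k.lt_succ_self)
      (p n).continuous.continuousOn ?_ fun x _ => (p n).hasDerivAt x
    rw [(hroot _).2 ⟨k, k.lt_succ_self.trans hk, rfl⟩, (hroot _).2 ⟨k + 1, hk, rfl⟩]
  obtain ⟨ξ, hξ⟩ := hrolle.choice
  have hξlim : Tendsto ξ F (𝓝 (ζ k)) :=
    tendsto_of_tendsto_of_tendsto_of_le_of_le' (hζ k) (heq ▸ hζ (k + 1))
      (hξ.mono fun _ hn => hn.1.1.le) (hξ.mono fun _ hn => hn.1.2.le)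
  refine h.simple (ζ k) (heq ▸ h.limit_nonneg k.succ_pos (hζ (k + 1))) (h.seriesSum_limit (hζ k))
    (tendsto_nhds_unique ((h.dominated.derivSeq.tendsto_seriesSum hξlim).congr' ?_)
      tendsto_const_nhds)
  filter_upwards [hξ] with n hn
  rw [derivSeq_coeff, seriesSum_coeff, hn.2]

lemma tendsto_limit_atTop (h : AlternatingLimit F p w b C)
    (hζ : ∀ k, Tendsto (fun n => w n k) F (𝓝 (ζ k))) : Tendsto ζ atTop atTop := by
  have hmono := h.strictMono_limit hζ
  refine (tendsto_atTop_of_monotone hmono.monotone).resolve_right ?_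
  rintro ⟨z, hz⟩
  have hzero : ∀ k, seriesSum b (ζ k) = 0 := fun k => h.seriesSum_limit (hζ k)
  have hb := h.dominated.isEntireSeq
  have hz0 : seriesSum b z = 0 := tendsto_nhds_unique
    ((hb.continuous.tendsto z).comp hz) (tendsto_const_nhds.congr fun k => (hzero k).symm)
  have hpos : 0 ≤ z := (h.limit_nonneg one_pos (hζ 1)).trans (hmono.monotone.ge_of_tendsto hz 1)
  have hne := (hb.hasDerivAt z).eventually_ne (c := 0) (h.simple z hpos hz0)
  have hlt : ∀ k, ζ k < z := fun k =>
    (hmono k.lt_succ_self).trans_le (hmono.monotone.ge_of_tendsto hz (k + 1))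
  have hz' : Tendsto ζ atTop (𝓝[≠] z) := tendsto_nhdsWithin_iff.2
    ⟨hz, Eventually.of_forall fun k => (hlt k).ne⟩
  obtain ⟨k, hk⟩ := (hz'.eventually hne).exists
  exact hk (hzero k)

end Limits

end AlternatingLimit

end RootLimits

lemma DominatedTendsto.frequently_eval_eq_zero {ι : Type*} {F : Filter ι} [F.NeBot] {p : ι → ℝ[X]}
    {b C : ℕ → ℝ} (h : DominatedTendsto F (fun n => (p n).coeff) b C) {z : ℝ}
    (hz : seriesSum b z = 0) (hz' : seriesSum (_root_.derivSeq b) z ≠ 0) :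
    ∃ᶠ q in F ×ˢ 𝓝 z, (p q.1).eval q.2 = 0 := by
  intro hne
  obtain ⟨P, hP, Q, hQ, hPQ⟩ := eventually_prod_iff.1 hne
  obtain ⟨δ, hδ, hball⟩ := Metric.eventually_nhds_iff_ball.1 hQ
  have hsign : ∀ x ∈ Metric.ball z δ, ∀ y ∈ Metric.ball z δ,
      0 ≤ seriesSum b x * seriesSum b y := by
    intro x hx y hy
    refine ge_of_tendsto ((h.tendsto_eval tendsto_const_nhds).mul
      (h.tendsto_eval tendsto_const_nhds)) (hP.mono fun n hn => ?_)
    have himage := ((convex_ball z δ).isPreconnected.image _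
      (p n).continuous.continuousOn).ordConnected
    have hroot : ∀ u ∈ (fun x => (p n).eval x) '' Metric.ball z δ, u ≠ 0 := by
      rintro _ ⟨r, hr, rfl⟩
      exact hPQ hn (hball r hr)
    by_contra! hneg
    rcases mul_neg_iff.1 hneg with ⟨hx0, hy0⟩ | ⟨hx0, hy0⟩
    · exact hroot 0 (himage.out ⟨y, hy, rfl⟩ ⟨x, hx, rfl⟩ ⟨hy0.le, hx0.le⟩) rfl
    · exact hroot 0 (himage.out ⟨x, hx, rfl⟩ ⟨y, hy, rfl⟩ ⟨hx0.le, hy0.le⟩) rfl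
  have hslope := hasDerivAt_iff_tendsto_slope_zero.1 (h.isEntireSeq.hasDerivAt z)
  have hneg : Tendsto (fun t : ℝ => -t) (𝓝[≠] 0) (𝓝[≠] 0) := by
    refine tendsto_nhdsWithin_iff.2 ⟨?_, ?_⟩
    · simpa using (continuous_neg.tendsto (0 : ℝ)).mono_left nhdsWithin_le_nhds
    · filter_upwards [self_mem_nhdsWithin] with t ht using neg_ne_zero.2 ht
  have hsq := hslope.mul (hslope.comp hneg)
  refine (mul_self_pos.2 hz').not_ge (le_of_tendsto hsq ?_)
  have hnear : ∀ᶠ t : ℝ in 𝓝[≠] 0, t ∈ Metric.ball 0 δ :=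
    nhdsWithin_le_nhds (Metric.ball_mem_nhds 0 hδ)
  filter_upwards [hnear] with t ht
  have hprod := hsign (z + t) (by simpa using ht) (z + -t) (by simpa using ht)
  have ht2 : (0 : ℝ) ≤ t ^ 2 := by positivity
  simp only [Function.comp_apply, hz, sub_zero, smul_eq_mul]
  calc t⁻¹ * seriesSum b (z + t) * ((-t)⁻¹ * seriesSum b (z + -t))
      = -((t ^ 2)⁻¹ * (seriesSum b (z + t) * seriesSum b (z + -t))) := by rw [inv_neg]; ring
    _ ≤ 0 := neg_nonpos.2 (mul_nonneg (inv_nonneg.2 ht2) hprod)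

/-- The number of leading roots `w n 0 < w n 1 < ⋯` whose limits are not positive zeros of the
series with coefficients `b`: it is governed by the sign of the value at `0`. -/
def leadingRoots (b : ℕ → ℝ) : ℕ := if 0 < b 0 then 0 else 1

lemma isNthPosZero_of_strictMono {f : ℝ → ℝ} {ζ : ℕ → ℝ} (hζ : StrictMono ζ) {o : ℕ}
    (hpos : ∀ k, 0 < ζ k ↔ o ≤ k) (hf : ∀ z, 0 < z → (f z = 0 ↔ ∃ k, ζ k = z)) (i : ℕ) :
    IsNthPosZero f (i + 1) (ζ (i + o)) := by
  have hio := (hpos (i + o)).2 (Nat.le_add_left o i)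
  refine ⟨hio, (hf _ hio).2 ⟨_, rfl⟩, ?_⟩
  have himage : {s : ℝ | 0 < s ∧ s ≤ ζ (i + o) ∧ f s = 0} = ζ '' Icc o (i + o) := by
    ext s
    constructor
    · rintro ⟨hs, hle, hfs⟩
      obtain ⟨k, rfl⟩ := (hf s hs).1 hfs
      exact ⟨k, ⟨(hpos k).1 hs, hζ.le_iff_le.1 hle⟩, rfl⟩
    · rintro ⟨k, ⟨hok, hk⟩, rfl⟩
      have hk0 := (hpos k).2 hok
      exact ⟨hk0, hζ.monotone hk, (hf _ hk0).2 ⟨k, rfl⟩⟩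
  rw [himage, hζ.injective.encard_image, ← Finset.coe_Icc, encard_coe_eq_coe_finsetCard,
    Nat.card_Icc]
  congr 1
  omega

namespace IsNthPosZero

lemma unique {f : ℝ → ℝ} {i : ℕ} {s t : ℝ} (hs : IsNthPosZero f i s) (ht : IsNthPosZero f i t) :
    s = t := by
  wlog hst : s ≤ t generalizing s t
  · exact (this ht hs (le_of_not_ge hst)).symm
  refine hst.antisymm (not_lt.1 fun hlt => ?_)
  have hss : {r : ℝ | 0 < r ∧ r ≤ s ∧ f r = 0} ⊂ {r : ℝ | 0 < r ∧ r ≤ t ∧ f r = 0} := by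
    refine ⟨fun r hr => ⟨hr.1, hr.2.1.trans hst, hr.2.2⟩, fun hsub => ?_⟩
    exact (hsub ⟨ht.1, le_rfl, ht.2.1⟩).2.1.not_gt hlt
  have hfin : {r : ℝ | 0 < r ∧ r ≤ s ∧ f r = 0}.Finite :=
    finite_of_encard_eq_coe hs.2.2
  exact (hfin.encard_lt_encard hss).ne (hs.2.2.trans ht.2.2.symm)

lemma sqrt {f g : ℝ → ℝ} (hfg : ∀ x, 0 < x → (f x = 0 ↔ g (x ^ 2) = 0)) {i : ℕ} {z : ℝ}
    (h : IsNthPosZero g i z) : IsNthPosZero f i √z := by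
  obtain ⟨hz, hgz, hcard⟩ := h
  have hsz := Real.sqrt_pos.2 hz
  refine ⟨hsz, (hfg _ hsz).2 (by rwa [Real.sq_sqrt hz.le]), ?_⟩
  have himage : {s : ℝ | 0 < s ∧ s ≤ √z ∧ f s = 0}
      = Real.sqrt '' {s : ℝ | 0 < s ∧ s ≤ z ∧ g s = 0} := by
    ext s
    constructor
    · rintro ⟨hs, hsz, hfs⟩
      exact ⟨s ^ 2, ⟨by positivity, (Real.le_sqrt' hs).1 hsz, (hfg s hs).1 hfs⟩,
        Real.sqrt_sq hs.le⟩
    · rintro ⟨r, ⟨hr, hrz, hgr⟩, rfl⟩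
      have hsr := Real.sqrt_pos.2 hr
      exact ⟨hsr, Real.sqrt_le_sqrt hrz, (hfg _ hsr).2 (by rwa [Real.sq_sqrt hr.le])⟩
  rw [himage, InjOn.encard_image, hcard]
  exact fun x hx y hy hxy => (Real.sqrt_inj hx.1.le hy.1.le).1 hxy

end IsNthPosZero

namespace AlternatingLimit

variable {F : Filter ℕ} {p : ℕ → ℝ[X]} {w : ℕ → ℕ → ℝ} {b C : ℕ → ℝ}

lemma seriesSum_pos_of_neg [F.NeBot] (h : AlternatingLimit F p w b C) (h0 : b 0 = 0) {x : ℝ}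
    (hx : x < 0) : 0 < seriesSum b x := by
  have hterm : ∀ l, b l * x ^ l = (-1) ^ l * b l * (-x) ^ l := fun l => by
    rw [mul_right_comm, ← mul_pow, neg_one_mul, neg_neg, mul_comm]
  have hx' : 0 < -x := neg_pos.2 hx
  refine (h.dominated.isEntireSeq.hasSum x).summable.tsum_pos (fun l => ?_) 1 ?_
  · rcases l.eq_zero_or_pos with rfl | hl
    · rw [h0, zero_mul]
    · rw [hterm]
      exact mul_nonneg (h.coeff_alternating_of_zero h0 l hl).le (pow_nonneg hx'.le l)
  · rw [hterm]
    exact mul_pos (h.coeff_alternating_of_zero h0 1 le_rfl) (pow_pos hx' 1)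

section Limits

variable [F.NeBot] {ζ : ℕ → ℝ}

lemma exists_limit_eq (h : AlternatingLimit F p w b C)
    (hζ : ∀ k, Tendsto (fun n => w n k) F (𝓝 (ζ k))) {z : ℝ} (hz : 0 ≤ z)
    (hz0 : seriesSum b z = 0) : ∃ k, ζ k = z := by
  by_contra! hne
  obtain ⟨N, hN⟩ := ((h.tendsto_limit_atTop hζ).eventually_gt_atTop z).exists
  have hnear : ∀ᶠ q in F ×ˢ 𝓝 z, ∀ k ∈ Finset.range N, w q.1 k ≠ q.2 :=
    (Finset.range N).eventually_all.2 fun k _ =>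
      ((((hζ k).comp tendsto_fst).sub tendsto_snd).eventually_ne (sub_ne_zero.2 (hne k))).mono
        fun _ => sub_ne_zero.1
  have hfar : ∀ᶠ q in F ×ˢ 𝓝 z, q.2 < w q.1 N :=
    tendsto_snd.eventually_lt ((hζ N).comp tendsto_fst) hN
  refine h.dominated.frequently_eval_eq_zero hz0 (h.simple z hz hz0) ?_
  filter_upwards [hnear, hfar, tendsto_fst.eventually h.isRoot_iff,
    tendsto_fst.eventually h.strictMonoOn] with q hq hqN hroot hmono hq0
  obtain ⟨k, hk, hkq⟩ := (hroot _).1 hq0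
  rcases lt_or_ge k N with hkN | hkN
  · exact hq k (Finset.mem_range.2 hkN) hkq
  · have hle := hmono.monotoneOn (mem_Iio.2 (hkN.trans_lt hk)) hk hkN
    linarith

lemma limit_one_pos (h : AlternatingLimit F p w b C)
    (hζ : ∀ k, Tendsto (fun n => w n k) F (𝓝 (ζ k))) : 0 < ζ 1 := by
  refine (h.limit_nonneg one_pos (hζ 1)).lt_of_ne' fun h1 => ?_
  have h0 : b 0 = 0 := (seriesSum_zero b).symm.trans (h1 ▸ h.seriesSum_limit (hζ 1))
  have hneg : ζ 0 < 0 := (h.strictMono_limit hζ one_pos).trans_eq h1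
  exact (h.seriesSum_pos_of_neg h0 hneg).ne' (h.seriesSum_limit (hζ 0))

lemma limit_zero_pos_iff (h : AlternatingLimit F p w b C)
    (hζ : ∀ k, Tendsto (fun n => w n k) F (𝓝 (ζ k))) : 0 < ζ 0 ↔ 0 < b 0 := by
  constructor
  · contrapose!
    intro hb
    rcases hb.lt_or_eq with hneg | h0
    · exact le_of_tendsto (hζ 0)
        ((h.root_zero_lt (by rwa [seriesSum_zero])).mono fun n hn => hn.le)
    · obtain ⟨k, hk⟩ := h.exists_limit_eq hζ le_rfl (by rwa [seriesSum_zero])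
      exact ((h.strictMono_limit hζ).monotone k.zero_le).trans_eq hk
  · intro hb
    have hnonneg : 0 ≤ ζ 0 := ge_of_tendsto (hζ 0)
      ((h.lt_root_zero le_rfl (by rwa [seriesSum_zero])).mono fun n hn => hn.le)
    refine hnonneg.lt_of_ne' fun h0 => hb.ne' ?_
    exact (seriesSum_zero b).symm.trans (h0 ▸ h.seriesSum_limit (hζ 0))

lemma limit_pos_iff (h : AlternatingLimit F p w b C)
    (hζ : ∀ k, Tendsto (fun n => w n k) F (𝓝 (ζ k))) (k : ℕ) :
    0 < ζ k ↔ leadingRoots b ≤ k := by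
  rcases k.eq_zero_or_pos with rfl | hk
  · rw [h.limit_zero_pos_iff hζ, leadingRoots]
    split_ifs with hb <;> simp [hb]
  · refine iff_of_true ((h.limit_one_pos hζ).trans_le ((h.strictMono_limit hζ).monotone hk)) ?_
    rw [leadingRoots]
    split_ifs <;> omega

end Limits

/-- Along every ultrafilter the roots converge to the zeros in order, and the `i`-th positive zero
does not depend on the ultrafilter. -/
lemma exists_isNthPosZero [F.NeBot] (h : AlternatingLimit F p w b C) (i : ℕ) :
    ∃ z, IsNthPosZero (seriesSum b) (i + 1) z ∧
      Tendsto (fun n => w n (i + leadingRoots b)) F (𝓝 z) := by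
  have hlimit : ∀ U : Ultrafilter ℕ, ↑U ≤ F → ∃ z, IsNthPosZero (seriesSum b) (i + 1) z ∧
      Tendsto (fun n => w n (i + leadingRoots b)) U (𝓝 z) := by
    intro U hU
    have hU' := h.mono hU
    choose ζ hζ using hU'.exists_tendsto_root
    refine ⟨_, isNthPosZero_of_strictMono (hU'.strictMono_limit hζ) (hU'.limit_pos_iff hζ)
      (fun z hz => ⟨hU'.exists_limit_eq hζ hz.le, ?_⟩) i, hζ _⟩
    rintro ⟨k, rfl⟩
    exact hU'.seriesSum_limit (hζ k)
  obtain ⟨z, hz, -⟩ := hlimit (Ultrafilter.of F) (Ultrafilter.of_le F)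
  refine ⟨z, hz, (tendsto_iff_ultrafilter _ _ _).2 fun U hU => ?_⟩
  obtain ⟨z', hz', hlim⟩ := hlimit U hU
  rwa [hz.unique hz']

lemma tendsto_root_zero (h : AlternatingLimit F p w b C) (h0 : b 0 = 0) :
    Tendsto (fun n => w n 0) F (𝓝 0) := by
  refine (tendsto_iff_ultrafilter _ _ _).2 fun U hU => ?_
  have hU' := h.mono hU
  choose ζ hζ using hU'.exists_tendsto_root
  have hle : ζ 0 ≤ 0 := not_lt.1 fun hpos => ((hU'.limit_zero_pos_iff hζ).1 hpos).ne' h0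
  have hge : 0 ≤ ζ 0 := not_lt.1 fun hneg =>
    (hU'.seriesSum_pos_of_neg h0 hneg).ne' (hU'.seriesSum_limit (hζ 0))
  exact hle.antisymm hge ▸ hζ 0

end AlternatingLimit

section BetaIntegral

variable {α β : ℝ}

lemma ofReal_rpow_mul_one_sub_rpow {t : ℝ} (ht : t ∈ Ioo (0 : ℝ) 1) :
    ((t ^ α * (1 - t) ^ β : ℝ) : ℂ)
      = (t : ℂ) ^ ((α + 1 : ℂ) - 1) * (1 - (t : ℂ)) ^ ((β + 1 : ℂ) - 1) := by
  rw [add_sub_cancel_right, add_sub_cancel_right, Complex.ofReal_mul, Complex.ofReal_cpow ht.1.le,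
    Complex.ofReal_cpow (sub_nonneg.2 ht.2.le), Complex.ofReal_sub, Complex.ofReal_one]

lemma intervalIntegrable_rpow_mul_one_sub_rpow (hα : -1 < α) (hβ : -1 < β) :
    IntervalIntegrable (fun t : ℝ => t ^ α * (1 - t) ^ β) MeasureTheory.volume 0 1 := by
  have hbeta := Complex.betaIntegral_convergent (u := (α : ℂ) + 1) (v := (β : ℂ) + 1)
    (by simp; linarith) (by simp; linarith)
  have hcomplex : IntervalIntegrable (fun t : ℝ => ((t ^ α * (1 - t) ^ β : ℝ) : ℂ))
      MeasureTheory.volume 0 1 := by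
    refine hbeta.congr_uIoo ?_
    rw [uIoo_of_le zero_le_one]
    exact fun t ht => (ofReal_rpow_mul_one_sub_rpow ht).symm
  rw [intervalIntegrable_iff] at hcomplex ⊢
  exact hcomplex.re

lemma integral_rpow_mul_one_sub_rpow (hα : -1 < α) (hβ : -1 < β) :
    ∫ t in (0 : ℝ)..1, t ^ α * (1 - t) ^ β
      = Real.Gamma (α + 1) * Real.Gamma (β + 1) / Real.Gamma (α + β + 2) := by
  rw [← Complex.ofReal_inj]
  calc ((∫ t in (0 : ℝ)..1, t ^ α * (1 - t) ^ β : ℝ) : ℂ)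
      = Complex.betaIntegral ((α : ℂ) + 1) ((β : ℂ) + 1) := by
        rw [Complex.betaIntegral, ← intervalIntegral.integral_ofReal]
        exact intervalIntegral.integral_congr_Ioo_of_le zero_le_one
          fun t ht => ofReal_rpow_mul_one_sub_rpow ht
    _ = Complex.Gamma ((α + 1 : ℝ) : ℂ) * Complex.Gamma ((β + 1 : ℝ) : ℂ)
          / Complex.Gamma ((α + β + 2 : ℝ) : ℂ) := by
        rw [Complex.betaIntegral_eq_Gamma_mul_div _ _ (by simp; linarith) (by simp; linarith)]
        push_cast
        ring_nf
    _ = _ := by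
        simp only [Complex.Gamma_ofReal]
        push_cast
        rfl

lemma intervalIntegrable_eval_mul_rpow_mul (hα : -1 < α) (hβ : -1 < β) (f : ℝ[X]) :
    IntervalIntegrable (fun t : ℝ => f.eval t * (t ^ α * (1 - t) ^ β))
      MeasureTheory.volume 0 1 :=
  (intervalIntegrable_rpow_mul_one_sub_rpow hα hβ).continuousOn_mul f.continuous.continuousOn

end BetaIntegral

section Pochhammer

lemma ascPochhammer_succ_eval_left (x : ℝ) (n : ℕ) :
    (ascPochhammer ℝ (n + 1)).eval x = x * (ascPochhammer ℝ n).eval (x + 1) := by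
  simp [ascPochhammer_succ_left, eval_comp]

lemma Gamma_add_natCast {x : ℝ} (hx : 0 < x) (n : ℕ) :
    Real.Gamma (x + n) = (ascPochhammer ℝ n).eval x * Real.Gamma x := by
  induction n with
  | zero => simp
  | succ n ih =>
    rw [ascPochhammer_succ_eval, Nat.cast_succ, ← add_assoc, Real.Gamma_add_one (by positivity), ih]
    ring

lemma fwdDiff_iter_one_eq_sum (f : ℝ → ℝ) (n : ℕ) (x : ℝ) :
    (fwdDiff 1)^[n] f x
      = (-1) ^ n * ∑ i ∈ Finset.range (n + 1), (-1) ^ i * (n.choose i : ℝ) * f (x + i) := by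
  rw [fwdDiff_iter_eq_sum_shift, Finset.mul_sum]
  refine Finset.sum_congr rfl fun i hi => ?_
  obtain ⟨d, rfl⟩ := Nat.exists_eq_add_of_le (Finset.mem_range_succ_iff.1 hi)
  have hsign : (-1 : ℝ) ^ i * (-1) ^ i = 1 := pow_mul_pow_eq_one i (by norm_num)
  simp only [zsmul_eq_mul, nsmul_eq_mul, mul_one, Nat.add_sub_cancel_left, pow_add, Int.cast_mul,
    Int.cast_pow, Int.cast_neg, Int.cast_one, Int.cast_natCast]
  linear_combination (-(-1) ^ d * ((i + d).choose i : ℝ) * f (x + i)) * hsign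

lemma fwdDiff_iter_inv {x : ℝ} (hx : 0 < x) (n : ℕ) : (fwdDiff 1)^[n] (fun y : ℝ => y⁻¹) x
    = (-1) ^ n * (n.factorial : ℝ) / (ascPochhammer ℝ (n + 1)).eval x := by
  induction n generalizing x with
  | zero => simp
  | succ n ih =>
    have hpos := ascPochhammer_pos n (x + 1) (by positivity)
    rw [Function.iterate_succ_apply', fwdDiff, ih hx, ih (by positivity : 0 < x + 1),
      ascPochhammer_succ_eval_left x (n + 1), ascPochhammer_succ_eval n (x + 1),
      ascPochhammer_succ_eval_left x n, Nat.factorial_succ]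
    have : x + 1 + n ≠ 0 := by positivity
    push_cast
    field_simp
    ring

lemma sum_neg_one_pow_mul_choose_mul_eval {P : ℝ[X]} {n : ℕ} (hP : P.natDegree < n) :
    ∑ i ∈ Finset.range (n + 1), (-1 : ℝ) ^ i * (n.choose i : ℝ) * P.eval (i : ℝ) = 0 := by
  have h := fwdDiff_iter_one_eq_sum P.eval n 0
  rw [fwdDiff_iter_eq_zero_of_degree_lt hP, Pi.zero_apply, eq_comm] at h
  simpa using h

lemma sum_neg_one_pow_mul_choose_div {x : ℝ} (hx : 0 < x) (n : ℕ) :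
    ∑ i ∈ Finset.range (n + 1), (-1 : ℝ) ^ i * (n.choose i : ℝ) / (x + i)
      = (n.factorial : ℝ) / (ascPochhammer ℝ (n + 1)).eval x := by
  have h := fwdDiff_iter_one_eq_sum (fun y => y⁻¹) n x
  rw [fwdDiff_iter_inv hx, mul_div_assoc] at h
  simpa only [div_eq_mul_inv] using (mul_left_cancel₀ (pow_ne_zero n (by norm_num)) h).symm

end Pochhammer

/-- The functional `f ↦ ∫₀¹ f(t) t^α (1-t)^β dt`, which is the Jacobi weight after the substitution
`x = 1 - 2t`. It is defined through its moments so that it is linear for all `α` and `β`; see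
`jacobiFunctional_apply`. -/
def jacobiFunctional (α β : ℝ) : ℝ[X] →ₗ[ℝ] ℝ :=
  Polynomial.lsum fun i => (∫ t in (0 : ℝ)..1, t ^ i * (t ^ α * (1 - t) ^ β)) • LinearMap.id

/-- The coefficients of the Jacobi polynomial `₂F₁(-n, n+α+β+1; α+1; t)`. -/
def jacobiCoeff (α β : ℝ) (n i : ℕ) : ℝ :=
  ∏ s ∈ Finset.range i, (((s : ℝ) - n) * (n + (α + β + 1) + s) / ((α + 1 + s) * (s + 1)))

/-- The Jacobi polynomial of degree `n` in the variable `t = (1-x)/2`, normalized to be `1` at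
`t = 0`. -/
def jacobiPoly (α β : ℝ) (n : ℕ) : ℝ[X] :=
  ∑ i ∈ Finset.range (n + 1), C (jacobiCoeff α β n i) * X ^ i

/-- The squared norm of the Jacobi polynomial `jacobiPoly α β n`. -/
def jacobiNorm (α β : ℝ) (n : ℕ) : ℝ :=
  jacobiFunctional α β (jacobiPoly α β n * jacobiPoly α β n)

section JacobiPoly

variable {α β : ℝ}

lemma jacobiFunctional_apply (hα : -1 < α) (hβ : -1 < β) (f : ℝ[X]) :
    jacobiFunctional α β f = ∫ t in (0 : ℝ)..1, f.eval t * (t ^ α * (1 - t) ^ β) := by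
  simp only [jacobiFunctional, lsum_apply, Polynomial.sum, LinearMap.smul_apply, LinearMap.id_apply,
    smul_eq_mul, eval_eq_sum, Finset.sum_mul]
  rw [intervalIntegral.integral_finsetSum]
  · refine Finset.sum_congr rfl fun i _ => ?_
    rw [mul_comm, ← intervalIntegral.integral_const_mul]
    simp only [mul_assoc]
  · intro i _
    have h := intervalIntegrable_eval_mul_rpow_mul hα hβ (C (f.coeff i) * X ^ i)
    simp_rw [eval_mul (p := C _), eval_C, eval_pow, eval_X] at h
    exact h

lemma jacobiFunctional_C_mul (c : ℝ) (f : ℝ[X]) :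
    jacobiFunctional α β (C c * f) = c * jacobiFunctional α β f := by
  rw [← smul_eq_C_mul, map_smul, smul_eq_mul]

lemma jacobiFunctional_X_pow_mul_one_sub_X_pow (hα : -1 < α) (hβ : -1 < β) (i p : ℕ) :
    jacobiFunctional α β (X ^ i * (1 - X) ^ p)
      = Real.Gamma (α + i + 1) * Real.Gamma (β + p + 1) / Real.Gamma (α + β + p + i + 2) := by
  rw [jacobiFunctional_apply hα hβ, show α + β + p + i + 2 = α + i + (β + p) + 2 by ring,
    ← integral_rpow_mul_one_sub_rpow (by linarith [i.cast_nonneg (α := ℝ)])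
      (by linarith [p.cast_nonneg (α := ℝ)])]
  refine intervalIntegral.integral_congr_Ioo_of_le zero_le_one fun t ht => ?_
  simp only [eval_mul, eval_pow, eval_X, eval_sub, eval_one]
  rw [Real.rpow_add ht.1, Real.rpow_add (sub_pos.2 ht.2), Real.rpow_natCast, Real.rpow_natCast]
  ring

lemma jacobiFunctional_pos (hα : -1 < α) (hβ : -1 < β) {f : ℝ[X]} (hf : f ≠ 0)
    (hnonneg : ∀ t ∈ Ioo (0 : ℝ) 1, 0 ≤ f.eval t) : 0 < jacobiFunctional α β f := by
  have hweight : ∀ t ∈ Ioo (0 : ℝ) 1, 0 < t ^ α * (1 - t) ^ β := fun t ht =>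
    mul_pos (Real.rpow_pos_of_pos ht.1 _) (Real.rpow_pos_of_pos (sub_pos.2 ht.2) _)
  have hint := intervalIntegrable_eval_mul_rpow_mul hα hβ f
  rw [intervalIntegrable_iff_integrableOn_Ioo_of_le zero_le_one] at hint
  have hsupport : Ioo (0 : ℝ) 1 \ (f.roots.toFinset : Set ℝ)
      ⊆ Function.support (fun t => f.eval t * (t ^ α * (1 - t) ^ β)) ∩ Ioo 0 1 := by
    rintro t ⟨ht, hroot⟩
    exact ⟨mul_ne_zero (by simpa [hf] using hroot) (hweight t ht).ne', ht⟩
  rw [jacobiFunctional_apply hα hβ, intervalIntegral.integral_of_le zero_le_one,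
    MeasureTheory.integral_Ioc_eq_integral_Ioo,
    MeasureTheory.setIntegral_pos_iff_support_of_nonneg_ae _ hint]
  · refine lt_of_lt_of_le ?_ (MeasureTheory.measure_mono hsupport)
    rw [MeasureTheory.measure_sdiff_null (Finset.measure_zero _ _)]
    simp
  · exact MeasureTheory.ae_restrict_of_forall_mem measurableSet_Ioo fun t ht =>
      mul_nonneg (hnonneg t ht) (hweight t ht).le

lemma jacobiFunctional_mul_self_pos (hα : -1 < α) (hβ : -1 < β) {f : ℝ[X]} (hf : f ≠ 0) :
    0 < jacobiFunctional α β (f * f) :=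
  jacobiFunctional_pos hα hβ (mul_ne_zero hf hf) fun t _ => by
    rw [eval_mul]
    exact mul_self_nonneg _

lemma jacobiCoeff_zero (n : ℕ) : jacobiCoeff α β n 0 = 1 := Finset.prod_range_zero _

lemma jacobiCoeff_succ (n i : ℕ) : jacobiCoeff α β n (i + 1)
    = jacobiCoeff α β n i * (((i : ℝ) - n) * (n + (α + β + 1) + i) / ((α + 1 + i) * (i + 1))) :=
  Finset.prod_range_succ _ _

lemma jacobiCoeff_eq_zero {n i : ℕ} (h : n < i) : jacobiCoeff α β n i = 0 :=
  Finset.prod_eq_zero (Finset.mem_range.2 h) (by simp)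

lemma jacobiCoeff_eq (hα : -1 < α) (n i : ℕ) : jacobiCoeff α β n i
    = (-1) ^ i * (n.choose i : ℝ) * (ascPochhammer ℝ i).eval (n + (α + β + 1))
      / (ascPochhammer ℝ i).eval (α + 1) := by
  induction i with
  | zero => simp [jacobiCoeff_zero]
  | succ i ih =>
    have hfactor : 0 < α + 1 + i := by linarith [i.cast_nonneg (α := ℝ)]
    have hpoch := ascPochhammer_pos i (α + 1) (by linarith)
    have hchoose : (n.choose (i + 1) : ℝ) = n.choose i * ((n : ℝ) - i) / (i + 1) := by
      rw [eq_div_iff (by positivity)]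
      rcases le_or_gt i n with h | h
      · rw [← Nat.cast_sub h]
        exact_mod_cast Nat.choose_succ_right_eq n i
      · rw [Nat.choose_eq_zero_of_lt h, Nat.choose_eq_zero_of_lt (by omega)]
        simp
    rw [jacobiCoeff_succ, ih, ascPochhammer_succ_eval, ascPochhammer_succ_eval, hchoose, pow_succ]
    field_simp
    ring

lemma neg_one_pow_mul_jacobiCoeff_pos (hα : -1 < α) (hβ : -1 < β) {n i : ℕ} (hn : 1 ≤ n)
    (hi : i ≤ n) : 0 < (-1) ^ i * jacobiCoeff α β n i := by
  have hn' : (1 : ℝ) ≤ n := by exact_mod_cast hn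
  have hdenom := ascPochhammer_pos i (α + 1) (by linarith)
  have hnum := ascPochhammer_pos i (n + (α + β + 1)) (by linarith)
  have hchoose : 0 < (n.choose i : ℝ) := by exact_mod_cast Nat.choose_pos hi
  rw [jacobiCoeff_eq hα, ← mul_div_assoc, ← mul_assoc, ← mul_assoc,
    pow_mul_pow_eq_one i (by norm_num), one_mul]
  positivity

lemma coeff_jacobiPoly (n i : ℕ) : (jacobiPoly α β n).coeff i = jacobiCoeff α β n i := by
  simp only [jacobiPoly, finsetSum_coeff, coeff_C_mul, coeff_X_pow, mul_ite, mul_one, mul_zero,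
    Finset.sum_ite_eq]
  split_ifs with h
  · rfl
  · exact (jacobiCoeff_eq_zero (by simpa using h)).symm

lemma degree_jacobiPoly (hα : -1 < α) (hβ : -1 < β) (n : ℕ) : (jacobiPoly α β n).degree = n := by
  refine le_antisymm ((degree_le_iff_coeff_zero _ _).2 fun m hm => ?_) (le_degree_of_ne_zero ?_)
  · rw [coeff_jacobiPoly]
    exact jacobiCoeff_eq_zero (by exact_mod_cast hm)
  · rw [coeff_jacobiPoly]
    rcases Nat.eq_zero_or_pos n with rfl | hn
    · simp [jacobiCoeff_zero]
    · exact right_ne_zero_of_mul (neg_one_pow_mul_jacobiCoeff_pos hα hβ hn le_rfl).ne'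

lemma jacobiNorm_pos (hα : -1 < α) (hβ : -1 < β) (n : ℕ) : 0 < jacobiNorm α β n :=
  jacobiFunctional_mul_self_pos hα hβ
    (degree_ne_bot.1 (by simp [degree_jacobiPoly hα hβ n]))

lemma jacobiFunctional_jacobiPoly_mul_one_sub_X_pow (hα : -1 < α) (hβ : -1 < β) {n : ℕ}
    (hn : 1 ≤ n) (p : ℕ) :
    jacobiFunctional α β (jacobiPoly α β n * (1 - X) ^ p)
      = Real.Gamma (α + 1) * Real.Gamma (β + p + 1) / Real.Gamma (n + (α + β + 1))
        * ∑ i ∈ Finset.range (n + 1), (-1 : ℝ) ^ i * (n.choose i : ℝ)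
          * (Real.Gamma (n + (α + β + 1) + i) / Real.Gamma (α + β + p + i + 2)) := by
  have hn' : (1 : ℝ) ≤ n := by exact_mod_cast hn
  have hσ : 0 < (n : ℝ) + (α + β + 1) := by linarith
  have := Real.Gamma_pos_of_pos hσ
  rw [jacobiPoly, Finset.sum_mul, map_sum, Finset.mul_sum]
  refine Finset.sum_congr rfl fun i _ => ?_
  have hpoch := ascPochhammer_pos i (α + 1) (by linarith)
  rw [mul_assoc, jacobiFunctional_C_mul, jacobiFunctional_X_pow_mul_one_sub_X_pow hα hβ,
    jacobiCoeff_eq hα, Gamma_add_natCast hσ, show α + (i : ℝ) + 1 = α + 1 + i by ring,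
    Gamma_add_natCast (by linarith)]
  field_simp

lemma jacobiFunctional_jacobiPoly_mul_one_sub_X_pow_eq_zero (hα : -1 < α) (hβ : -1 < β) {n p : ℕ}
    (hp : p < n) : jacobiFunctional α β (jacobiPoly α β n * (1 - X) ^ p) = 0 := by
  obtain ⟨d, rfl⟩ : ∃ d, n = p + d + 1 := ⟨n - p - 1, by omega⟩
  set P : ℝ[X] := (ascPochhammer ℝ d).comp (X + C (α + β + p + 2)) with hP
  have hdegree : P.natDegree < p + d + 1 := by
    rw [hP, natDegree_comp, natDegree_X_add_C, ascPochhammer_natDegree]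
    omega
  rw [jacobiFunctional_jacobiPoly_mul_one_sub_X_pow hα hβ (by omega)]
  refine mul_eq_zero_of_right _ ?_
  rw [← sum_neg_one_pow_mul_choose_mul_eval hdegree]
  refine Finset.sum_congr rfl fun i _ => ?_
  have hx : 0 < α + β + p + i + 2 := by
    linarith [p.cast_nonneg (α := ℝ), i.cast_nonneg (α := ℝ)]
  rw [show ((p + d + 1 : ℕ) : ℝ) + (α + β + 1) + i = α + β + p + i + 2 + d by push_cast; ring,
    Gamma_add_natCast hx, mul_div_cancel_right₀ _ (Real.Gamma_pos_of_pos hx).ne', hP, eval_comp,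
    eval_add, eval_X, eval_C, show (i : ℝ) + (α + β + p + 2) = α + β + p + i + 2 by ring]

lemma jacobiFunctional_jacobiPoly_mul_one_sub_X_pow_self (hα : -1 < α) (hβ : -1 < β) {n : ℕ}
    (hn : 1 ≤ n) :
    jacobiFunctional α β (jacobiPoly α β n * (1 - X) ^ n)
      = Real.Gamma (α + 1) * Real.Gamma (β + n + 1) / Real.Gamma (n + (α + β + 1))
        * ((n.factorial : ℝ) / (ascPochhammer ℝ (n + 1)).eval (n + (α + β + 1))) := by
  have hn' : (1 : ℝ) ≤ n := by exact_mod_cast hn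
  have hσ : 0 < (n : ℝ) + (α + β + 1) := by linarith
  rw [jacobiFunctional_jacobiPoly_mul_one_sub_X_pow hα hβ hn, ← sum_neg_one_pow_mul_choose_div hσ]
  congr 1
  refine Finset.sum_congr rfl fun i _ => ?_
  have hx : 0 < (n : ℝ) + (α + β + 1) + i := by positivity
  have := Real.Gamma_pos_of_pos hx
  rw [show α + β + n + i + 2 = n + (α + β + 1) + i + 1 by ring, Real.Gamma_add_one hx.ne']
  field_simp

lemma degree_sub_C_mul_lt {f p : ℝ[X]} {n : ℕ} (hf : f.degree ≤ n) (hp : p.degree = n) :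
    (f - C (f.coeff n / p.coeff n) * p).degree < n := by
  rw [degree_lt_iff_coeff_zero]
  intro m hm
  rw [coeff_sub, coeff_C_mul]
  rcases hm.eq_or_lt with rfl | hlt
  · rw [div_mul_cancel₀ _ (coeff_ne_zero_of_eq_degree hp), sub_self]
  · have hlt' : (n : WithBot ℕ) < m := by exact_mod_cast hlt
    rw [coeff_eq_zero_of_degree_lt (hf.trans_lt hlt'),
      coeff_eq_zero_of_degree_lt (hp.trans_lt hlt'), mul_zero, sub_zero]

lemma linearMap_eq_of_degree_lt (p : Polynomial.Sequence ℝ) {L L' : ℝ[X] →ₗ[ℝ] ℝ} {n : ℕ}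
    (h : ∀ k < n, L (p k) = L' (p k)) {f : ℝ[X]} (hf : f.degree < n) : L f = L' f := by
  refine LinearMap.eqOn_span (s := p '' Iio n) (forall_mem_image.2 fun k hk => h k hk) ?_
  rw [p.span_degreeLT fun k _ => (leadingCoeff_ne_zero.2 (p.ne_zero k)).isUnit]
  exact mem_degreeLT.2 hf

lemma degree_one_sub_X_pow (p : ℕ) : ((1 - X : ℝ[X]) ^ p).degree = p := by
  rw [degree_pow, ← neg_sub, degree_neg, ← C_1, degree_X_sub_C, nsmul_one]

lemma jacobiFunctional_jacobiPoly_mul_eq_zero (hα : -1 < α) (hβ : -1 < β) {n : ℕ} {f : ℝ[X]}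
    (hf : f.degree < n) : jacobiFunctional α β (jacobiPoly α β n * f) = 0 :=
  linearMap_eq_of_degree_lt ⟨fun p => (1 - X) ^ p, degree_one_sub_X_pow⟩
    (L := jacobiFunctional α β ∘ₗ LinearMap.mulLeft ℝ (jacobiPoly α β n)) (L' := 0)
    (fun _ hp => jacobiFunctional_jacobiPoly_mul_one_sub_X_pow_eq_zero hα hβ hp) hf

lemma coeff_one_sub_X_pow_self (n : ℕ) : ((1 - X : ℝ[X]) ^ n).coeff n = (-1) ^ n := by
  have h := coeff_pow_of_natDegree_le (p := (1 - X : ℝ[X])) (m := n) (n := 1)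
    ((natDegree_sub_le _ _).trans (by simp))
  simpa [coeff_one] using h

lemma jacobiNorm_eq (hα : -1 < α) (hβ : -1 < β) {n : ℕ} (hn : 1 ≤ n) :
    jacobiNorm α β n = Real.Gamma (α + 1) * Real.Gamma (β + n + 1) * (n.factorial : ℝ)
      / (Real.Gamma (n + (α + β + 1)) * (ascPochhammer ℝ n).eval (α + 1)
        * (2 * n + (α + β + 1))) := by
  have hn' : (1 : ℝ) ≤ n := by exact_mod_cast hn
  have hσ : 0 < (n : ℝ) + (α + β + 1) := by linarith
  set c := jacobiCoeff α β n n / (-1) ^ n with hc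
  have hlower : jacobiFunctional α β
      (jacobiPoly α β n * (jacobiPoly α β n - C c * (1 - X) ^ n)) = 0 := by
    refine jacobiFunctional_jacobiPoly_mul_eq_zero hα hβ ?_
    rw [hc, ← coeff_jacobiPoly, ← coeff_one_sub_X_pow_self]
    exact degree_sub_C_mul_lt (degree_jacobiPoly hα hβ n).le (degree_one_sub_X_pow n)
  rw [mul_sub, map_sub, mul_left_comm, jacobiFunctional_C_mul, sub_eq_zero, ← jacobiNorm,
    jacobiFunctional_jacobiPoly_mul_one_sub_X_pow_self hα hβ hn] at hlower
  rw [hlower, hc, jacobiCoeff_eq hα, Nat.choose_self, ascPochhammer_succ_eval,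
    show 2 * (n : ℝ) + (α + β + 1) = n + (α + β + 1) + n by ring]
  have hdenom := ascPochhammer_pos n (α + 1) (by linarith)
  have hnum := ascPochhammer_pos n (n + (α + β + 1)) hσ
  have := Real.Gamma_pos_of_pos hσ
  have hlast : (n : ℝ) + (α + β + 1) + n ≠ 0 := by positivity
  push_cast
  field_simp

end JacobiPoly

/-- The polynomial `∑_{k<n} (R_k^{(j)}(0)/j!) R_k / ‖R_k‖²`, where `R_k` is `jacobiPoly α β k`. It
represents the functional `f ↦ f.coeff j` on polynomials of degree less than `n`. -/
def jacobiKernel (α β : ℝ) (j n : ℕ) : ℝ[X] :=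
  ∑ k ∈ Finset.range n, C (jacobiCoeff α β k j / jacobiNorm α β k) * jacobiPoly α β k

section Kernel

variable {α β : ℝ}

lemma jacobiFunctional_jacobiPoly_mul_jacobiPoly (hα : -1 < α) (hβ : -1 < β) (k l : ℕ) :
    jacobiFunctional α β (jacobiPoly α β k * jacobiPoly α β l)
      = if k = l then jacobiNorm α β k else 0 := by
  split_ifs with h
  · rw [h, jacobiNorm]
  · wlog hlk : l < k generalizing k l
    · rw [mul_comm]
      exact this l k (Ne.symm h) (by omega)
    · refine jacobiFunctional_jacobiPoly_mul_eq_zero hα hβ ?_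
      rw [degree_jacobiPoly hα hβ]
      exact_mod_cast hlk

lemma coeff_jacobiKernel (j n i : ℕ) : (jacobiKernel α β j n).coeff i
    = ∑ k ∈ Finset.range n, jacobiCoeff α β k j / jacobiNorm α β k * jacobiCoeff α β k i := by
  simp only [jacobiKernel, finsetSum_coeff, coeff_C_mul, coeff_jacobiPoly]

lemma degree_jacobiKernel_lt (j n : ℕ) : (jacobiKernel α β j n).degree < n := by
  rw [degree_lt_iff_coeff_zero]
  intro m hm
  rw [coeff_jacobiKernel]
  refine Finset.sum_eq_zero fun k hk => ?_
  rw [jacobiCoeff_eq_zero ((Finset.mem_range.1 hk).trans_le hm), mul_zero]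

lemma coeff_jacobiKernel_self_nonneg (hα : -1 < α) (hβ : -1 < β) (j n : ℕ) :
    0 ≤ (jacobiKernel α β j n).coeff j := by
  rw [coeff_jacobiKernel]
  refine Finset.sum_nonneg fun k _ => ?_
  rw [div_mul_eq_mul_div]
  exact div_nonneg (mul_self_nonneg _) (jacobiNorm_pos hα hβ k).le

lemma jacobiFunctional_jacobiKernel_mul (hα : -1 < α) (hβ : -1 < β) (j : ℕ) {n : ℕ} {f : ℝ[X]}
    (hf : f.degree < n) : jacobiFunctional α β (jacobiKernel α β j n * f) = f.coeff j := by
  refine linearMap_eq_of_degree_lt ⟨jacobiPoly α β, degree_jacobiPoly hα hβ⟩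
    (L := jacobiFunctional α β ∘ₗ LinearMap.mulLeft ℝ (jacobiKernel α β j n)) (L' := lcoeff ℝ j)
    (fun l hl => ?_) hf
  change jacobiFunctional α β (jacobiKernel α β j n * jacobiPoly α β l)
    = (jacobiPoly α β l).coeff j
  simp only [jacobiKernel, Finset.sum_mul, map_sum, mul_assoc, jacobiFunctional_C_mul,
    jacobiFunctional_jacobiPoly_mul_jacobiPoly hα hβ, mul_ite, mul_zero, Finset.sum_ite_eq',
    Finset.mem_range, if_pos hl, coeff_jacobiPoly]
  exact div_mul_cancel₀ _ (jacobiNorm_pos hα hβ l).ne'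

lemma eq_C_mul_jacobiPoly_of_orthogonal (hα : -1 < α) (hβ : -1 < β) {n : ℕ} {p : ℝ[X]}
    (hdegree : p.degree ≤ n)
    (horth : ∀ f : ℝ[X], f.degree < n → jacobiFunctional α β (p * f) = 0) :
    p = C (p.coeff n / (jacobiPoly α β n).coeff n) * jacobiPoly α β n := by
  set d := p - C (p.coeff n / (jacobiPoly α β n).coeff n) * jacobiPoly α β n with hd
  have hdlt : d.degree < n := degree_sub_C_mul_lt hdegree (degree_jacobiPoly hα hβ n)
  have hdd : jacobiFunctional α β (d * d) = 0 := by
    nth_rw 1 [hd]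
    rw [sub_mul, map_sub, horth d hdlt, mul_assoc, jacobiFunctional_C_mul,
      jacobiFunctional_jacobiPoly_mul_eq_zero hα hβ hdlt, mul_zero, sub_zero]
  refine sub_eq_zero.1 (by_contra fun hne => ?_)
  exact (jacobiFunctional_mul_self_pos hα hβ hne).ne' hdd

lemma eq_C_mul_jacobiPoly_sub_jacobiKernel (hα : -1 < α) (hβ : -1 < β) {j n : ℕ} {μ : ℝ}
    (hμ : 0 ≤ μ) {q : ℝ[X]} (hdegree : q.degree = n)
    (horth : ∀ f : ℝ[X], f.degree < n →
      jacobiFunctional α β (q * f) + μ * q.coeff j * f.coeff j = 0) :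
    ∃ a, a ≠ 0 ∧ q = C a * (jacobiPoly α β n
      - C (μ * jacobiCoeff α β n j / (1 + μ * (jacobiKernel α β j n).coeff j))
        * jacobiKernel α β j n) := by
  set K := jacobiKernel α β j n
  set p := q + C (μ * q.coeff j) * K with hp
  set a := q.coeff n / (jacobiPoly α β n).coeff n with ha
  have hpn : p.coeff n = q.coeff n := by
    rw [hp, coeff_add, coeff_C_mul, coeff_eq_zero_of_degree_lt (degree_jacobiKernel_lt j n),
      mul_zero, add_zero]
  have hpa : p = C a * jacobiPoly α β n := by
    rw [ha, ← hpn]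
    refine eq_C_mul_jacobiPoly_of_orthogonal hα hβ ?_ fun f hf => ?_
    · rw [hp, ← smul_eq_C_mul]
      exact (degree_add_le _ _).trans (max_le hdegree.le
        ((degree_smul_le _ _).trans (degree_jacobiKernel_lt j n).le))
    · rw [hp, add_mul, map_add, mul_assoc, jacobiFunctional_C_mul,
        jacobiFunctional_jacobiKernel_mul hα hβ j hf]
      exact horth f hf
  have hpos : 0 < 1 + μ * K.coeff j := by
    linarith [mul_nonneg hμ (coeff_jacobiKernel_self_nonneg hα hβ j n)]
  have hqj : q.coeff j = a * jacobiCoeff α β n j / (1 + μ * K.coeff j) := by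
    have h := congrArg (fun f => coeff f j) hpa
    simp only [hp, coeff_add, coeff_C_mul, coeff_jacobiPoly] at h
    rw [eq_div_iff hpos.ne']
    linarith
  refine ⟨a, div_ne_zero (coeff_ne_zero_of_eq_degree hdegree)
    (coeff_ne_zero_of_eq_degree (degree_jacobiPoly hα hβ n)), ?_⟩
  rw [mul_sub, ← hpa, ← mul_assoc, ← C_mul, eq_sub_iff_add_eq, hp, hqj]
  congr 3
  ring

end Kernel

section Roots

lemma exists_square_decomposition (I : Set ℝ) {q : ℝ[X]} (hq : q ≠ 0) :
    ∃ (S : Finset ℝ) (u v : ℝ[X]), (∀ s ∈ S, s ∈ I) ∧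
      q = (∏ s ∈ S, (C s - X)) * u ^ 2 * v ∧ ∀ t ∈ I, v.eval t ≠ 0 := by
  induction hn : q.natDegree using Nat.strong_induction_on generalizing q with
  | _ n ih =>
    by_cases hroot : ∀ t ∈ I, q.eval t ≠ 0
    · exact ⟨∅, 1, q, by simp, by simp, hroot⟩
    push Not at hroot
    obtain ⟨r, hrI, hr⟩ := hroot
    obtain ⟨q', rfl⟩ := dvd_iff_isRoot.2 (show q.IsRoot r from hr)
    have hq' : q' ≠ 0 := right_ne_zero_of_mul hq
    have hlt : q'.natDegree < n := by
      rw [← hn, natDegree_mul (X_sub_C_ne_zero r) hq', natDegree_X_sub_C]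
      omega
    obtain ⟨S, u, v, hS, hfactor, hv⟩ := ih _ hlt hq' rfl
    have hnegv : ∀ t ∈ I, (-v).eval t ≠ 0 := fun t ht => by simpa using hv t ht
    by_cases hrS : r ∈ S
    · refine ⟨S.erase r, u * (C r - X), -v, fun s hs => hS s (Finset.mem_of_mem_erase hs), ?_,
        hnegv⟩
      rw [hfactor, ← Finset.mul_prod_erase S _ hrS]
      ring
    · refine ⟨insert r S, u, -v, Finset.forall_mem_insert _ _ _ |>.2 ⟨hrI, hS⟩, ?_, hnegv⟩
      rw [hfactor, Finset.prod_insert hrS]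
      ring

lemma eval_pos_or_neg {I : Set ℝ} (hI : IsPreconnected I) {v : ℝ[X]}
    (hv : ∀ t ∈ I, v.eval t ≠ 0) :
    (∀ t ∈ I, 0 < v.eval t) ∨ ∀ t ∈ I, v.eval t < 0 := by
  by_contra! h
  obtain ⟨⟨s, hs, hs0⟩, ⟨t, ht, ht0⟩⟩ := h
  obtain ⟨x, hx, hx0⟩ := hI.intermediate_value hs ht v.continuous.continuousOn ⟨hs0, ht0⟩
  exact hv x hx hx0

lemma natDegree_prod_C_sub_X (S : Finset ℝ) : (∏ s ∈ S, (C s - X)).natDegree = S.card := by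
  rw [natDegree_prod _ _ fun s _ => sub_ne_zero.2 (X_ne_C s).symm]
  simp [natDegree_sub]

lemma neg_one_pow_mul_coeff_prod_C_sub_X_pos {S : Finset ℝ} (hS : ∀ s ∈ S, 0 < s) {i : ℕ}
    (hi : i ≤ S.card) : 0 < (-1) ^ i * (∏ s ∈ S, (C s - X)).coeff i := by
  have hcomp : ∏ s ∈ S, (C s - X) = (∏ s ∈ S, (X + C s)).comp (C (-1) * X) := by
    simp only [prod_comp, add_comp, X_comp, C_comp, C_neg, C_1, neg_one_mul, neg_add_eq_sub]
  rw [hcomp, comp_C_mul_X_coeff, mul_left_comm, pow_mul_pow_eq_one i (by norm_num), mul_one,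
    Finset.prod_X_add_C_coeff _ _ hi]
  refine Finset.sum_pos (fun T hT => Finset.prod_pos fun s hs =>
    hS s ((Finset.mem_powersetCard.1 hT).1 hs)) (Finset.powersetCard_nonempty.2 (Nat.sub_le _ _))

lemma exists_coeff_mul_X_add_C_eq_zero {S : Finset ℝ} (hS : ∀ s ∈ S, 0 < s) {i : ℕ}
    (hi : i + 1 ≤ S.card) :
    ∃ d > 0, ((∏ s ∈ S, (C s - X)) * (X + C d)).coeff (i + 1) = 0 := by
  set P := ∏ s ∈ S, (C s - X)
  have hlow : 0 < (-1) ^ i * P.coeff i := neg_one_pow_mul_coeff_prod_C_sub_X_pos hS (by omega)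
  have hhigh : 0 < (-1) ^ (i + 1) * P.coeff (i + 1) := neg_one_pow_mul_coeff_prod_C_sub_X_pos hS hi
  have hne : P.coeff (i + 1) ≠ 0 := right_ne_zero_of_mul hhigh.ne'
  refine ⟨((-1) ^ i * P.coeff i) / ((-1) ^ (i + 1) * P.coeff (i + 1)), div_pos hlow hhigh, ?_⟩
  have hsign : (-1 : ℝ) ^ i ≠ 0 := pow_ne_zero _ (by norm_num)
  rw [mul_add, coeff_add, coeff_mul_X, coeff_mul_C, pow_succ]
  field_simp
  ring

lemma jacobiFunctional_mul_ne_zero {α β : ℝ} (hα : -1 < α) (hβ : -1 < β) {q P u v g : ℝ[X]}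
    (hq : q ≠ 0) (hfactor : q = P * u ^ 2 * v) (hv : ∀ t ∈ Ioo (0 : ℝ) 1, v.eval t ≠ 0)
    (hg : g ≠ 0) (hgnonneg : ∀ t ∈ Ioo (0 : ℝ) 1, 0 ≤ g.eval t) :
    jacobiFunctional α β (q * (P * g)) ≠ 0 := by
  have hP : P ≠ 0 := fun h => hq (by rw [hfactor, h, zero_mul, zero_mul])
  have hne : q * (P * g) ≠ 0 := mul_ne_zero hq (mul_ne_zero hP hg)
  have heval : ∀ t, (q * (P * g)).eval t = (P.eval t * u.eval t) ^ 2 * g.eval t * v.eval t :=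
    fun t => by
      rw [hfactor]
      simp only [eval_mul, eval_pow]
      ring
  have hfactors : ∀ t ∈ Ioo (0 : ℝ) 1, 0 ≤ (P.eval t * u.eval t) ^ 2 * g.eval t := fun t ht =>
    mul_nonneg (sq_nonneg _) (hgnonneg t ht)
  rcases eval_pos_or_neg isPreconnected_Ioo hv with hpos | hneg
  · refine (jacobiFunctional_pos hα hβ hne fun t ht => ?_).ne'
    rw [heval]
    exact mul_nonneg (hfactors t ht) (hpos t ht).le
  · rw [← neg_ne_zero, ← map_neg]
    refine (jacobiFunctional_pos hα hβ (neg_ne_zero.2 hne) fun t ht => ?_).ne'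
    rw [eval_neg, heval, ← mul_neg]
    exact mul_nonneg (hfactors t ht) (neg_nonneg.2 (hneg t ht).le)

/- `P = ∏ (s - X)` collects the sign changes of `q` in `(0, 1)`. When it has degree at most `n - 2`,
one of `g = 1` and `g = X + d` with `d > 0` makes the `j`-th coefficient of `P g` vanish, which
contradicts orthogonality. -/
lemma le_card_add_one_of_orthogonal {α β : ℝ} (hα : -1 < α) (hβ : -1 < β) {j n : ℕ} (hj : 0 < j)
    {q u v : ℝ[X]} {S : Finset ℝ} (hq : q ≠ 0) (hS : ∀ s ∈ S, s ∈ Ioo (0 : ℝ) 1)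
    (hfactor : q = (∏ s ∈ S, (C s - X)) * u ^ 2 * v) (hv : ∀ t ∈ Ioo (0 : ℝ) 1, v.eval t ≠ 0)
    (horth : ∀ f : ℝ[X], f.degree < n → f.coeff j = 0 → jacobiFunctional α β (q * f) = 0) :
    n ≤ S.card + 1 := by
  set P := ∏ s ∈ S, (C s - X)
  have hPdegree : P.natDegree = S.card := natDegree_prod_C_sub_X S
  have hP : P ≠ 0 := fun h => hq (by rw [hfactor, h, zero_mul, zero_mul])
  have hsign {g : ℝ[X]} (hg : g ≠ 0) (hnonneg : ∀ t ∈ Ioo (0 : ℝ) 1, 0 ≤ g.eval t) :=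
    jacobiFunctional_mul_ne_zero hα hβ hq hfactor hv hg hnonneg
  by_contra! hlt
  rcases Nat.lt_or_ge S.card j with hcard | hcard
  · refine hsign one_ne_zero (by simp) ?_
    rw [mul_one]
    refine horth P ?_ (coeff_eq_zero_of_natDegree_lt (hPdegree.trans_lt hcard))
    exact (natDegree_lt_iff_degree_lt hP).1 (by omega)
  · obtain ⟨i, rfl⟩ := Nat.exists_eq_add_of_lt hj
    rw [zero_add] at hcard horth
    obtain ⟨d, hd, hcoeff⟩ := exists_coeff_mul_X_add_C_eq_zero (fun s hs => (hS s hs).1) hcard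
    have hXd : (X + C d : ℝ[X]) ≠ 0 := X_add_C_ne_zero d
    refine hsign hXd (fun t ht => ?_) (horth _ ?_ hcoeff)
    · rw [eval_add, eval_X, eval_C]
      linarith [ht.1]
    · refine (natDegree_lt_iff_degree_lt (mul_ne_zero hP hXd)).1 ?_
      rwa [natDegree_mul hP hXd, hPdegree, natDegree_X_add_C]

lemma exists_eq_C_mul_prod_C_sub_X {q u v : ℝ[X]} {S : Finset ℝ} {n : ℕ} (hdegree : q.degree = n)
    (hfactor : q = (∏ s ∈ S, (C s - X)) * u ^ 2 * v) (hv : ∀ s ∈ S, v.eval s ≠ 0)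
    (hcard : n ≤ S.card + 1) :
    ∃ T : Finset ℝ, S ⊆ T ∧ T.card = n ∧ ∃ a, a ≠ 0 ∧ q = C a * ∏ s ∈ T, (C s - X) := by
  have hq : q ≠ 0 := degree_ne_bot.1 (by simp [hdegree])
  have hv0 : v ≠ 0 := right_ne_zero_of_mul (hfactor ▸ hq)
  have hu0 : u ^ 2 ≠ 0 := right_ne_zero_of_mul (left_ne_zero_of_mul (hfactor ▸ hq))
  have hP0 : ∏ s ∈ S, (C s - X) ≠ 0 := left_ne_zero_of_mul (left_ne_zero_of_mul (hfactor ▸ hq))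
  have hsum : n = S.card + 2 * u.natDegree + v.natDegree := by
    rw [← natDegree_eq_of_degree_eq_some hdegree, hfactor, natDegree_mul (mul_ne_zero hP0 hu0) hv0,
      natDegree_mul hP0 hu0, natDegree_pow, natDegree_prod_C_sub_X]
  obtain ⟨c, rfl⟩ := natDegree_eq_zero.1 (show u.natDegree = 0 by omega)
  have hc : c ^ 2 ≠ 0 := by simpa using hu0
  rcases Nat.eq_zero_or_pos v.natDegree with hv1 | hv1
  · obtain ⟨b, rfl⟩ := natDegree_eq_zero.1 hv1
    refine ⟨S, subset_rfl, by omega, c ^ 2 * b, mul_ne_zero hc (by simpa using hv0), ?_⟩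
    rw [hfactor, C_mul, C_pow]
    ring
  · obtain ⟨a, ha, b, rfl⟩ := natDegree_eq_one.1 (show v.natDegree = 1 by omega)
    have hlinear : C a * X + C b = C (-a) * (C (-b / a) - X) := by
      rw [mul_sub, ← C_mul, show -a * (-b / a) = b by field_simp, C_neg]
      ring
    have hnotMem : -b / a ∉ S := fun h => hv _ h (by simp [hlinear])
    refine ⟨insert (-b / a) S, Finset.subset_insert _ _,
      by rw [Finset.card_insert_of_notMem hnotMem]; omega, c ^ 2 * -a,
      mul_ne_zero hc (neg_ne_zero.2 ha), ?_⟩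
    rw [hfactor, Finset.prod_insert hnotMem, hlinear, C_mul, C_pow]
    ring

lemma exists_strictMonoOn_image_range_eq (T : Finset ℝ) :
    ∃ w : ℕ → ℝ, StrictMonoOn w (Iio T.card) ∧ (Finset.range T.card).image w = T := by
  set w : ℕ → ℝ := Function.extend Fin.val (T.orderEmbOfFin rfl) 0
  have hw : ∀ k : Fin T.card, w k = T.orderEmbOfFin rfl k := fun k =>
    Fin.val_injective.extend_apply _ _ k
  refine ⟨w, fun k hk l hl hkl => ?_, ?_⟩
  · rw [hw ⟨k, hk⟩, hw ⟨l, hl⟩]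
    exact (T.orderEmbOfFin rfl).strictMono (Fin.mk_lt_mk.2 hkl)
  · have hrange : Finset.range T.card = Finset.univ.image (Fin.val (n := T.card)) := by
      ext k
      simp [Fin.exists_iff]
    rw [hrange, Finset.image_image]
    exact (Finset.image_congr fun k _ => hw k).trans (T.image_orderEmbOfFin_univ rfl)

theorem exists_roots_of_orthogonal {α β : ℝ} (hα : -1 < α) (hβ : -1 < β) {j n : ℕ} (hj : 0 < j)
    {q : ℝ[X]} (hdegree : q.degree = n)
    (horth : ∀ f : ℝ[X], f.degree < n → f.coeff j = 0 → jacobiFunctional α β (q * f) = 0) :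
    ∃ w : ℕ → ℝ, StrictMonoOn w (Iio n) ∧ (∀ k, 0 < k → k < n → 0 < w k) ∧
      ∃ a, a ≠ 0 ∧ ∀ x, q.eval x = a * ∏ k ∈ Finset.range n, (w k - x) := by
  have hq : q ≠ 0 := degree_ne_bot.1 (by simp [hdegree])
  obtain ⟨S, u, v, hS, hfactor, hv⟩ := exists_square_decomposition (Ioo 0 1) hq
  have hcard := le_card_add_one_of_orthogonal hα hβ hj hq hS hfactor hv horth
  obtain ⟨T, hST, rfl, a, ha, hqT⟩ :=
    exists_eq_C_mul_prod_C_sub_X hdegree hfactor (fun s hs => hv s (hS s hs)) hcard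
  obtain ⟨w, hmono, himage⟩ := exists_strictMonoOn_image_range_eq T
  refine ⟨w, hmono, fun k hk hkT => ?_, a, ha, fun x => ?_⟩
  · have hlt : w 0 < w k := hmono (hk.trans hkT) hkT hk
    by_contra! hnonpos
    have hmem : ∀ l < T.card, w l ≤ 0 → w l ∈ T \ S := fun l hl hwl => by
      refine Finset.mem_sdiff.2 ⟨?_, fun h => (hS _ h).1.not_ge hwl⟩
      rw [← himage]
      exact Finset.mem_image_of_mem w (Finset.mem_range.2 hl)
    have hsdiff : (T \ S).card ≤ 1 := by
      rw [Finset.card_sdiff_of_subset hST]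
      omega
    exact hlt.ne (Finset.card_le_one.1 hsdiff _ (hmem 0 (hk.trans hkT) (hlt.le.trans hnonpos)) _
      (hmem k hkT hnonpos))
  · nth_rw 1 [hqT, eval_mul, eval_C, eval_prod, ← himage]
    rw [Finset.prod_image (by simpa using hmono.injOn)]
    simp

end Roots

section Asymptotics

lemma summable_prod_range {d : ℕ → ℝ} (hd : Tendsto d atTop (𝓝 0)) :
    Summable fun l => ∏ s ∈ Finset.range l, d s := by
  refine summable_of_ratio_norm_eventually_le (r := 1 / 2) (by norm_num) ?_
  filter_upwards [hd.norm.eventually (gt_mem_nhds (by simp : ‖(0 : ℝ)‖ < 1 / 2))] with n hn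
  rw [Finset.prod_range_succ, norm_mul, mul_comm]
  gcongr

lemma hasExpTypeZero_prod_range_div {d : ℕ → ℝ} (hd : Tendsto d atTop (𝓝 0)) :
    HasExpTypeZero fun l => ∏ s ∈ Finset.range l, d s / (s + 1) := by
  intro ε hε
  have hscaled : Tendsto (fun s => |d s| / ε) atTop (𝓝 0) := by
    simpa using hd.abs.div_const ε
  obtain ⟨K, hK⟩ := (summable_prod_range hscaled).tendsto_atTop_zero.bddAbove_range
  refine ⟨K, fun l => ?_⟩
  calc |∏ s ∈ Finset.range l, d s / (s + 1)| * (l.factorial : ℝ)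
      = ∏ s ∈ Finset.range l, |d s| := by
        rw [Finset.abs_prod, ← Finset.prod_range_add_one_eq_factorial, Nat.cast_prod,
          ← Finset.prod_mul_distrib]
        refine Finset.prod_congr rfl fun s _ => ?_
        rw [abs_div, Nat.cast_add_one, abs_of_pos (by positivity : (0 : ℝ) < s + 1)]
        exact div_mul_cancel₀ _ (by positivity)
    _ = (∏ s ∈ Finset.range l, |d s| / ε) * ε ^ l := by
        rw [Finset.prod_div_distrib, Finset.prod_const, Finset.card_range]
        exact (div_mul_cancel₀ _ (by positivity)).symm
    _ ≤ K * ε ^ l := mul_le_mul_of_nonneg_right (hK ⟨l, rfl⟩) (by positivity)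

lemma HasExpTypeZero.isEntireSeq {b : ℕ → ℝ} (hb : HasExpTypeZero b) : IsEntireSeq b := by
  intro r hr
  obtain ⟨K, hK⟩ := hb 1 one_pos
  refine ((Real.summable_pow_div_factorial r).mul_left K).of_nonneg_of_le
    (fun l => by positivity) fun l => ?_
  have hbl : |b l| ≤ K * 1 ^ l / l.factorial := (le_div_iff₀ (by positivity)).2 (hK l)
  calc |b l| * r ^ l ≤ K * 1 ^ l / l.factorial * r ^ l := by gcongr
    _ = K * (r ^ l / l.factorial) := by rw [one_pow]; ring

lemma HasExpTypeZero.of_abs_le_const_mul {b b' : ℕ → ℝ} (hb : HasExpTypeZero b) {c : ℝ}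
    (hc : 0 ≤ c) (h : ∀ l, |b' l| ≤ c * |b l|) : HasExpTypeZero b' := by
  intro ε hε
  obtain ⟨K, hK⟩ := hb ε hε
  refine ⟨c * K, fun l => ?_⟩
  calc |b' l| * (l.factorial : ℝ) ≤ c * |b l| * l.factorial := by gcongr; exact h l
    _ = c * (|b l| * l.factorial) := mul_assoc _ _ _
    _ ≤ c * (K * ε ^ l) := mul_le_mul_of_nonneg_left (hK l) hc
    _ = c * K * ε ^ l := (mul_assoc _ _ _).symm

lemma DominatedTendsto.sub_tendsto_mul {ι : Type*} {F : Filter ι} {a a' : ι → ℕ → ℝ}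
    {b b' C C' : ℕ → ℝ} (h : DominatedTendsto F a b C) (h' : DominatedTendsto F a' b' C')
    {y : ι → ℝ} {z : ℝ} (hy : Tendsto y F (𝓝 z)) :
    DominatedTendsto F (fun n l => a n l - y n * a' n l) (fun l => b l - z * b' l)
      (fun l => C l + (|z| + 1) * C' l) where
  isEntireSeq_bound r hr := by
    refine ((h.isEntireSeq_bound r hr).add
      (h'.isEntireSeq_bound.const_mul (|z| + 1) r hr)).of_nonneg_of_le
      (fun l => by positivity) fun l => ?_
    rw [← add_mul]
    exact mul_le_mul_of_nonneg_right (abs_add_le _ _) (by positivity)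
  eventually_abs_le := by
    filter_upwards [h.eventually_abs_le, h'.eventually_abs_le,
      hy.abs.eventually (gt_mem_nhds (lt_add_one |z|))] with n hn hn' hyn l
    calc |a n l - y n * a' n l| ≤ |a n l| + |y n| * |a' n l| := by
          rw [← abs_mul]
          exact abs_sub _ _
      _ ≤ C l + (|z| + 1) * C' l := by
          gcongr
          exacts [hn l, hn' l]
  tendsto_coeff l := (h.tendsto_coeff l).sub (hy.mul (h'.tendsto_coeff l))

lemma tendsto_natCast_div_add (c : ℝ) :
    Tendsto (fun n : ℕ => (n : ℝ) / (n + c)) atTop (𝓝 1) := by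
  have h := ((tendsto_const_div_atTop_nhds_zero_nat c).const_add 1).inv₀ (by simp)
  rw [add_zero, inv_one] at h
  refine h.congr' ?_
  filter_upwards [eventually_ne_atTop 0] with n hn
  rw [one_add_div (Nat.cast_ne_zero.2 hn), inv_div]

lemma tendsto_Gamma_ratio_of_pos {s : ℝ} (hs : 0 < s) :
    Tendsto (fun n : ℕ => Real.Gamma (s + n + 1) / ((n : ℝ) ^ s * n.factorial)) atTop (𝓝 1) := by
  have hGamma := Real.Gamma_pos_of_pos hs
  have h := (tendsto_const_nhds (x := Real.Gamma s)).div (Real.GammaSeq_tendsto_Gamma s) hGamma.ne'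
  rw [div_self hGamma.ne'] at h
  refine h.congr' ?_
  filter_upwards [eventually_ge_atTop 1] with n hn
  have := Real.rpow_pos_of_pos (by exact_mod_cast hn : (0 : ℝ) < n) s
  have hprod (m : ℕ) : ∏ k ∈ Finset.range m, (s + k) = (ascPochhammer ℝ m).eval s := by
    induction m with
    | zero => simp
    | succ m ih => rw [Finset.prod_range_succ, ih, ascPochhammer_succ_eval]
  have hpochhammer := ascPochhammer_pos (n + 1) s hs
  have : (0 : ℝ) < n.factorial := by positivity
  rw [Pi.div_apply, Real.GammaSeq, hprod, add_assoc, ← Nat.cast_add_one, Gamma_add_natCast hs]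
  field_simp

lemma tendsto_Gamma_ratio_of_add_one {s : ℝ} (hs : -2 < s)
    (h : Tendsto (fun n : ℕ => Real.Gamma (s + 1 + n + 1) / ((n : ℝ) ^ (s + 1) * n.factorial))
      atTop (𝓝 1)) :
    Tendsto (fun n : ℕ => Real.Gamma (s + n + 1) / ((n : ℝ) ^ s * n.factorial)) atTop (𝓝 1) := by
  have hmul := h.mul (tendsto_natCast_div_add (s + 1))
  rw [mul_one] at hmul
  refine hmul.congr' ?_
  filter_upwards [eventually_ge_atTop 1] with n hn
  have hn' : (1 : ℝ) ≤ n := by exact_mod_cast hn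
  have := Real.rpow_pos_of_pos (by linarith : (0 : ℝ) < n) s
  have hpos : 0 < s + n + 1 := by linarith
  rw [show s + 1 + n + 1 = s + n + 1 + 1 by ring, Real.Gamma_add_one hpos.ne',
    Real.rpow_add_one (by positivity), show (n : ℝ) + (s + 1) = s + n + 1 by ring]
  field_simp

lemma tendsto_Gamma_ratio {s : ℝ} (hs : -2 < s) :
    Tendsto (fun n : ℕ => Real.Gamma (s + n + 1) / ((n : ℝ) ^ s * n.factorial)) atTop (𝓝 1) :=
  tendsto_Gamma_ratio_of_add_one hs (tendsto_Gamma_ratio_of_add_one (by linarith)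
    (tendsto_Gamma_ratio_of_pos (by linarith)))

lemma rpow_add_two_mul_natCast {x : ℝ} (hx : x ≠ 0) (a : ℝ) (m : ℕ) :
    x ^ (a + 2 * m) = x ^ a * (x ^ 2) ^ m := by
  rw [← pow_mul, ← Real.rpow_add_natCast hx, Nat.cast_mul, Nat.cast_ofNat]

lemma tendsto_rpow_succ_sub (p : ℝ) :
    Tendsto (fun k : ℕ => (((k : ℝ) + 1) ^ p - (k : ℝ) ^ p) / (k : ℝ) ^ (p - 1)) atTop (𝓝 p) := by
  have hderiv : HasDerivAt (fun x : ℝ => x ^ p) p 1 := by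
    simpa using Real.hasDerivAt_rpow_const (x := 1) (p := p) (Or.inl one_ne_zero)
  have hto : Tendsto (fun k : ℕ => 1 + 1 / (k : ℝ)) atTop (𝓝[≠] 1) := by
    refine tendsto_nhdsWithin_iff.2 ⟨?_, ?_⟩
    · simpa using (tendsto_const_div_atTop_nhds_zero_nat (1 : ℝ)).const_add 1
    · filter_upwards [eventually_ne_atTop 0] with k hk
      simpa using hk
  refine ((hasDerivAt_iff_tendsto_slope.1 hderiv).comp hto).congr' ?_
  filter_upwards [eventually_ge_atTop 1] with k hk
  have hk0 : (0 : ℝ) < k := by exact_mod_cast hk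
  have := Real.rpow_pos_of_pos hk0 p
  rw [Function.comp_apply, slope_def_field, show (k : ℝ) + 1 = k * (1 + 1 / k) by field_simp,
    Real.mul_rpow hk0.le (by positivity), Real.rpow_sub hk0, Real.rpow_one, Real.one_rpow]
  field_simp
  ring

/- Stolz–Cesàro: compare `a k` with the telescoping weights `(k + 1) ^ p - k ^ p`. -/
lemma tendsto_sum_div_rpow {a : ℕ → ℝ} {c p : ℝ} (hp : 0 < p)
    (ha : Tendsto (fun k : ℕ => a k / (k : ℝ) ^ (p - 1)) atTop (𝓝 c)) :
    Tendsto (fun n : ℕ => (∑ k ∈ Finset.range n, a k) / (n : ℝ) ^ p) atTop (𝓝 (c / p)) := by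
  set g : ℕ → ℝ := fun k => ((k : ℝ) + 1) ^ p - (k : ℝ) ^ p
  have hg : ∀ k, 0 < g k := fun k =>
    sub_pos.2 (Real.rpow_lt_rpow (by positivity) (lt_add_one _) hp)
  have hgsum : ∀ n, ∑ k ∈ Finset.range n, g k = (n : ℝ) ^ p := fun n => by
    simpa [g, Real.zero_rpow hp.ne', -Finset.sum_sub_distrib] using
      Finset.sum_range_sub (fun k : ℕ => (k : ℝ) ^ p) n
  have hlittle : (fun k => a k - c / p * g k) =o[atTop] g := by
    refine Asymptotics.isLittleO_of_tendsto (fun k hk => absurd hk (hg k).ne') ?_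
    have hquot := (ha.div (tendsto_rpow_succ_sub p) hp.ne').sub_const (c / p)
    rw [sub_self] at hquot
    refine hquot.congr' ?_
    filter_upwards [eventually_gt_atTop 0] with k hk
    have hpow : (k : ℝ) ^ (p - 1) ≠ 0 := (Real.rpow_pos_of_pos (Nat.cast_pos.2 hk) _).ne'
    rw [Pi.div_apply, div_div_div_cancel_right₀ hpow, sub_div, mul_div_cancel_right₀ _ (hg k).ne']
  have hinf : Tendsto (fun n => ∑ k ∈ Finset.range n, g k) atTop atTop := by
    simp only [hgsum]
    exact (tendsto_rpow_atTop hp).comp tendsto_natCast_atTop_atTop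
  have hsum := ((hlittle.sum_range (fun k => (hg k).le) hinf).tendsto_div_nhds_zero).add_const
    (c / p)
  rw [zero_add] at hsum
  refine hsum.congr' ?_
  filter_upwards [eventually_gt_atTop 0] with n hn
  have hpow : (n : ℝ) ^ p ≠ 0 := (Real.rpow_pos_of_pos (Nat.cast_pos.2 hn) _).ne'
  rw [hgsum, Finset.sum_sub_distrib, ← Finset.mul_sum, hgsum, sub_div,
    mul_div_cancel_right₀ _ hpow, sub_add_cancel]

end Asymptotics

/-- The coefficients of the entire function `₀F₁(α + 1; -w/4) = ∑ (-w/4)^i / ((α+1)_i i!)`, which is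
`Γ(α+1) (√w/2)^{-α} J_α(√w)` for `w > 0`. -/
def besselCoeff (α : ℝ) (i : ℕ) : ℝ :=
  ∏ s ∈ Finset.range i, (-1 / (4 * ((α + 1 + s) * (s + 1))))

/-- A dominating sequence for the scaled coefficients of the Jacobi polynomials. -/
def jacobiBound (α β : ℝ) (i : ℕ) : ℝ :=
  ∏ s ∈ Finset.range i, ((2 + |α + β + 1|) / 4 / (α + 1 + s) / (s + 1))

/-- The coefficients of the limit of the scaled kernel polynomials, normalized to be `1` at `0`. -/
def kernelSeries (α : ℝ) (j i : ℕ) : ℝ := besselCoeff α i * ((α + j + 1) / (α + j + 1 + i))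

/-- The coefficients of the limit of the scaled orthogonal polynomials. The parameter `c ∈ [0, 1]`
is the limit of `μ K / (1 + μ K)`, where `μ` is the mass and `K` the `j`-th coefficient of
`jacobiKernel`. -/
def limitSeries (α : ℝ) (j : ℕ) (c : ℝ) (i : ℕ) : ℝ :=
  besselCoeff α i * (1 - c * ((α + 2 * j + 1) / (α + j + 1 + i)))

/-- The kernel polynomial in the variable `w = 4 n² t`, normalized to be `1` at `0`. -/
def scaledKernel (α β : ℝ) (j n : ℕ) : ℝ[X] :=
  C (1 / (jacobiKernel α β j n).coeff 0)
    * (jacobiKernel α β j n).comp (C (1 / (4 * (n : ℝ) ^ 2)) * X)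

/-- The orthogonal polynomial of degree `n` for the functional with mass `μ` on the `j`-th
coefficients, in the variable `w = 4 n² t`. -/
def scaledPoly (α β : ℝ) (j : ℕ) (μ : ℝ) (n : ℕ) : ℝ[X] :=
  (jacobiPoly α β n - C (μ * jacobiCoeff α β n j / (1 + μ * (jacobiKernel α β j n).coeff j))
    * jacobiKernel α β j n).comp (C (1 / (4 * (n : ℝ) ^ 2)) * X)

section JacobiAsymptotics

variable {α β : ℝ}

lemma besselCoeff_zero : besselCoeff α 0 = 1 := Finset.prod_range_zero _

lemma besselCoeff_succ (i : ℕ) :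
    besselCoeff α (i + 1) = besselCoeff α i * (-1 / (4 * ((α + 1 + i) * (i + 1)))) :=
  Finset.prod_range_succ _ _

lemma neg_one_pow_mul_besselCoeff_pos (hα : -1 < α) (i : ℕ) : 0 < (-1) ^ i * besselCoeff α i := by
  induction i with
  | zero => rw [pow_zero, besselCoeff_zero, mul_one]; exact one_pos
  | succ i ih =>
    have : 0 < α + 1 + i := by linarith [i.cast_nonneg (α := ℝ)]
    have hstep : (-1) ^ (i + 1) * besselCoeff α (i + 1)
        = (-1) ^ i * besselCoeff α i * (1 / (4 * ((α + 1 + i) * (i + 1)))) := by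
      rw [besselCoeff_succ]
      ring
    rw [hstep]
    positivity

lemma besselCoeff_ne_zero (hα : -1 < α) (i : ℕ) : besselCoeff α i ≠ 0 :=
  right_ne_zero_of_mul (neg_one_pow_mul_besselCoeff_pos hα i).ne'

lemma jacobiBound_nonneg (hα : -1 < α) (i : ℕ) : 0 ≤ jacobiBound α β i := by
  refine Finset.prod_nonneg fun s _ => ?_
  have : 0 < α + 1 + s := by linarith [s.cast_nonneg (α := ℝ)]
  positivity

lemma hasExpTypeZero_jacobiBound : HasExpTypeZero (jacobiBound α β) :=
  hasExpTypeZero_prod_range_div (tendsto_const_nhds.div_atTop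
    (tendsto_atTop_add_const_left _ _ tendsto_natCast_atTop_atTop))

lemma tendsto_jacobiNorm (hα : -1 < α) (hβ : -1 < β) :
    Tendsto (fun n : ℕ => jacobiNorm α β n * (n : ℝ) ^ (2 * α + 1)) atTop
      (𝓝 (Real.Gamma (α + 1) ^ 2 / 2)) := by
  have hratio := ((tendsto_Gamma_ratio (s := β) (by linarith)).div
    ((tendsto_Gamma_ratio (s := α + β) (by linarith)).mul
      (tendsto_Gamma_ratio (s := α) (by linarith))) (by norm_num)).mul
    (tendsto_natCast_div_add ((α + β + 1) / 2))
  have h := hratio.const_mul (Real.Gamma (α + 1) ^ 2 / 2)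
  rw [mul_one, mul_one, div_one, mul_one] at h
  refine h.congr' ?_
  filter_upwards [eventually_ge_atTop 1] with n hn
  have hn' : (1 : ℝ) ≤ n := by exact_mod_cast hn
  have hn0 : (0 : ℝ) < n := by linarith
  have hσ : 0 < (n : ℝ) + (α + β + 1) := by linarith
  have : (n : ℝ) * 2 + (α + β + 1) ≠ 0 := by linarith
  have := Real.Gamma_pos_of_pos hσ
  have := Real.Gamma_pos_of_pos (by linarith : 0 < α + 1)
  have := ascPochhammer_pos n (α + 1) (by linarith)
  have := Real.rpow_pos_of_pos hn0 α
  have := Real.rpow_pos_of_pos hn0 β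
  rw [jacobiNorm_eq hα hβ hn, Pi.div_apply, show α + (n : ℝ) + 1 = α + 1 + n by ring,
    Gamma_add_natCast (by linarith : 0 < α + 1), show α + β + (n : ℝ) + 1 = n + (α + β + 1) by ring,
    show β + (n : ℝ) + 1 = β + n + 1 by ring, Real.rpow_add hn0 α β,
    Real.rpow_add hn0 (2 * α) 1, Real.rpow_one, two_mul α, Real.rpow_add hn0 α α,
    show (n : ℝ) + (α + β + 1) / 2 = (n * 2 + (α + β + 1)) / 2 by ring, mul_comm (2 : ℝ) (n : ℝ)]
  field_simp

lemma tendsto_jacobiCoeff_div_pow (i : ℕ) :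
    Tendsto (fun n : ℕ => jacobiCoeff α β n i / (4 * (n : ℝ) ^ 2) ^ i) atTop
      (𝓝 (besselCoeff α i)) := by
  induction i with
  | zero => simp [jacobiCoeff_zero, besselCoeff_zero]
  | succ i ih =>
    have hleft := (tendsto_const_div_atTop_nhds_zero_nat (i : ℝ)).sub_const 1
    have hright := (tendsto_const_div_atTop_nhds_zero_nat (α + β + 1 + i)).const_add 1
    have h := ih.mul ((hleft.mul hright).div_const (4 * ((α + 1 + i) * (i + 1))))
    rw [zero_sub, add_zero, mul_one, ← besselCoeff_succ] at h
    refine h.congr' ?_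
    filter_upwards [eventually_ne_atTop 0] with n hn
    have hn0 : (n : ℝ) ≠ 0 := Nat.cast_ne_zero.2 hn
    have hfactor : ((i : ℝ) / n - 1) * (1 + (α + β + 1 + i) / n)
        = (i - n) * (n + (α + β + 1) + i) / n ^ 2 := by
      field_simp
      ring
    rw [hfactor, jacobiCoeff_succ, ← div_div _ (4 : ℝ)]
    ring

lemma abs_jacobiCoeff_mono (hα : -1 < α) (hβ : -1 < β) {k n : ℕ} (hk : 1 ≤ k) (hkn : k ≤ n)
    (i : ℕ) : |jacobiCoeff α β k i| ≤ |jacobiCoeff α β n i| := by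
  rcases Nat.lt_or_ge k i with h | h
  · rw [jacobiCoeff_eq_zero h, abs_zero]
    exact abs_nonneg _
  · rw [jacobiCoeff, jacobiCoeff, Finset.abs_prod, Finset.abs_prod]
    refine Finset.prod_le_prod (fun s _ => abs_nonneg _) fun s hs => ?_
    have hsk : (s : ℝ) + 1 ≤ k := by exact_mod_cast (Finset.mem_range.1 hs).trans_le h
    have : (1 : ℝ) ≤ k := by exact_mod_cast hk
    have hkn' : (k : ℝ) ≤ n := by exact_mod_cast hkn
    have := s.cast_nonneg (α := ℝ)
    rw [abs_div, abs_div, abs_mul ((s : ℝ) - k), abs_mul ((s : ℝ) - n),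
      abs_of_nonpos (by linarith : (s : ℝ) - k ≤ 0), abs_of_nonpos (by linarith : (s : ℝ) - n ≤ 0),
      abs_of_nonneg (by linarith : 0 ≤ (k : ℝ) + (α + β + 1) + s),
      abs_of_nonneg (by linarith : 0 ≤ (n : ℝ) + (α + β + 1) + s)]
    refine div_le_div_of_nonneg_right ?_ (abs_nonneg _)
    exact mul_le_mul (by linarith) (by linarith) (by linarith) (by linarith)

lemma abs_jacobiCoeff_div_pow_le (hα : -1 < α) (hβ : -1 < β) {n : ℕ} (hn : 1 ≤ n) (i : ℕ) :
    |jacobiCoeff α β n i / (4 * (n : ℝ) ^ 2) ^ i| ≤ jacobiBound α β i := by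
  have hn' : (1 : ℝ) ≤ n := by exact_mod_cast hn
  rcases Nat.lt_or_ge n i with h | h
  · rw [jacobiCoeff_eq_zero h, zero_div, abs_zero]
    exact jacobiBound_nonneg hα i
  · nth_rw 2 [← Finset.card_range i]
    rw [← Finset.prod_const, jacobiCoeff, ← Finset.prod_div_distrib, Finset.abs_prod, jacobiBound]
    refine Finset.prod_le_prod (fun s _ => abs_nonneg _) fun s hs => ?_
    have hsn : (s : ℝ) + 1 ≤ n := by exact_mod_cast (Finset.mem_range.1 hs).trans_le h
    have := s.cast_nonneg (α := ℝ)
    have hd : 0 < (α + 1 + s) * ((s : ℝ) + 1) := mul_pos (by linarith) (by linarith)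
    have hσ : α + β + 1 ≤ |α + β + 1| * n :=
      (le_abs_self _).trans (le_mul_of_one_le_right (abs_nonneg _) hn')
    have hnum : -((s : ℝ) - n) * (n + (α + β + 1) + s) ≤ n * ((2 + |α + β + 1|) * n) :=
      mul_le_mul (by linarith) (by linarith) (by linarith) (by linarith)
    rw [abs_div, abs_div, abs_mul, abs_of_nonpos (by linarith : (s : ℝ) - n ≤ 0),
      abs_of_nonneg (by linarith : 0 ≤ (n : ℝ) + (α + β + 1) + s), abs_of_pos hd,
      abs_of_pos (by positivity), div_right_comm, div_div _ (α + 1 + (s : ℝ))]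
    refine div_le_div_of_nonneg_right ?_ hd.le
    rw [div_le_div_iff₀ (by positivity) (by norm_num)]
    linarith

lemma tendsto_coeff_jacobiKernel (hα : -1 < α) (hβ : -1 < β) (j i : ℕ) :
    Tendsto (fun n : ℕ => (jacobiKernel α β j n).coeff i
        / ((n : ℝ) ^ (2 * α + 2) * (4 * (n : ℝ) ^ 2) ^ (i + j))) atTop
      (𝓝 (besselCoeff α i * besselCoeff α j / (Real.Gamma (α + 1) ^ 2 * (α + j + 1 + i)))) := by
  have hGamma := Real.Gamma_pos_of_pos (by linarith : 0 < α + 1)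
  have hp : 0 < 2 * α + 2 + 2 * (i + j : ℕ) := by
    linarith [(i + j).cast_nonneg (α := ℝ)]
  have hterm := (((tendsto_jacobiCoeff_div_pow (α := α) (β := β) j).div (tendsto_jacobiNorm hα hβ)
    (by positivity)).mul (tendsto_jacobiCoeff_div_pow (α := α) (β := β) i)).const_mul
    ((4 : ℝ) ^ (i + j))
  have hsum := (tendsto_sum_div_rpow (a := fun k => jacobiCoeff α β k j / jacobiNorm α β k
    * jacobiCoeff α β k i) hp (hterm.congr' ?_)).div_const ((4 : ℝ) ^ (i + j))
  · convert hsum using 2 with n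
    · rcases eq_or_ne (n : ℝ) 0 with hn | hn
      · have hn' : n = 0 := by exact_mod_cast hn
        simp [hn', coeff_jacobiKernel]
      · rw [coeff_jacobiKernel, rpow_add_two_mul_natCast hn, mul_pow, div_div]
        ring
    · push_cast
      field_simp
      ring
  · filter_upwards [eventually_ne_atTop 0] with k hk
    have hk0 : (k : ℝ) ≠ 0 := Nat.cast_ne_zero.2 hk
    rw [show 2 * α + 2 + 2 * ((i + j : ℕ) : ℝ) - 1 = 2 * α + 1 + 2 * (i + j : ℕ) by ring,
      rpow_add_two_mul_natCast hk0, Pi.div_apply, mul_pow, mul_pow, pow_add, pow_add]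
    field_simp

end JacobiAsymptotics

section KernelAsymptotics

variable {α β : ℝ} {j : ℕ}

lemma neg_one_pow_mul_jacobiCoeff_nonneg (hα : -1 < α) (hβ : -1 < β) {n : ℕ} (hn : 1 ≤ n)
    (i : ℕ) : 0 ≤ (-1) ^ i * jacobiCoeff α β n i := by
  rcases Nat.lt_or_ge n i with h | h
  · rw [jacobiCoeff_eq_zero h, mul_zero]
  · exact (neg_one_pow_mul_jacobiCoeff_pos hα hβ hn h).le

lemma abs_jacobiCoeff (hα : -1 < α) (hβ : -1 < β) {n : ℕ} (hn : 1 ≤ n) (i : ℕ) :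
    |jacobiCoeff α β n i| = (-1) ^ i * jacobiCoeff α β n i := by
  rw [← abs_of_nonneg (neg_one_pow_mul_jacobiCoeff_nonneg hα hβ hn i), abs_mul, abs_neg_one_pow,
    one_mul]

lemma coeff_jacobiKernel_self_pos (hα : -1 < α) (hβ : -1 < β) (hj : 1 ≤ j) {n : ℕ} (hn : j < n) :
    0 < (jacobiKernel α β j n).coeff j := by
  have hne : jacobiCoeff α β j j ≠ 0 :=
    right_ne_zero_of_mul (neg_one_pow_mul_jacobiCoeff_pos hα hβ hj le_rfl).ne'
  simp only [coeff_jacobiKernel, div_mul_eq_mul_div]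
  exact Finset.sum_pos' (fun k _ => div_nonneg (mul_self_nonneg _) (jacobiNorm_pos hα hβ k).le)
    ⟨j, Finset.mem_range.2 hn, div_pos (mul_self_pos.2 hne) (jacobiNorm_pos hα hβ j)⟩

lemma eval_jacobiPoly_pos (hα : -1 < α) (hβ : -1 < β) (n : ℕ) {x : ℝ} (hx : x ≤ 0) :
    0 < (jacobiPoly α β n).eval x := by
  simp only [jacobiPoly, eval_finsetSum, eval_mul, eval_C, eval_pow, eval_X]
  refine Finset.sum_pos' (fun i hi => ?_) ⟨0, by simp, by simp [jacobiCoeff_zero]⟩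
  rcases Nat.eq_zero_or_pos n with rfl | hn
  · obtain rfl : i = 0 := by simpa using hi
    simp [jacobiCoeff_zero]
  · have hterm : jacobiCoeff α β n i * x ^ i = (-1) ^ i * jacobiCoeff α β n i * (-x) ^ i := by
      rw [mul_right_comm, ← mul_pow, neg_one_mul, neg_neg, mul_comm]
    rw [hterm]
    exact mul_nonneg (neg_one_pow_mul_jacobiCoeff_nonneg hα hβ hn i)
      (pow_nonneg (neg_nonneg.2 hx) i)

lemma neg_one_pow_mul_eval_jacobiKernel_pos (hα : -1 < α) (hβ : -1 < β) (hj : 1 ≤ j) {n : ℕ}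
    (hn : j < n) {x : ℝ} (hx : x ≤ 0) : 0 < (-1) ^ j * (jacobiKernel α β j n).eval x := by
  simp only [jacobiKernel, eval_finsetSum, eval_mul, eval_C, Finset.mul_sum, mul_div_assoc',
    ← mul_assoc]
  refine Finset.sum_pos' (fun k _ => mul_nonneg (div_nonneg ?_ (jacobiNorm_pos hα hβ k).le)
    (eval_jacobiPoly_pos hα hβ k hx).le) ⟨j, Finset.mem_range.2 hn, mul_pos (div_pos
      (neg_one_pow_mul_jacobiCoeff_pos hα hβ hj le_rfl) (jacobiNorm_pos hα hβ j))
      (eval_jacobiPoly_pos hα hβ j hx)⟩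
  rcases Nat.eq_zero_or_pos k with rfl | hk
  · rw [jacobiCoeff_eq_zero hj, mul_zero]
  · exact neg_one_pow_mul_jacobiCoeff_nonneg hα hβ hk j

lemma neg_one_pow_mul_coeff_zero_jacobiKernel_pos (hα : -1 < α) (hβ : -1 < β) (hj : 1 ≤ j) {n : ℕ}
    (hn : j < n) : 0 < (-1) ^ j * (jacobiKernel α β j n).coeff 0 := by
  rw [coeff_zero_eq_eval_zero]
  exact neg_one_pow_mul_eval_jacobiKernel_pos hα hβ hj hn le_rfl

lemma coeff_zero_jacobiKernel_ne_zero (hα : -1 < α) (hβ : -1 < β) (hj : 1 ≤ j) {n : ℕ}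
    (hn : j < n) : (jacobiKernel α β j n).coeff 0 ≠ 0 :=
  right_ne_zero_of_mul (neg_one_pow_mul_coeff_zero_jacobiKernel_pos hα hβ hj hn).ne'

-- The terms `J_kj / N_k` of the kernel all have the sign `(-1)^j`, so no cancellation occurs in
-- the coefficient at `0`.
lemma abs_coeff_jacobiKernel_le (hα : -1 < α) (hβ : -1 < β) (hj : 1 ≤ j) {n : ℕ} (hn : j < n)
    (i : ℕ) : |(jacobiKernel α β j n).coeff i|
      ≤ |jacobiCoeff α β n i| * |(jacobiKernel α β j n).coeff 0| := by
  have hcoeff_zero : |(jacobiKernel α β j n).coeff 0|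
      = ∑ k ∈ Finset.range n, (-1) ^ j * jacobiCoeff α β k j / jacobiNorm α β k := by
    nth_rw 1 [← one_mul |(jacobiKernel α β j n).coeff 0|, ← abs_neg_one_pow (α := ℝ) j]
    rw [← abs_mul,
      abs_of_pos (neg_one_pow_mul_coeff_zero_jacobiKernel_pos hα hβ hj hn), coeff_jacobiKernel,
      Finset.mul_sum]
    simp only [jacobiCoeff_zero, mul_one, mul_div_assoc]
  rw [hcoeff_zero, coeff_jacobiKernel, Finset.mul_sum]
  refine (Finset.abs_sum_le_sum_abs _ _).trans (Finset.sum_le_sum fun k hk => ?_)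
  rcases Nat.eq_zero_or_pos k with rfl | hk_pos
  · simp [jacobiCoeff_eq_zero hj]
  · rw [abs_mul, abs_div, abs_of_pos (jacobiNorm_pos hα hβ k), abs_jacobiCoeff hα hβ hk_pos j,
      mul_comm]
    exact mul_le_mul_of_nonneg_right
      (abs_jacobiCoeff_mono hα hβ hk_pos (Finset.mem_range.1 hk).le i)
      (div_nonneg (neg_one_pow_mul_jacobiCoeff_nonneg hα hβ hk_pos j) (jacobiNorm_pos hα hβ k).le)

lemma coeff_scaledKernel (n i : ℕ) : (scaledKernel α β j n).coeff i
    = (jacobiKernel α β j n).coeff i / (jacobiKernel α β j n).coeff 0 / (4 * (n : ℝ) ^ 2) ^ i := by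
  rw [scaledKernel, coeff_C_mul, comp_C_mul_X_coeff, one_div_pow]
  ring

lemma abs_coeff_scaledKernel_le (hα : -1 < α) (hβ : -1 < β) (hj : 1 ≤ j) {n : ℕ} (hn : j < n)
    (i : ℕ) : |(scaledKernel α β j n).coeff i| ≤ jacobiBound α β i := by
  refine le_trans ?_ (abs_jacobiCoeff_div_pow_le hα hβ (by omega : 1 ≤ n) i)
  rw [coeff_scaledKernel, abs_div, abs_div, abs_div]
  refine div_le_div_of_nonneg_right ?_ (abs_nonneg _)
  rw [div_le_iff₀ (abs_pos.2 (coeff_zero_jacobiKernel_ne_zero hα hβ hj hn))]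
  exact abs_coeff_jacobiKernel_le hα hβ hj hn i

lemma tendsto_coeff_scaledKernel (hα : -1 < α) (hβ : -1 < β) (i : ℕ) :
    Tendsto (fun n => (scaledKernel α β j n).coeff i) atTop (𝓝 (kernelSeries α j i)) := by
  have hGamma := (Real.Gamma_pos_of_pos (by linarith : 0 < α + 1)).ne'
  have hA : α + j + 1 ≠ 0 := by linarith [j.cast_nonneg (α := ℝ)]
  have hbessel := besselCoeff_ne_zero hα j
  have h := (tendsto_coeff_jacobiKernel hα hβ j i).div (tendsto_coeff_jacobiKernel hα hβ j 0)
    (by simp only [besselCoeff_zero, Nat.cast_zero, add_zero]; positivity)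
  convert h.congr' ?_ using 2
  · rw [kernelSeries, besselCoeff_zero, Nat.cast_zero, add_zero]
    field_simp
  · filter_upwards [eventually_ne_atTop 0] with n hn
    have hn0 : (0 : ℝ) < n := Nat.cast_pos.2 (Nat.pos_of_ne_zero hn)
    have := Real.rpow_pos_of_pos hn0 (2 * α + 2)
    rw [coeff_scaledKernel, Pi.div_apply, zero_add, pow_add]
    field_simp

lemma dominatedTendsto_scaledKernel (hα : -1 < α) (hβ : -1 < β) (hj : 1 ≤ j) :
    DominatedTendsto atTop (fun n => (scaledKernel α β j n).coeff) (kernelSeries α j)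
      (jacobiBound α β) :=
  ⟨hasExpTypeZero_jacobiBound.isEntireSeq, (eventually_gt_atTop j).mono fun _ hn =>
    abs_coeff_scaledKernel_le hα hβ hj hn, tendsto_coeff_scaledKernel hα hβ⟩

lemma dominatedTendsto_jacobiCoeff_div_pow (hα : -1 < α) (hβ : -1 < β) :
    DominatedTendsto atTop (fun n i => jacobiCoeff α β n i / (4 * (n : ℝ) ^ 2) ^ i)
      (besselCoeff α) (jacobiBound α β) :=
  ⟨hasExpTypeZero_jacobiBound.isEntireSeq, (eventually_ge_atTop 1).mono fun _ hn =>
    abs_jacobiCoeff_div_pow_le hα hβ hn, tendsto_jacobiCoeff_div_pow⟩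

lemma tendsto_jacobiCoeff_mul_jacobiKernel_ratio (hα : -1 < α) (hβ : -1 < β) (j : ℕ) :
    Tendsto (fun n : ℕ => jacobiCoeff α β n j * (jacobiKernel α β j n).coeff 0
      / (jacobiKernel α β j n).coeff j) atTop (𝓝 ((α + 2 * j + 1) / (α + j + 1))) := by
  have hGamma := (Real.Gamma_pos_of_pos (by linarith : 0 < α + 1)).ne'
  have hA : 0 < α + j + 1 := by linarith [j.cast_nonneg (α := ℝ)]
  have hbessel := besselCoeff_ne_zero hα j
  have h := ((tendsto_jacobiCoeff_div_pow (α := α) (β := β) j).mul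
    (tendsto_coeff_jacobiKernel hα hβ j 0)).div (tendsto_coeff_jacobiKernel hα hβ j j)
    (by positivity)
  convert h.congr' ?_ using 2
  · rw [besselCoeff_zero, Nat.cast_zero, add_zero]
    field_simp
    ring
  · filter_upwards [eventually_ne_atTop 0] with n hn
    have hn0 : (0 : ℝ) < n := Nat.cast_pos.2 (Nat.pos_of_ne_zero hn)
    have := Real.rpow_pos_of_pos hn0 (2 * α + 2)
    rw [Pi.div_apply, zero_add, pow_add]
    field_simp

lemma coeff_scaledPoly (hα : -1 < α) (hβ : -1 < β) (hj : 1 ≤ j) {n : ℕ} (hn : j < n) (μ : ℝ)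
    (i : ℕ) : (scaledPoly α β j μ n).coeff i = jacobiCoeff α β n i / (4 * (n : ℝ) ^ 2) ^ i
      - μ * (jacobiKernel α β j n).coeff j / (1 + μ * (jacobiKernel α β j n).coeff j)
        * (jacobiCoeff α β n j * (jacobiKernel α β j n).coeff 0 / (jacobiKernel α β j n).coeff j)
        * (scaledKernel α β j n).coeff i := by
  have hzero := coeff_zero_jacobiKernel_ne_zero hα hβ hj hn
  have hself := (coeff_jacobiKernel_self_pos hα hβ hj hn).ne'
  rw [scaledPoly, comp_C_mul_X_coeff, coeff_sub, coeff_C_mul, coeff_jacobiPoly, coeff_scaledKernel,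
    one_div_pow]
  field_simp

lemma dominatedTendsto_scaledPoly (hα : -1 < α) (hβ : -1 < β) (hj : 1 ≤ j) {μ : ℕ → ℝ} {c : ℝ}
    (hc : Tendsto (fun n => μ n * (jacobiKernel α β j n).coeff j
      / (1 + μ n * (jacobiKernel α β j n).coeff j)) atTop (𝓝 c)) :
    ∃ C, DominatedTendsto atTop (fun n => (scaledPoly α β j (μ n) n).coeff) (limitSeries α j c)
      (fun i => C * jacobiBound α β i) := by
  have hA : α + j + 1 ≠ 0 := by linarith [j.cast_nonneg (α := ℝ)]
  have hratio := hc.mul (tendsto_jacobiCoeff_mul_jacobiKernel_ratio hα hβ j)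
  have h := (dominatedTendsto_jacobiCoeff_div_pow hα hβ).sub_tendsto_mul
    (dominatedTendsto_scaledKernel hα hβ hj) hratio
  refine ⟨1 + (|c * ((α + 2 * j + 1) / (α + j + 1))| + 1), ?_⟩
  convert h.congr' ((eventually_gt_atTop j).mono fun n hn i =>
    (coeff_scaledPoly hα hβ hj hn (μ n) i).symm) using 2 with i i
  · rw [limitSeries, kernelSeries]
    field_simp
  · ring

end KernelAsymptotics

/-- The energy `w g'(w)² + g(w)² / 4` of the solution `g = seriesSum (besselCoeff α)` of the
equation `w g'' + (1 + α) g' + g / 4 = 0`. -/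
def besselEnergy (α w : ℝ) : ℝ :=
  w * seriesSum (derivSeq (besselCoeff α)) w ^ 2 + seriesSum (besselCoeff α) w ^ 2 / 4

section Bessel

variable {α : ℝ}

lemma isEntireSeq_besselCoeff (hα : -1 < α) : IsEntireSeq (besselCoeff α) :=
  (dominatedTendsto_jacobiCoeff_div_pow (β := 0) hα (by norm_num)).isEntireSeq

lemma bessel_ode (hα : -1 < α) (w : ℝ) :
    w * seriesSum (derivSeq (derivSeq (besselCoeff α))) w
      + (1 + α) * seriesSum (derivSeq (besselCoeff α)) w + seriesSum (besselCoeff α) w / 4 = 0 := by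
  have h := isEntireSeq_besselCoeff hα
  have hsum := ((h.derivSeq.natCast_mul.hasSum w).add ((h.derivSeq.hasSum w).mul_left (1 + α))).add
    ((h.hasSum w).div_const 4)
  rw [← h.derivSeq.seriesSum_natCast_mul]
  refine hsum.unique (hasSum_zero.congr_fun fun i => ?_)
  have hi : α + 1 + i ≠ 0 := by linarith [i.cast_nonneg (α := ℝ)]
  simp only [derivSeq, besselCoeff_succ]
  field_simp
  ring

lemma hasDerivAt_besselEnergy (hα : -1 < α) (w : ℝ) : HasDerivAt (besselEnergy α)
    (-(1 + 2 * α) * seriesSum (derivSeq (besselCoeff α)) w ^ 2) w := by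
  have h := isEntireSeq_besselCoeff hα
  refine (((hasDerivAt_id w).mul ((h.derivSeq.hasDerivAt w).pow 2)).add
    (((h.hasDerivAt w).pow 2).div_const 4)).congr_deriv ?_
  simp only [id, Nat.cast_ofNat, Nat.add_one_sub_one, pow_one, Pi.pow_apply]
  linear_combination (2 * seriesSum (derivSeq (besselCoeff α)) w) * bessel_ode hα w

lemma monotoneOn_rpow_mul_besselEnergy (hα : -1 < α) :
    MonotoneOn (fun w => w ^ |1 + 2 * α| * besselEnergy α w) (Ioi 0) := by
  set p := |1 + 2 * α|
  have hderiv : ∀ w ∈ Ioi (0 : ℝ), HasDerivAt (fun w => w ^ p * besselEnergy α w)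
      (w ^ (p - 1) * (p * (seriesSum (besselCoeff α) w ^ 2 / 4)
        + (p - (1 + 2 * α)) * (w * seriesSum (derivSeq (besselCoeff α)) w ^ 2))) w := by
    intro w hw
    have hw0 : w ≠ 0 := ne_of_gt hw
    refine ((Real.hasDerivAt_rpow_const (p := p) (Or.inl hw0)).mul
      (hasDerivAt_besselEnergy hα w)).congr_deriv ?_
    rw [besselEnergy, ← sub_add_cancel p 1, Real.rpow_add_one hw0]
    ring_nf
  refine monotoneOn_of_hasDerivWithinAt_nonneg (convex_Ioi 0)
    (fun w hw => (hderiv w hw).continuousAt.continuousWithinAt)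
    (fun w hw => (hderiv w (interior_subset hw)).hasDerivWithinAt) fun w hw => ?_
  have hw0 : 0 < w := interior_subset hw
  have := Real.rpow_pos_of_pos hw0 (p - 1)
  have : 0 ≤ p - (1 + 2 * α) := sub_nonneg.2 (le_abs_self _)
  positivity

-- At a double zero the energy vanishes, hence, by monotonicity, the function vanishes on `(0, w₀]`,
-- which contradicts its value `1` at `0`.
lemma seriesSum_derivSeq_besselCoeff_ne_zero (hα : -1 < α) {w₀ : ℝ} (hw₀ : 0 < w₀)
    (hzero : seriesSum (besselCoeff α) w₀ = 0) : seriesSum (derivSeq (besselCoeff α)) w₀ ≠ 0 := by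
  intro hderiv
  have henergy : besselEnergy α w₀ = 0 := by simp [besselEnergy, hzero, hderiv]
  have hvanish : ∀ w ∈ Ioc 0 w₀, seriesSum (besselCoeff α) w = 0 := by
    intro w hw
    have hle := monotoneOn_rpow_mul_besselEnergy hα hw.1 hw₀ hw.2
    simp only [henergy, mul_zero] at hle
    have hle' : besselEnergy α w ≤ 0 :=
      nonpos_of_mul_nonpos_right hle (Real.rpow_pos_of_pos hw.1 _)
    have hnonneg : 0 ≤ w * seriesSum (derivSeq (besselCoeff α)) w ^ 2 :=
      mul_nonneg hw.1.le (sq_nonneg _)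
    rw [besselEnergy] at hle'
    exact pow_eq_zero_iff two_ne_zero |>.1 (le_antisymm (by linarith) (sq_nonneg _))
  have hlim : Tendsto (seriesSum (besselCoeff α)) (𝓝[>] 0) (𝓝 (besselCoeff α 0)) :=
    seriesSum_zero (besselCoeff α) ▸
      ((isEntireSeq_besselCoeff hα).continuous.tendsto 0).mono_left nhdsWithin_le_nhds
  have hlim_zero : Tendsto (seriesSum (besselCoeff α)) (𝓝[>] 0) (𝓝 0) :=
    tendsto_const_nhds.congr'
      (eventually_of_mem (Ioc_mem_nhdsGT hw₀) fun w hw => (hvanish w hw).symm)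
  exact one_ne_zero (besselCoeff_zero.symm.trans (tendsto_nhds_unique hlim hlim_zero))

end Bessel

/-- The Laguerre expression `(θp)² - p θ²p` of a polynomial, where `θ = w d/dw`. It is nonnegative
for `w ≥ 0` when all the zeros of `p` are positive. -/
def laguerreExpr (p : ℝ[X]) (w : ℝ) : ℝ :=
  (X * derivative p).eval w ^ 2 - p.eval w * (X * derivative (X * derivative p)).eval w

section Laguerre

lemma laguerreExpr_mul (p q : ℝ[X]) (w : ℝ) : laguerreExpr (p * q) w
    = p.eval w ^ 2 * laguerreExpr q w + q.eval w ^ 2 * laguerreExpr p w := by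
  simp only [laguerreExpr, derivative_mul, derivative_add, derivative_X, eval_add, eval_mul, eval_X,
    one_mul]
  ring

lemma laguerreExpr_one_sub_C_mul_X (x w : ℝ) : laguerreExpr (1 - C x * X) w = x * w := by
  have hderiv : derivative (1 - C x * X) = -C x := by simp
  rw [laguerreExpr, hderiv]
  simp only [mul_neg, derivative_neg, derivative_mul, derivative_X, derivative_C, one_mul, mul_zero,
    add_zero, eval_neg, eval_mul, eval_X, eval_C, eval_sub, eval_one]
  ring

lemma mul_sum_mul_sq_le_laguerreExpr {s : Finset ℕ} {x : ℕ → ℝ} {B w : ℝ} (hw : 0 ≤ w)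
    (hx : ∀ k ∈ s, 0 ≤ x k) (hxB : ∀ k ∈ s, x k ≤ B) :
    w * (∑ k ∈ s, x k) * (∏ k ∈ s, (1 - C (x k) * X)).eval w ^ 2
      ≤ laguerreExpr (∏ k ∈ s, (1 - C (x k) * X)) w * (1 + B * w) ^ 2 := by
  induction s using Finset.induction_on with
  | empty => simp [laguerreExpr]
  | insert a s ha ih =>
    have ih := ih (fun k hk => hx k (Finset.mem_insert_of_mem hk))
      fun k hk => hxB k (Finset.mem_insert_of_mem hk)
    have hxa := hx a (Finset.mem_insert_self a s)
    have hxaw : x a * w ≤ B * w :=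
      mul_le_mul_of_nonneg_right (hxB a (Finset.mem_insert_self a s)) hw
    have hsq : (1 - x a * w) ^ 2 ≤ (1 + B * w) ^ 2 :=
      sq_le_sq' (by linarith) (by linarith [mul_nonneg hxa hw])
    have heval : (1 - C (x a) * X : ℝ[X]).eval w = 1 - x a * w := by simp
    rw [Finset.prod_insert ha, Finset.sum_insert ha, laguerreExpr_mul, laguerreExpr_one_sub_C_mul_X,
      eval_mul, heval]
    set P := ∏ k ∈ s, (1 - C (x k) * X)
    have hnew := mul_le_mul_of_nonneg_left hsq
      (mul_nonneg (sq_nonneg (P.eval w)) (mul_nonneg hxa hw))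
    have hold := mul_le_mul_of_nonneg_left ih (sq_nonneg (1 - x a * w))
    linarith

lemma coeff_zero_prod_one_sub_C_mul_X (s : Finset ℕ) (x : ℕ → ℝ) :
    (∏ k ∈ s, (1 - C (x k) * X)).coeff 0 = 1 := by
  simp [coeff_zero_eq_eval_zero, eval_prod]

lemma coeff_one_prod_one_sub_C_mul_X (s : Finset ℕ) (x : ℕ → ℝ) :
    (∏ k ∈ s, (1 - C (x k) * X)).coeff 1 = -∑ k ∈ s, x k := by
  induction s using Finset.induction_on with
  | empty => simp [coeff_one]
  | insert a s ha ih =>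
    rw [Finset.prod_insert ha, Finset.sum_insert ha, sub_mul, one_mul, mul_assoc, coeff_sub,
      coeff_C_mul, coeff_X_mul, ih, coeff_zero_prod_one_sub_C_mul_X]
    ring

lemma coeff_X_mul_derivative (p : ℝ[X]) : (X * derivative p).coeff = fun l => l * p.coeff l := by
  ext l
  rcases l with _ | l
  · simp
  · rw [coeff_X_mul, coeff_derivative, Nat.cast_succ, mul_comm]

lemma laguerreExpr_eq_seriesSum (p : ℝ[X]) (w : ℝ) : laguerreExpr p w
    = seriesSum (fun l => l * p.coeff l) w ^ 2
      - seriesSum p.coeff w * seriesSum (fun l => l * (l * p.coeff l)) w := by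
  rw [laguerreExpr, ← seriesSum_coeff, ← seriesSum_coeff, ← seriesSum_coeff,
    coeff_X_mul_derivative (X * derivative p), coeff_X_mul_derivative]

lemma DominatedTendsto.laguerre_inequality {p : ℕ → ℝ[X]} {b C' : ℕ → ℝ}
    (h : DominatedTendsto atTop (fun n => (p n).coeff) b C')
    (hprod : ∀ᶠ n in atTop, ∃ (s : Finset ℕ) (x : ℕ → ℝ), (∀ k ∈ s, 0 ≤ x k) ∧
      p n = ∏ k ∈ s, (1 - C (x k) * X)) {w : ℝ} (hw : 0 ≤ w) :
    w * -b 1 * seriesSum b w ^ 2 ≤ (seriesSum (fun l => l * b l) w ^ 2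
      - seriesSum b w * seriesSum (fun l => l * (l * b l)) w) * (1 + -b 1 * w) ^ 2 := by
  have hconst : Tendsto (fun _ : ℕ => w) atTop (𝓝 w) := tendsto_const_nhds
  have hb1 := (h.tendsto_coeff 1).neg
  have h0 := h.tendsto_seriesSum hconst
  have h1 := h.natCast_mul.tendsto_seriesSum hconst
  have h2 := h.natCast_mul.natCast_mul.tendsto_seriesSum hconst
  refine le_of_tendsto_of_tendsto ((hb1.const_mul w).mul (h0.pow 2))
    (((h1.pow 2).sub (h0.mul h2)).mul (((hb1.mul_const w).const_add 1).pow 2)) ?_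
  filter_upwards [hprod] with n ⟨s, x, hx, hp⟩
  have hcoeff : -(p n).coeff 1 = ∑ k ∈ s, x k := by
    rw [hp, coeff_one_prod_one_sub_C_mul_X, neg_neg]
  rw [← laguerreExpr_eq_seriesSum, seriesSum_coeff, hcoeff, hp]
  exact mul_sum_mul_sq_le_laguerreExpr hw hx fun k hk => Finset.single_le_sum hx hk

end Laguerre

section SimpleZeros

variable {α β : ℝ} {j : ℕ}

lemma degree_jacobiKernel_succ (hα : -1 < α) (hβ : -1 < β) (hj : 1 ≤ j) {n : ℕ} (hn : j ≤ n) :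
    (jacobiKernel α β j (n + 1)).degree = n := by
  refine le_antisymm (Order.le_of_lt_succ ?_) (le_degree_of_ne_zero ?_)
  · exact_mod_cast degree_jacobiKernel_lt (α := α) (β := β) j (n + 1)
  · have hvanish : ∀ k ∈ Finset.range n,
        jacobiCoeff α β k j / jacobiNorm α β k * jacobiCoeff α β k n = 0 := fun k hk => by
      rw [jacobiCoeff_eq_zero (Finset.mem_range.1 hk), mul_zero]
    have hpos := fun i hi => neg_one_pow_mul_jacobiCoeff_pos hα hβ (hj.trans hn) (i := i) hi
    rw [coeff_jacobiKernel, Finset.sum_range_succ, Finset.sum_eq_zero hvanish, zero_add]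
    exact mul_ne_zero (div_ne_zero (right_ne_zero_of_mul (hpos j hn).ne')
      (jacobiNorm_pos hα hβ n).ne') (right_ne_zero_of_mul (hpos n le_rfl).ne')

lemma exists_pos_roots_jacobiKernel (hα : -1 < α) (hβ : -1 < β) (hj : 1 ≤ j) {n : ℕ} (hn : j ≤ n) :
    ∃ (w : ℕ → ℝ) (a : ℝ), (∀ k ∈ Finset.range n, 0 < w k) ∧ a ≠ 0 ∧
      ∀ x, (jacobiKernel α β j (n + 1)).eval x = a * ∏ k ∈ Finset.range n, (w k - x) := by
  obtain ⟨w, -, -, a, ha, heval⟩ := exists_roots_of_orthogonal hα hβ hj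
    (degree_jacobiKernel_succ hα hβ hj hn) fun f hf hfj => by
      rw [jacobiFunctional_jacobiKernel_mul hα hβ j (hf.trans_le (by exact_mod_cast n.le_succ)),
        hfj]
  refine ⟨w, a, fun k hk => ?_, ha, heval⟩
  by_contra! hwk
  refine (neg_one_pow_mul_eval_jacobiKernel_pos hα hβ hj (Nat.lt_succ_of_le hn) hwk).ne' ?_
  rw [heval, Finset.prod_eq_zero hk (sub_self _), mul_zero, mul_zero]

lemma C_mul_comp_eq_prod_one_sub {q : ℝ[X]} {s : Finset ℕ} {w : ℕ → ℝ} {a : ℝ} (ha : a ≠ 0)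
    (hw : ∀ k ∈ s, w k ≠ 0) (heval : ∀ x, q.eval x = a * ∏ k ∈ s, (w k - x)) (c : ℝ) :
    C (1 / q.coeff 0) * q.comp (C c * X) = ∏ k ∈ s, (1 - C (c / w k) * X) := by
  refine Polynomial.funext fun y => ?_
  have hprod := Finset.prod_ne_zero_iff.2 hw
  have hfactor : ∏ k ∈ s, (w k - c * y) = (∏ k ∈ s, w k) * ∏ k ∈ s, (1 - c / w k * y) := by
    rw [← Finset.prod_mul_distrib]
    refine Finset.prod_congr rfl fun k hk => ?_
    have := hw k hk
    field_simp
  simp only [coeff_zero_eq_eval_zero, eval_mul, eval_comp, eval_prod, eval_sub, eval_one, eval_C,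
    eval_X, heval, sub_zero, hfactor]
  field_simp

lemma exists_scaledKernel_eq_prod (hα : -1 < α) (hβ : -1 < β) (hj : 1 ≤ j) {n : ℕ} (hn : j < n) :
    ∃ (s : Finset ℕ) (x : ℕ → ℝ), (∀ k ∈ s, 0 ≤ x k) ∧
      scaledKernel α β j n = ∏ k ∈ s, (1 - C (x k) * X) := by
  obtain ⟨n, rfl⟩ := Nat.exists_eq_add_of_lt hn
  obtain ⟨w, a, hw, ha, heval⟩ := exists_pos_roots_jacobiKernel hα hβ hj (j.le_add_right n)
  refine ⟨_, _, fun k hk => ?_, C_mul_comp_eq_prod_one_sub ha (fun k hk => (hw k hk).ne') heval _⟩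
  have := hw k hk
  positivity

lemma isEntireSeq_kernelSeries (hα : -1 < α) (hj : 1 ≤ j) : IsEntireSeq (kernelSeries α j) :=
  (dominatedTendsto_scaledKernel (β := 0) hα (by norm_num) hj).isEntireSeq

lemma kernelSeries_one_neg (hα : -1 < α) : kernelSeries α j 1 < 0 := by
  have hbessel := neg_one_pow_mul_besselCoeff_pos hα 1
  have := j.cast_nonneg (α := ℝ)
  rw [kernelSeries]
  exact mul_neg_of_neg_of_pos (by linarith) (div_pos (by linarith) (by push_cast; linarith))

lemma seriesSum_kernelSeries_eq_zero (hα : -1 < α) (hj : 1 ≤ j) {w : ℝ} (hw : 0 < w)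
    (h : seriesSum (fun l => l * kernelSeries α j l) w ^ 2
      = seriesSum (kernelSeries α j) w * seriesSum (fun l => l * (l * kernelSeries α j l)) w) :
    seriesSum (kernelSeries α j) w = 0 := by
  have hβ : (-1 : ℝ) < 0 := by norm_num
  have hle := (dominatedTendsto_scaledKernel hα hβ hj).laguerre_inequality
    ((eventually_gt_atTop j).mono fun n hn => exists_scaledKernel_eq_prod hα hβ hj hn) hw.le
  rw [h, sub_self, zero_mul] at hle
  have hpos : 0 < w * -kernelSeries α j 1 := mul_pos hw (neg_pos.2 (kernelSeries_one_neg hα))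
  exact pow_eq_zero_iff two_ne_zero |>.1 (le_antisymm (nonpos_of_mul_nonpos_right hle hpos)
    (sq_nonneg _))

lemma limitSeries_zero_right : limitSeries α j 0 = besselCoeff α := by
  ext i
  rw [limitSeries, zero_mul, sub_zero, mul_one]

lemma mul_limitSeries (hα : -1 < α) (c : ℝ) (i : ℕ) :
    (α + j + 1) * limitSeries α j c i
      = (α + j + 1 - c * (α + 2 * j + 1)) * kernelSeries α j i + i * kernelSeries α j i := by
  have : α + j + 1 + i ≠ 0 := by linarith [i.cast_nonneg (α := ℝ), j.cast_nonneg (α := ℝ)]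
  rw [limitSeries, kernelSeries]
  field_simp
  ring

lemma isEntireSeq_limitSeries (hα : -1 < α) (hj : 1 ≤ j) (c : ℝ) :
    IsEntireSeq (limitSeries α j c) := by
  have hA : α + j + 1 ≠ 0 := by linarith [j.cast_nonneg (α := ℝ)]
  have hH := isEntireSeq_kernelSeries hα hj
  convert ((hH.const_mul (α + j + 1 - c * (α + 2 * j + 1))).add hH.natCast_mul).const_mul
    (α + j + 1)⁻¹ using 2 with i
  rw [← mul_limitSeries hα, inv_mul_cancel_left₀ hA]

lemma mul_seriesSum_limitSeries (hα : -1 < α) (hj : 1 ≤ j) (c w : ℝ) :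
    (α + j + 1) * seriesSum (limitSeries α j c) w
      = (α + j + 1 - c * (α + 2 * j + 1)) * seriesSum (kernelSeries α j) w
        + seriesSum (fun l => l * kernelSeries α j l) w := by
  have hH := isEntireSeq_kernelSeries hα hj
  rw [← seriesSum_const_mul, ← seriesSum_const_mul, ← (hH.const_mul _).seriesSum_add hH.natCast_mul]
  simp only [mul_limitSeries hα]

lemma mul_seriesSum_natCast_mul_limitSeries (hα : -1 < α) (hj : 1 ≤ j) (c w : ℝ) :
    (α + j + 1) * seriesSum (fun l => l * limitSeries α j c l) w
      = (α + j + 1 - c * (α + 2 * j + 1)) * seriesSum (fun l => l * kernelSeries α j l) w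
        + seriesSum (fun l => l * (l * kernelSeries α j l)) w := by
  have hH := (isEntireSeq_kernelSeries hα hj).natCast_mul
  rw [← seriesSum_const_mul, ← seriesSum_const_mul, ← (hH.const_mul _).seriesSum_add hH.natCast_mul]
  congr 1 with l
  linear_combination (l : ℝ) * mul_limitSeries hα c l

-- A double zero of `limitSeries α j c` is a zero of the Laguerre expression of the kernel series,
-- hence a triple zero of that series and a double zero of the Bessel series.
lemma limitSeries_simple_of_pos (hα : -1 < α) (hj : 1 ≤ j) (c : ℝ) {w : ℝ} (hw : 0 < w)
    (hzero : seriesSum (limitSeries α j c) w = 0) :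
    seriesSum (derivSeq (limitSeries α j c)) w ≠ 0 := by
  intro hderiv
  have hA : α + j + 1 ≠ 0 := by linarith [j.cast_nonneg (α := ℝ)]
  have hsum := mul_seriesSum_limitSeries hα hj c w
  have hsum' := mul_seriesSum_natCast_mul_limitSeries hα hj c w
  rw [hzero, mul_zero] at hsum
  rw [(isEntireSeq_limitSeries hα hj c).seriesSum_natCast_mul, hderiv, mul_zero, mul_zero] at hsum'
  have h0 : seriesSum (kernelSeries α j) w = 0 := seriesSum_kernelSeries_eq_zero hα hj hw (by
    linear_combination seriesSum (kernelSeries α j) w * hsum'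
      - seriesSum (fun l => l * kernelSeries α j l) w * hsum)
  have h1 : seriesSum (fun l => l * kernelSeries α j l) w = 0 := by
    rw [h0] at hsum
    linarith
  have h2 : seriesSum (fun l => l * (l * kernelSeries α j l)) w = 0 := by
    rw [h1] at hsum'
    linarith
  have hbessel := mul_seriesSum_limitSeries hα hj 0 w
  have hbessel' := mul_seriesSum_natCast_mul_limitSeries hα hj 0 w
  rw [limitSeries_zero_right, h0, h1, mul_zero, add_zero, mul_eq_zero] at hbessel
  rw [limitSeries_zero_right, (isEntireSeq_besselCoeff hα).seriesSum_natCast_mul, h1, h2, mul_zero,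
    add_zero, mul_eq_zero, mul_eq_zero] at hbessel'
  exact seriesSum_derivSeq_besselCoeff_ne_zero hα hw (hbessel.resolve_left hA)
    ((hbessel'.resolve_left hA).resolve_left hw.ne')

lemma limitSeries_simple (hα : -1 < α) (hj : 1 ≤ j) (c : ℝ) {w : ℝ} (hw : 0 ≤ w)
    (hzero : seriesSum (limitSeries α j c) w = 0) :
    seriesSum (derivSeq (limitSeries α j c)) w ≠ 0 := by
  rcases hw.eq_or_lt with rfl | hw
  · rw [seriesSum_zero] at hzero ⊢
    intro hderiv
    have hA : α + j + 1 ≠ 0 := by linarith [j.cast_nonneg (α := ℝ)]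
    have h0 := mul_limitSeries (j := j) hα c 0
    have h1 := mul_limitSeries (j := j) hα c 1
    have h1' : limitSeries α j c 1 = 0 := by simpa [derivSeq] using hderiv
    have hker : kernelSeries α j 0 ≠ 0 := by simp [kernelSeries, besselCoeff_zero, hA]
    rw [hzero, mul_zero, Nat.cast_zero, zero_mul, add_zero, eq_comm] at h0
    rw [(mul_eq_zero.1 h0).resolve_right hker, h1', mul_zero, zero_mul, zero_add, Nat.cast_one,
      one_mul] at h1
    exact (kernelSeries_one_neg hα).ne h1.symm
  · exact limitSeries_simple_of_pos hα hj c hw hzero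

end SimpleZeros

section BesselFunctions

variable {α : ℝ}

lemma besselCoeff_eq (hα : -1 < α) (i : ℕ) :
    besselCoeff α i
      = (-1) ^ i * Real.Gamma (α + 1) / (4 ^ i * i.factorial * Real.Gamma (α + 1 + i)) := by
  have hΓ := Real.Gamma_pos_of_pos (by linarith : 0 < α + 1)
  induction i with
  | zero => simp [besselCoeff_zero, hΓ.ne']
  | succ i ih =>
    have hi : 0 < α + 1 + i := by linarith [i.cast_nonneg (α := ℝ)]
    have := Real.Gamma_pos_of_pos hi
    rw [besselCoeff_succ, ih, Nat.factorial_succ, Nat.cast_mul, Nat.cast_succ, ← add_assoc (α + 1),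
      Real.Gamma_add_one hi.ne']
    field_simp
    ring

lemma besselJ_eq {x : ℝ} (hα : -1 < α) (hx : 0 < x) :
    besselJ α x = (x / 2) ^ α / Real.Gamma (α + 1) * seriesSum (besselCoeff α) (x ^ 2) := by
  rw [besselJ, seriesSum, ← tsum_mul_left]
  refine tsum_congr fun k => ?_
  have hx2 : 0 < x / 2 := by positivity
  have := Real.Gamma_pos_of_pos (by linarith : 0 < α + 1)
  have := Real.Gamma_pos_of_pos (by linarith [k.cast_nonneg (α := ℝ)] : 0 < α + 1 + k)
  rw [add_comm (2 * (k : ℝ)) α, rpow_add_two_mul_natCast hx2.ne', besselCoeff_eq hα,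
    show (k : ℝ) + α + 1 = α + 1 + k by ring, div_pow x 2 2, div_pow]
  norm_num
  field_simp

lemma hasSum_rpow_mul_besselJ {x : ℝ} (hα : -1 < α) (hx : 0 < x) (i : ℕ) :
    HasSum (fun l : ℕ => (-2) ^ i * (l.descFactorial i * Real.Gamma (α + l + 1)
        / Real.Gamma (α + l + i + 1)) * (besselCoeff α l * (x ^ 2) ^ l))
      (Real.Gamma (α + 1) * (2 ^ i * (x / 2) ^ (-α) * besselJ (α + 2 * i) x)) := by
  have hν : -1 < α + 2 * i := by linarith [i.cast_nonneg (α := ℝ)]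
  have hΓ := Real.Gamma_pos_of_pos (by linarith : 0 < α + 2 * i + 1)
  have hsum : Real.Gamma (α + 1) * (2 ^ i * (x / 2) ^ (-α) * besselJ (α + 2 * i) x)
      = Real.Gamma (α + 1) * 2 ^ i * (x ^ 2) ^ i / (4 ^ i * Real.Gamma (α + 2 * i + 1))
        * seriesSum (besselCoeff (α + 2 * i)) (x ^ 2) := by
    have hx2 : 0 < x / 2 := by positivity
    have := Real.rpow_pos_of_pos hx2 α
    rw [besselJ_eq hν hx, rpow_add_two_mul_natCast hx2.ne', Real.rpow_neg hx2.le, div_pow x 2 2,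
      div_pow]
    norm_num
    field_simp
  rw [hsum]
  refine ((add_left_injective i).hasSum_iff fun l hl => ?_).1
    ((((isEntireSeq_besselCoeff hν).hasSum (x ^ 2)).mul_left _).congr_fun fun d => ?_)
  · have hli : l < i := not_le.1 fun h => hl ⟨l - i, Nat.sub_add_cancel h⟩
    simp [Nat.descFactorial_of_lt hli]
  · have hfac : (((d + i).factorial : ℕ) : ℝ) = d.factorial * (d + i).descFactorial i := by
      rw [← Nat.factorial_mul_descFactorial (Nat.le_add_left i d), Nat.add_sub_cancel, Nat.cast_mul]
    have hdi : (0 : ℝ) < (d + i).descFactorial i :=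
      Nat.cast_pos.2 (Nat.descFactorial_pos.2 (Nat.le_add_left i d))
    have h1 := Real.Gamma_pos_of_pos (by
      linarith [(d + i).cast_nonneg (α := ℝ)] : 0 < α + ((d + i : ℕ) : ℝ) + 1)
    have h2 := Real.Gamma_pos_of_pos (by
      linarith [d.cast_nonneg (α := ℝ)] : 0 < α + 2 * i + 1 + d)
    rw [Function.comp_apply, besselCoeff_eq hα, besselCoeff_eq hν, hfac,
      show α + ((d + i : ℕ) : ℝ) + i + 1 = α + 2 * i + 1 + d by push_cast; ring,
      show α + 1 + ((d + i : ℕ) : ℝ) = α + ((d + i : ℕ) : ℝ) + 1 by ring,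
      show (-2 : ℝ) ^ i = (-1) ^ i * 2 ^ i by rw [← mul_pow]; norm_num]
    have hsign : (-1 : ℝ) ^ i * (-1) ^ (d + i) = (-1) ^ d := by
      rw [pow_add, mul_left_comm, pow_mul_pow_eq_one i (by norm_num), mul_one]
    rw [← hsign]
    field_simp
    ring

lemma sum_limitCoeff_mul (hα : -1 < α) (θ : ℕ → ℝ) (l : ℕ) :
    ∑ i ∈ Finset.range (l + 1), limitCoeff α θ i * ((-2) ^ i
      * (l.descFactorial i * Real.Gamma (α + l + 1) / Real.Gamma (α + l + i + 1))) = θ l := by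
  have hΓ (i : ℕ) : 0 < Real.Gamma (α + l + i + 1) := Real.Gamma_pos_of_pos (by
    linarith [l.cast_nonneg (α := ℝ), i.cast_nonneg (α := ℝ)])
  have hΓ0 : 0 < Real.Gamma (α + l + 1) := by simpa using hΓ 0
  have hpow (i : ℕ) : (-2 : ℝ) ^ i = (-1) ^ i * 2 ^ i := by rw [← mul_pow]; norm_num
  rw [Finset.sum_range_succ]
  have htop : limitCoeff α θ l * ((-2) ^ l
      * (l.descFactorial l * Real.Gamma (α + l + 1) / Real.Gamma (α + l + l + 1)))
      = θ l - Real.Gamma (α + l + 1) * ∑ k : Fin l, limitCoeff α θ k * (l.choose k : ℝ) *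
          ((-1 : ℝ) ^ (k : ℕ) * ((k : ℕ).factorial : ℝ) * 2 ^ (k : ℕ)
            / Real.Gamma (α + l + (k : ℕ) + 1)) := by
    have := hΓ l
    rw [limitCoeff, Nat.descFactorial_self, hpow, show α + 2 * (l : ℝ) + 1 = α + l + l + 1 by ring]
    field_simp
    rw [pow_right_comm]
    norm_num
  rw [htop, Fin.sum_univ_eq_sum_range (fun k => limitCoeff α θ k * (l.choose k : ℝ) *
      ((-1 : ℝ) ^ k * (k.factorial : ℝ) * 2 ^ k / Real.Gamma (α + l + k + 1))), Finset.mul_sum,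
    add_sub_left_comm, ← Finset.sum_sub_distrib, Finset.sum_eq_zero fun k _ => ?_, add_zero]
  rw [hpow, Nat.descFactorial_eq_factorial_mul_choose]
  push_cast
  ring

lemma sum_mul_Gamma_ratio_eq_of_le (hα : -1 < α) {N : ℕ} {a : ℕ → ℝ} {p : ℝ[X]}
    (hp : p.natDegree ≤ N)
    (h : ∀ l ≤ N, ∑ i ∈ Finset.range (N + 1),
      a i * (l.descFactorial i * Real.Gamma (α + l + 1) / Real.Gamma (α + l + i + 1))
        = p.eval (l : ℝ) / (ascPochhammer ℝ N).eval (α + l + 1)) (l : ℕ) :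
    ∑ i ∈ Finset.range (N + 1),
      a i * (l.descFactorial i * Real.Gamma (α + l + 1) / Real.Gamma (α + l + i + 1))
        = p.eval (l : ℝ) / (ascPochhammer ℝ N).eval (α + l + 1) := by
  set q : ℝ[X] := ∑ i ∈ Finset.range (N + 1),
    C (a i) * (descPochhammer ℝ i * (ascPochhammer ℝ (N - i)).comp (X + C (α + 1 + i))) with hq
  have hpos (l : ℕ) : 0 < α + l + 1 := by linarith [l.cast_nonneg (α := ℝ)]
  have hasc (l i : ℕ) : (ascPochhammer ℝ i).eval (α + l + 1) ≠ 0 :=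
    (ascPochhammer_pos i _ (hpos l)).ne'
  have hq_eval (l : ℕ) : q.eval (l : ℝ) = (∑ i ∈ Finset.range (N + 1),
      a i * (l.descFactorial i * Real.Gamma (α + l + 1) / Real.Gamma (α + l + i + 1)))
        * (ascPochhammer ℝ N).eval (α + l + 1) := by
    rw [hq, eval_finsetSum, Finset.sum_mul]
    refine Finset.sum_congr rfl fun i hi => ?_
    have hΓ := (Real.Gamma_pos_of_pos (hpos l)).ne'
    have := hasc l i
    rw [← Nat.add_sub_cancel' (Finset.mem_range_succ_iff.1 hi), ← ascPochhammer_mul,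
      Nat.add_sub_cancel_left, add_right_comm _ (i : ℝ), Gamma_add_natCast (hpos l)]
    simp only [eval_mul, eval_C, eval_comp, eval_add, eval_X, eval_natCast,
      descPochhammer_eval_eq_descFactorial]
    rw [show α + (l : ℝ) + 1 + i = l + (α + 1 + i) by ring]
    field_simp
  have hq_degree : q.natDegree ≤ N := by
    refine natDegree_sum_le_of_forall_le _ _ fun i hi => ?_
    refine (natDegree_C_mul_le _ _).trans (natDegree_mul_le.trans ?_)
    rw [natDegree_comp, descPochhammer_natDegree, ascPochhammer_natDegree, natDegree_X_add_C,
      mul_one, Nat.add_sub_cancel' (Finset.mem_range_succ_iff.1 hi)]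
  have hqp : q = p := by
    refine eq_of_natDegree_lt_card_of_eval_eq q p (f := fun l : Fin (N + 1) => ((l : ℕ) : ℝ))
      (Nat.cast_injective.comp Fin.val_injective) (fun l => ?_) ?_
    · rw [hq_eval, h l (Nat.lt_succ_iff.1 l.2), div_mul_cancel₀ _ (hasc l N)]
    · rw [Fintype.card_fin]
      omega
  rw [eq_div_iff (hasc l N), ← hq_eval, hqp]

lemma sum_limitCoeff_mul_of_lt (hα : -1 < α) (θ : ℕ → ℝ) {N l : ℕ} (hl : l < N) :
    ∑ i ∈ Finset.range N, limitCoeff α θ i * ((-2) ^ i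
      * (l.descFactorial i * Real.Gamma (α + l + 1) / Real.Gamma (α + l + i + 1))) = θ l := by
  rw [← sum_limitCoeff_mul hα θ l]
  refine (Finset.sum_subset (Finset.range_subset_range.2 hl) fun i _ hi => ?_).symm
  rw [Nat.descFactorial_of_lt (by simpa using hi)]
  simp

lemma sum_limitCoeff_mul_of_rational (hα : -1 < α) (j : ℕ) (τ : ℝ) (l : ℕ) :
    ∑ i ∈ Finset.range (j + 2), limitCoeff α (fun i => 1 - τ / (α + j + 1 + i)) i * ((-2) ^ i
      * (l.descFactorial i * Real.Gamma (α + l + 1) / Real.Gamma (α + l + i + 1)))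
      = 1 - τ / (α + j + 1 + l) := by
  set p : ℝ[X] := (X + C (α + j + 1 - τ)) * (ascPochhammer ℝ j).comp (X + C (α + 1)) with hp
  have hp_degree : p.natDegree ≤ j + 1 := by
    refine natDegree_mul_le.trans ?_
    rw [natDegree_comp, ascPochhammer_natDegree, natDegree_X_add_C, natDegree_X_add_C, mul_one,
      add_comm]
  have hp_eval (l : ℕ) : p.eval (l : ℝ) / (ascPochhammer ℝ (j + 1)).eval (α + l + 1)
      = 1 - τ / (α + j + 1 + l) := by
    have hl : 0 < α + l + 1 := by linarith [l.cast_nonneg (α := ℝ)]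
    have := (ascPochhammer_pos j _ hl).ne'
    have : α + j + 1 + l ≠ 0 := by linarith [j.cast_nonneg (α := ℝ)]
    rw [ascPochhammer_succ_eval, show α + (l : ℝ) + 1 + j = α + j + 1 + l by ring, hp]
    simp only [eval_mul, eval_C, eval_comp, eval_add, eval_X]
    rw [show (l : ℝ) + (α + 1) = α + l + 1 by ring]
    field_simp
    ring
  simp only [← mul_assoc (limitCoeff _ _ _), ← hp_eval]
  refine sum_mul_Gamma_ratio_eq_of_le hα hp_degree (fun l hl => ?_) l
  simp only [mul_assoc (limitCoeff _ _ _), hp_eval]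
  exact sum_limitCoeff_mul_of_lt hα _ (Nat.lt_succ_of_le hl)

lemma besselCombination_eq (hα : -1 < α) (j : ℕ) (c : ℝ) {x : ℝ} (hx : 0 < x) :
    besselCombination α j (fun i => 1 - c * (α + 2 * j + 1) / (α + j + 1 + i)) x
      = seriesSum (limitSeries α j c) (x ^ 2) / Real.Gamma (α + 1) := by
  have hΓ := Real.Gamma_pos_of_pos (by linarith : 0 < α + 1)
  have hsum := hasSum_sum fun i (_ : i ∈ Finset.range (j + 2)) =>
    (hasSum_rpow_mul_besselJ hα hx i).mul_left
      (limitCoeff α (fun i => 1 - c * (α + 2 * j + 1) / (α + j + 1 + i)) i)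
  rw [eq_div_iff hΓ.ne', besselCombination, Finset.sum_mul, seriesSum]
  refine .trans (Finset.sum_congr rfl fun i _ => ?_) (hsum.congr_fun fun l => ?_).tsum_eq.symm
  · ring
  · simp only [← mul_assoc (limitCoeff _ _ _)]
    rw [← Finset.sum_mul]
    simp only [mul_assoc (limitCoeff _ _ _)]
    rw [sum_limitCoeff_mul_of_rational hα, limitSeries]
    ring

end BesselFunctions

section ChangeOfVariables

variable {α β : ℝ} {j : ℕ}

/-- The mass of the Sobolev form in the variable `t = (1 - x) / 2`, acting on the `j`-th
coefficients and relative to the factor `2^{α+β+1}` of the transformed integral. -/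
def scaledMass (α β : ℝ) (j : ℕ) (m : ℝ) : ℝ :=
  m * (j.factorial : ℝ) ^ 2 / (4 ^ j * 2 ^ (α + β + 1))

lemma scaledMass_nonneg {m : ℝ} (hm : 0 ≤ m) : 0 ≤ scaledMass α β j m :=
  div_nonneg (mul_nonneg hm (sq_nonneg _))
    (mul_nonneg (by positivity) (Real.rpow_nonneg zero_le_two _))

lemma factorial_mul_coeff_comp_one_sub (p : ℝ[X]) (j : ℕ) :
    (j.factorial : ℝ) * (p.comp (1 - C 2 * X)).coeff j
      = (-2) ^ j * (derivative^[j] p).eval 1 := by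
  have htaylor : p.comp (1 - C 2 * X) = (taylor 1 p).comp (C (-2) * X) := by
    rw [taylor_apply, comp_assoc, add_comp, X_comp, C_comp, map_neg, map_one]
    congr 1
    ring
  rw [htaylor, comp_C_mul_X_coeff, taylor_coeff, ← factorial_smul_hasseDeriv, LinearMap.smul_apply,
    eval_smul, nsmul_eq_mul]
  ring

lemma integral_mul_one_sub_rpow_mul_one_add_rpow (hα : -1 < α) (hβ : -1 < β) (p q : ℝ[X]) :
    ∫ x in (-1 : ℝ)..1, p.eval x * q.eval x * (1 - x) ^ α * (1 + x) ^ β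
      = 2 ^ (α + β + 1) * jacobiFunctional α β ((p * q).comp (1 - C 2 * X)) := by
  have hsubst := intervalIntegral.mul_integral_comp_sub_mul (a := 0) (b := 1)
    (f := fun x : ℝ => p.eval x * q.eval x * (1 - x) ^ α * (1 + x) ^ β) 2 1
  norm_num at hsubst
  rw [← hsubst, jacobiFunctional_apply hα hβ, ← intervalIntegral.integral_const_mul,
    ← intervalIntegral.integral_const_mul]
  refine intervalIntegral.integral_congr_Ioo_of_le zero_le_one fun t ht => ?_
  simp only [eval_mul, eval_comp, eval_sub, eval_one, eval_C, eval_X]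
  rw [show 1 + (1 - 2 * t) = 2 * (1 - t) by ring, Real.mul_rpow zero_le_two ht.1.le,
    Real.mul_rpow zero_le_two (sub_nonneg.2 ht.2.le), Real.rpow_add two_pos, Real.rpow_add two_pos,
    Real.rpow_one]
  ring

lemma jacobiSobolevForm_eq (hα : -1 < α) (hβ : -1 < β) (m : ℝ) (p q : ℝ[X]) :
    jacobiSobolevForm α β j m p q
      = 2 ^ (α + β + 1) * (jacobiFunctional α β ((p * q).comp (1 - C 2 * X))
        + scaledMass α β j m * (p.comp (1 - C 2 * X)).coeff j
          * (q.comp (1 - C 2 * X)).coeff j) := by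
  have hpq : ((j.factorial : ℝ) * (p.comp (1 - C 2 * X)).coeff j)
      * ((j.factorial : ℝ) * (q.comp (1 - C 2 * X)).coeff j)
      = 4 ^ j * ((derivative^[j] p).eval 1 * (derivative^[j] q).eval 1) := by
    rw [factorial_mul_coeff_comp_one_sub, factorial_mul_coeff_comp_one_sub, mul_mul_mul_comm,
      ← mul_pow]
    norm_num
  have := Real.rpow_pos_of_pos two_pos (α + β + 1)
  rw [jacobiSobolevForm, integral_mul_one_sub_rpow_mul_one_add_rpow hα hβ, mul_add, scaledMass]
  congr 1
  field_simp
  linear_combination -m * hpq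

lemma degree_comp_linear {p ℓ : ℝ[X]} (hℓ : ℓ.degree = 1) : (p.comp ℓ).degree = p.degree := by
  rw [degree_comp (by rw [hℓ]; exact one_pos), hℓ, mul_one]

lemma IsJacobiSobolevOP.degree_comp_one_sub {m : ℝ} {n : ℕ} {p : ℝ[X]}
    (h : IsJacobiSobolevOP α β j m n p) : (p.comp (1 - C 2 * X)).degree = n := by
  rw [degree_comp_linear (by compute_degree!), h.1]

lemma IsJacobiSobolevOP.jacobiFunctional_comp_one_sub (hα : -1 < α) (hβ : -1 < β) {m : ℝ} {n : ℕ}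
    {p : ℝ[X]} (h : IsJacobiSobolevOP α β j m n p) {f : ℝ[X]} (hf : f.degree < n) :
    jacobiFunctional α β (p.comp (1 - C 2 * X) * f)
      + scaledMass α β j m * (p.comp (1 - C 2 * X)).coeff j * f.coeff j = 0 := by
  have hinv : (f.comp (C (1 / 2) - C (1 / 2) * X)).comp (1 - C 2 * X) = f := by
    rw [comp_assoc]
    convert! comp_X using 2
    refine Polynomial.funext fun x => ?_
    simp only [eval_comp, eval_sub, eval_mul, eval_C, eval_X, eval_one]
    ring
  have horth := h.2 (f.comp (C (1 / 2) - C (1 / 2) * X))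
    (by rwa [degree_comp_linear (by compute_degree!)])
  rw [jacobiSobolevForm_eq hα hβ, mul_comp, hinv] at horth
  exact (mul_eq_zero.1 horth).resolve_left (Real.rpow_pos_of_pos two_pos _).ne'

end ChangeOfVariables

section Mass

variable {α β γ M : ℝ} {m : ℕ → ℝ}

/-- The share `μ K / (1 + μ K)` of the discrete part of the Sobolev form, where `μ` is the scaled
mass and `K` the `j`-th coefficient of `jacobiKernel`. Its limit is the parameter of
`limitSeries`. -/
def relativeMass (α β : ℝ) (j : ℕ) (m : ℝ) (n : ℕ) : ℝ :=
  scaledMass α β j m * (jacobiKernel α β j n).coeff j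
    / (1 + scaledMass α β j m * (jacobiKernel α β j n).coeff j)

lemma massConst_pos (hα : -1 < α) (j : ℕ) : 0 < massConst α β j := by
  have := j.cast_nonneg (α := ℝ)
  have := Real.Gamma_pos_of_pos (by linarith : 0 < α + j + 1)
  have : 0 < α + 2 * j + 1 := by linarith
  rw [massConst]
  positivity

lemma tendsto_scaledMass_mul_coeff_jacobiKernel_div (hα : -1 < α) (hβ : -1 < β) (j : ℕ)
    (hlim : Tendsto (fun n : ℕ => m n * (n : ℝ) ^ γ) atTop (𝓝 M)) :
    Tendsto (fun n : ℕ => scaledMass α β j (m n) * (jacobiKernel α β j n).coeff j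
      / (n : ℝ) ^ (2 * (α + 2 * j + 1) - γ)) atTop (𝓝 (M / massConst α β j)) := by
  have := j.cast_nonneg (α := ℝ)
  have := Real.rpow_pos_of_pos two_pos (α + β + 1)
  convert! (hlim.mul (tendsto_coeff_jacobiKernel hα hβ j j)).mul_const
    (16 ^ j * (j.factorial : ℝ) ^ 2 / (4 ^ j * 2 ^ (α + β + 1))) |>.congr' ?_ using 2
  · have := Real.Gamma_pos_of_pos (by linarith : 0 < α + 1)
    have := Real.Gamma_pos_of_pos (by linarith : 0 < α + 1 + j)
    have : 0 < α + 2 * j + 1 := by linarith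
    rw [besselCoeff_eq hα, massConst, show α + j + 1 + (j : ℝ) = α + 2 * j + 1 by ring,
      show α + (j : ℝ) + 1 = α + 1 + j by ring,
      show α + β + 2 * (j : ℝ) + 1 = α + β + 1 + 2 * j by ring,
      rpow_add_two_mul_natCast two_ne_zero, show (16 : ℝ) ^ j = 4 ^ j * 4 ^ j by
        rw [← mul_pow]; norm_num, show (2 : ℝ) ^ 2 = 4 by norm_num]
    field_simp
    rw [← pow_mul, pow_mul', neg_one_sq, one_pow, mul_one]
  · filter_upwards [eventually_gt_atTop 0] with n hn
    have hn : (0 : ℝ) < n := Nat.cast_pos.2 hn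
    have := Real.rpow_pos_of_pos hn γ
    have := Real.rpow_pos_of_pos hn (2 * α + 2)
    rw [scaledMass, Real.rpow_sub hn,
      show 2 * (α + 2 * (j : ℝ) + 1) = 2 * α + 2 + 2 * (j + j : ℕ) by push_cast; ring,
      rpow_add_two_mul_natCast hn.ne', mul_pow, pow_add 4, show (16 : ℝ) ^ j = 4 ^ j * 4 ^ j by
        rw [← mul_pow]; norm_num]
    field_simp

lemma tendsto_div_one_add {u : ℕ → ℝ} {k : ℝ} (hk : 1 + k ≠ 0) (hu : Tendsto u atTop (𝓝 k)) :
    Tendsto (fun n => u n / (1 + u n)) atTop (𝓝 (k / (1 + k))) :=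
  hu.div (hu.const_add 1) hk

lemma tendsto_div_one_add_of_atTop {u : ℕ → ℝ} (hu : Tendsto u atTop atTop) :
    Tendsto (fun n => u n / (1 + u n)) atTop (𝓝 1) := by
  have h : Tendsto (fun n => 1 - (1 + u n)⁻¹) atTop (𝓝 (1 - 0)) :=
    (tendsto_inv_atTop_zero.comp (tendsto_atTop_add_const_left _ 1 hu)).const_sub 1
  rw [sub_zero] at h
  refine h.congr' ?_
  filter_upwards [hu.eventually_gt_atTop 0] with n hn
  field_simp
  ring

lemma scaledMass_mul_coeff_eventuallyEq (j : ℕ) (m : ℕ → ℝ) (δ : ℝ) :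
    (fun n : ℕ => scaledMass α β j (m n) * (jacobiKernel α β j n).coeff j / (n : ℝ) ^ δ
      * (n : ℝ) ^ δ)
      =ᶠ[atTop] fun n => scaledMass α β j (m n) * (jacobiKernel α β j n).coeff j := by
  filter_upwards [eventually_gt_atTop 0] with n hn
  exact div_mul_cancel₀ _ (Real.rpow_pos_of_pos (Nat.cast_pos.2 hn) _).ne'

lemma tendsto_relativeMass_of_gt (hα : -1 < α) (hβ : -1 < β) {j : ℕ}
    (hlim : Tendsto (fun n : ℕ => m n * (n : ℝ) ^ γ) atTop (𝓝 M))
    (hγ : γ > 2 * (α + 2 * j + 1)) :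
    Tendsto (fun n => relativeMass α β j (m n) n) atTop (𝓝 0) := by
  have hpow := (tendsto_rpow_neg_atTop (sub_pos.2 hγ)).comp tendsto_natCast_atTop_atTop
  simp only [neg_sub] at hpow
  have hmass := ((tendsto_scaledMass_mul_coeff_jacobiKernel_div hα hβ j hlim).mul hpow).congr'
    (scaledMass_mul_coeff_eventuallyEq j m _)
  simpa only [relativeMass, mul_zero, zero_div] using tendsto_div_one_add (by simp) hmass

lemma tendsto_relativeMass_of_lt (hα : -1 < α) (hβ : -1 < β) (hM : 0 < M) {j : ℕ}
    (hlim : Tendsto (fun n : ℕ => m n * (n : ℝ) ^ γ) atTop (𝓝 M))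
    (hγ : γ < 2 * (α + 2 * j + 1)) :
    Tendsto (fun n => relativeMass α β j (m n) n) atTop (𝓝 1) := by
  have hpow := (tendsto_rpow_atTop (sub_pos.2 hγ)).comp tendsto_natCast_atTop_atTop
  exact tendsto_div_one_add_of_atTop
    (((tendsto_scaledMass_mul_coeff_jacobiKernel_div hα hβ j hlim).pos_mul_atTop
      (div_pos hM (massConst_pos hα j)) hpow).congr' (scaledMass_mul_coeff_eventuallyEq j m _))

lemma tendsto_relativeMass_of_eq (hα : -1 < α) (hβ : -1 < β) (hM : 0 < M) {j : ℕ}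
    (hlim : Tendsto (fun n : ℕ => m n * (n : ℝ) ^ γ) atTop (𝓝 M))
    (hγ : γ = 2 * (α + 2 * j + 1)) :
    Tendsto (fun n => relativeMass α β j (m n) n) atTop (𝓝 (M / (M + massConst α β j))) := by
  have hD := massConst_pos (β := β) hα j
  have hmass := tendsto_scaledMass_mul_coeff_jacobiKernel_div hα hβ j hlim
  simp only [hγ, sub_self, Real.rpow_zero, div_one] at hmass
  convert! tendsto_div_one_add (by positivity) hmass using 2
  field_simp
  ring

end Mass

section Zeros

variable {α β : ℝ} {j n : ℕ} {m : ℝ} {p : ℝ[X]}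

lemma IsJacobiSobolevOP.exists_roots (hα : -1 < α) (hβ : -1 < β) (hj : 0 < j)
    (h : IsJacobiSobolevOP α β j m n p) :
    ∃ t : ℕ → ℝ, StrictMonoOn t (Iio n) ∧ (∀ k, 0 < k → k < n → 0 < t k) ∧
      ∃ a, a ≠ 0 ∧ ∀ x, (p.comp (1 - C 2 * X)).eval x = a * ∏ k ∈ Finset.range n, (t k - x) :=
  exists_roots_of_orthogonal hα hβ hj h.degree_comp_one_sub fun f hf hfj => by
    simpa only [hfj, mul_zero, add_zero] using h.jacobiFunctional_comp_one_sub hα hβ hf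

lemma isZeroList_of_eval_comp_eq {t : ℕ → ℝ} {a : ℝ} (ht : StrictMonoOn t (Iio n)) (ha : a ≠ 0)
    (heval : ∀ x, (p.comp (1 - C 2 * X)).eval x = a * ∏ k ∈ Finset.range n, (t k - x)) :
    IsZeroList p n fun i => 1 - 2 * t (i - 1) := by
  refine ⟨fun i hi k hk hik => ?_, fun x => ?_⟩
  · have := @ht (i - 1) (by grind) (k - 1) (by grind) (by grind)
    linarith
  · have hx : p.eval x = a * ∏ k ∈ Finset.range n, (t k - (1 - x) / 2) := by
      rw [← heval]
      simp only [eval_comp, eval_sub, eval_one, eval_mul, eval_C, eval_X]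
      congr 1
      ring
    rw [IsRoot.def, hx, mul_eq_zero, or_iff_right ha, Finset.prod_eq_zero_iff]
    constructor
    · rintro ⟨k, hk, hkx⟩
      refine ⟨k + 1, ⟨k.succ_pos, Finset.mem_range.1 hk⟩, ?_⟩
      simp only [Nat.add_sub_cancel]
      linarith
    · rintro ⟨i, ⟨hi1, hin⟩, rfl⟩
      exact ⟨i - 1, Finset.mem_range.2 (by omega), by ring⟩

lemma coeff_eq_of_eval_eq_mul_prod {w : ℕ → ℝ} {c : ℝ}
    (heval : ∀ x, p.eval x = c * ∏ k ∈ Finset.range n, (w k - x)) : p.coeff n = (-1) ^ n * c := by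
  have hp : p = C c * ((-1) ^ n * ∏ k ∈ Finset.range n, (X - C (w k))) := by
    refine Polynomial.funext fun x => ?_
    rw [heval, eval_mul, eval_C, ← Finset.card_range n, ← Finset.prod_const,
      Finset.card_range, ← Finset.prod_mul_distrib, eval_prod]
    simp
  have hmonic : (∏ k ∈ Finset.range n, (X - C (w k))).coeff n = 1 := by
    have := (monic_prod_X_sub_C w (Finset.range n)).coeff_natDegree
    rwa [natDegree_finsetProd_X_sub_C_eq_card, Finset.card_range] at this
  rw [hp, coeff_C_mul, ← C_1, ← C_neg, ← C_pow, coeff_C_mul, hmonic]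
  ring

lemma neg_one_pow_mul_coeff_scaledPoly_pos (hα : -1 < α) (hβ : -1 < β) (hj : 1 ≤ j) (hn : j < n)
    (μ : ℝ) : 0 < (-1) ^ n * (scaledPoly α β j μ n).coeff n := by
  have hkernel : (scaledKernel α β j n).coeff n = 0 := by
    rw [coeff_scaledKernel, coeff_eq_zero_of_degree_lt (degree_jacobiKernel_lt j n)]
    simp
  have hn0 : (0 : ℝ) < n := Nat.cast_pos.2 (by omega)
  rw [coeff_scaledPoly hα hβ hj hn, hkernel, mul_zero, sub_zero, ← mul_div_assoc]
  exact div_pos (neg_one_pow_mul_jacobiCoeff_pos hα hβ (by omega) le_rfl) (by positivity)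

lemma prod_mul_sub_eq_pow_mul {s : ℝ} (hs : s ≠ 0) (n : ℕ) (t : ℕ → ℝ) (x : ℝ) :
    ∏ k ∈ Finset.range n, (s * t k - x) = s ^ n * ∏ k ∈ Finset.range n, (t k - 1 / s * x) := by
  rw [← Finset.card_range n, ← Finset.prod_const, Finset.card_range, ← Finset.prod_mul_distrib]
  refine Finset.prod_congr rfl fun k _ => ?_
  field_simp

lemma IsJacobiSobolevOP.exists_eval_scaledPoly_eq (hα : -1 < α) (hβ : -1 < β) (hj : 1 ≤ j)
    (hn : j < n) (hm : 0 ≤ m) (h : IsJacobiSobolevOP α β j m n p) {t : ℕ → ℝ} {a : ℝ}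
    (heval : ∀ x, (p.comp (1 - C 2 * X)).eval x = a * ∏ k ∈ Finset.range n, (t k - x)) :
    ∃ c > 0, ∀ x, (scaledPoly α β j (scaledMass α β j m) n).eval x
      = c * ∏ k ∈ Finset.range n, (4 * (n : ℝ) ^ 2 * t k - x) := by
  have hn0 : (0 : ℝ) < 4 * (n : ℝ) ^ 2 := by
    have : (0 : ℝ) < n := Nat.cast_pos.2 (by omega)
    positivity
  obtain ⟨d, hd, hp⟩ := eq_C_mul_jacobiPoly_sub_jacobiKernel hα hβ (scaledMass_nonneg hm)
    h.degree_comp_one_sub fun f hf => h.jacobiFunctional_comp_one_sub hα hβ hf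
  have hscaled (x : ℝ) : (scaledPoly α β j (scaledMass α β j m) n).eval x
      = a / d / (4 * (n : ℝ) ^ 2) ^ n * ∏ k ∈ Finset.range n, (4 * (n : ℝ) ^ 2 * t k - x) := by
    have hx := heval (1 / (4 * (n : ℝ) ^ 2) * x)
    rw [hp, eval_mul, eval_C] at hx
    rw [scaledPoly, eval_comp, eval_mul, eval_C, eval_X, ← mul_right_inj' hd, hx,
      prod_mul_sub_eq_pow_mul hn0.ne']
    generalize ∏ k ∈ Finset.range n, (t k - 1 / (4 * (n : ℝ) ^ 2) * x) = P
    field_simp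
  refine ⟨_, ?_, hscaled⟩
  have hpos := neg_one_pow_mul_coeff_scaledPoly_pos hα hβ hj hn (scaledMass α β j m)
  rwa [coeff_eq_of_eval_eq_mul_prod hscaled, ← mul_assoc, pow_mul_pow_eq_one n (by norm_num),
    one_mul] at hpos

end Zeros

section Limit

variable {α β c : ℝ} {j : ℕ}

lemma limitSeries_zero_apply : limitSeries α j c 0 = 1 - c * ((α + 2 * j + 1) / (α + j + 1)) := by
  rw [limitSeries, besselCoeff_zero, one_mul, Nat.cast_zero, add_zero]

lemma neg_one_pow_mul_limitSeries_pos (hα : -1 < α) {i : ℕ}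
    (hi : c * (α + 2 * j + 1) < α + j + 1 + i) : 0 < (-1) ^ i * limitSeries α j c i := by
  have := j.cast_nonneg (α := ℝ)
  have := i.cast_nonneg (α := ℝ)
  rw [limitSeries, ← mul_assoc, ← mul_div_assoc]
  exact mul_pos (neg_one_pow_mul_besselCoeff_pos hα i)
    (sub_pos.2 ((div_lt_one (by linarith)).2 hi))

lemma alternatingLimit_scaledPoly (hα : -1 < α) (hβ : -1 < β) (hj : 1 ≤ j) {μ : ℕ → ℝ}
    {w : ℕ → ℕ → ℝ}
    (hμ : Tendsto (fun n => μ n * (jacobiKernel α β j n).coeff j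
      / (1 + μ n * (jacobiKernel α β j n).coeff j)) atTop (𝓝 c))
    (heval : ∀ᶠ n in atTop, ∃ c > 0, ∀ x,
      (scaledPoly α β j (μ n) n).eval x = c * ∏ k ∈ Finset.range n, (w n k - x))
    (hmono : ∀ᶠ n in atTop, StrictMonoOn (w n) (Iio n))
    (hpos : ∀ᶠ n in atTop, ∀ k, 0 < k → k < n → 0 < w n k) :
    ∃ C, AlternatingLimit atTop (fun n => scaledPoly α β j (μ n) n) w (limitSeries α j c) C := by
  obtain ⟨C, hC⟩ := dominatedTendsto_scaledPoly hα hβ hj hμ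
  refine ⟨_, le_rfl, hC, heval, hmono, hpos, ?_, fun h0 l hl => ?_, ?_,
    fun x hx => limitSeries_simple hα hj c hx⟩
  · filter_upwards [tendsto_natCast_atTop_atTop.eventually_gt_atTop
      (c * (α + 2 * j + 1) - (α + j + 1))] with i hi
    exact neg_one_pow_mul_limitSeries_pos hα (by linarith)
  · have : (0 : ℝ) < α + j + 1 := by linarith [j.cast_nonneg (α := ℝ)]
    have hl : (1 : ℝ) ≤ l := Nat.one_le_cast.2 hl
    rw [limitSeries_zero_apply, ← mul_div_assoc, sub_eq_zero, eq_div_iff this.ne', one_mul] at h0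
    exact neg_one_pow_mul_limitSeries_pos hα (by linarith)
  · exact (hasExpTypeZero_jacobiBound (α := α) (β := β)).of_abs_le_const_mul (abs_nonneg C)
      fun l => (hC.abs_le l).trans ((le_abs_self _).trans (abs_mul _ _).le)

lemma besselJ_eq_zero_iff (hα : -1 < α) {x : ℝ} (hx : 0 < x) :
    besselJ α x = 0 ↔ seriesSum (limitSeries α j 0) (x ^ 2) = 0 := by
  have := Real.Gamma_pos_of_pos (by linarith : 0 < α + 1)
  have := Real.rpow_pos_of_pos (half_pos hx) α
  rw [besselJ_eq hα hx, limitSeries_zero_right, mul_eq_zero, or_iff_right (by positivity)]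

lemma besselCombination_eq_zero_iff (hα : -1 < α) {θ : ℕ → ℝ}
    (hθ : ∀ i, θ i = 1 - c * (α + 2 * j + 1) / (α + j + 1 + i)) {x : ℝ} (hx : 0 < x) :
    besselCombination α j θ x = 0 ↔ seriesSum (limitSeries α j c) (x ^ 2) = 0 := by
  have := Real.Gamma_pos_of_pos (by linarith : 0 < α + 1)
  rw [funext hθ, besselCombination_eq hα j c hx, div_eq_zero_iff, or_iff_left this.ne']

lemma varphiFun_eq_zero_iff (hα : -1 < α) {x : ℝ} (hx : 0 < x) :
    varphiFun α j x = 0 ↔ seriesSum (limitSeries α j 1) (x ^ 2) = 0 := by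
  refine besselCombination_eq_zero_iff hα (fun i => ?_) hx
  have : α + j + 1 + i ≠ 0 := by
    linarith [j.cast_nonneg (α := ℝ), i.cast_nonneg (α := ℝ)] |> ne_of_gt
  rw [show α + j + i + 1 = α + j + 1 + i by ring]
  field_simp
  ring

lemma psiFun_eq_zero_iff (hα : -1 < α) {M : ℝ} (hM : 0 < M) {x : ℝ} (hx : 0 < x) :
    psiFun α β j M x = 0
      ↔ seriesSum (limitSeries α j (M / (M + massConst α β j))) (x ^ 2) = 0 := by
  refine besselCombination_eq_zero_iff hα (fun i => ?_) hx
  have : 0 < α + j + 1 + i := by linarith [j.cast_nonneg (α := ℝ), i.cast_nonneg (α := ℝ)]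
  have := massConst_pos (β := β) hα j
  rw [show α + j + i + 1 = α + j + 1 + i by ring]
  field_simp
  ring

lemma limitSeries_zero_zero_pos : 0 < limitSeries α j 0 0 := by
  rw [limitSeries_zero_apply, zero_mul, sub_zero]
  exact one_pos

lemma limitSeries_one_zero_neg (hα : -1 < α) (hj : 0 < j) : limitSeries α j 1 0 < 0 := by
  have hj : (0 : ℝ) < j := Nat.cast_pos.2 hj
  rw [limitSeries_zero_apply, one_mul, sub_neg, one_lt_div (by linarith)]
  linarith

lemma exists_limitSeries_massConst_zero_eq (hα : -1 < α) (hj : 0 < j) {M : ℝ} (hM : 0 < M) :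
    ∃ κ > 0, limitSeries α j (M / (M + massConst α β j)) 0 = (massThreshold α β j - M) * κ := by
  have hj : (0 : ℝ) < j := Nat.cast_pos.2 hj
  have : 0 < α + j + 1 := by linarith
  have := massConst_pos (β := β) hα j
  have hthreshold : massThreshold α β j = massConst α β j * (α + j + 1) / j := by
    rw [massThreshold, massConst]
    ring
  refine ⟨j / ((M + massConst α β j) * (α + j + 1)), by positivity, ?_⟩
  rw [limitSeries_zero_apply, hthreshold]
  field_simp
  ring

end Limit

section RescaledZeros

variable {F : Filter ℕ} {p : ℕ → ℝ[X]} {y : ℕ → ℕ → ℝ} {b C : ℕ → ℝ}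

/-- The rescaled distances `2 n² (1 - y n i)` of the zeros from `1`, indexed by `k = i - 1` so that
the count starts at `0`. The first one is negative when `y n 1 > 1`. -/
def rescaledRoots (y : ℕ → ℕ → ℝ) (n k : ℕ) : ℝ := (n : ℝ) ^ 2 * (2 * (1 - y n (k + 1)))

lemma sqrt_rescaledRoots (n k : ℕ) :
    √(rescaledRoots y n k) = n * √(2 * (1 - y n (k + 1))) := by
  rw [rescaledRoots, Real.sqrt_mul (sq_nonneg _), Real.sqrt_sq n.cast_nonneg]

lemma AlternatingLimit.exists_isNthPosZero_tendsto_sqrt [F.NeBot]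
    (h : AlternatingLimit F p (rescaledRoots y) b C) {f : ℝ → ℝ}
    (hf : ∀ x, 0 < x → (f x = 0 ↔ seriesSum b (x ^ 2) = 0)) {i : ℕ} (hi : leadingRoots b < i) :
    ∃ z, IsNthPosZero f (i - leadingRoots b) z ∧
      Tendsto (fun n : ℕ => (n : ℝ) * √(2 * (1 - y n i))) F (𝓝 z) := by
  obtain ⟨k, rfl⟩ := Nat.exists_eq_add_of_lt hi
  obtain ⟨z, hz, hlim⟩ := h.exists_isNthPosZero k
  refine ⟨√z, ?_, ?_⟩
  · rw [add_assoc, Nat.add_sub_cancel_left]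
    exact hz.sqrt hf
  · rw [add_comm (leadingRoots b)]
    simpa only [sqrt_rescaledRoots] using hlim.sqrt

lemma AlternatingLimit.exists_isNthPosZero_of_pos [F.NeBot]
    (h : AlternatingLimit F p (rescaledRoots y) b C) (hb : 0 < b 0) {f : ℝ → ℝ}
    (hf : ∀ x, 0 < x → (f x = 0 ↔ seriesSum b (x ^ 2) = 0)) :
    ∀ i ≥ 1, ∃ z, IsNthPosZero f i z ∧
      Tendsto (fun n : ℕ => (n : ℝ) * √(2 * (1 - y n i))) F (𝓝 z) := by
  have hb : leadingRoots b = 0 := if_pos hb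
  intro i hi
  simpa only [hb, Nat.sub_zero] using h.exists_isNthPosZero_tendsto_sqrt hf (hb ▸ hi)

lemma AlternatingLimit.exists_isNthPosZero_of_nonpos [F.NeBot]
    (h : AlternatingLimit F p (rescaledRoots y) b C) (hb : b 0 ≤ 0) {f : ℝ → ℝ}
    (hf : ∀ x, 0 < x → (f x = 0 ↔ seriesSum b (x ^ 2) = 0)) :
    ∀ i ≥ 2, ∃ z, IsNthPosZero f (i - 1) z ∧
      Tendsto (fun n : ℕ => (n : ℝ) * √(2 * (1 - y n i))) F (𝓝 z) := by
  have hb : leadingRoots b = 1 := if_neg hb.not_gt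
  intro i hi
  simpa only [hb] using h.exists_isNthPosZero_tendsto_sqrt hf (hb ▸ hi)

lemma AlternatingLimit.tendsto_zero_one (h : AlternatingLimit F p (rescaledRoots y) b C) :
    Tendsto (fun n => y n 1) F (𝓝 1) := by
  have hu : Tendsto (fun n : ℕ => (n : ℝ) ^ 2) F atTop :=
    ((tendsto_pow_atTop two_ne_zero).comp tendsto_natCast_atTop_atTop).mono_left h.le_atTop
  have hdiv := ((h.tendsto_root_div 0 hu).div_const 2).const_sub 1
  rw [zero_div, sub_zero] at hdiv
  refine hdiv.congr' ?_
  filter_upwards [hu.eventually_gt_atTop 0] with n hn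
  rw [rescaledRoots, mul_div_cancel_left₀ _ hn.ne']
  ring

lemma AlternatingLimit.eventually_le_one (h : AlternatingLimit F p (rescaledRoots y) b C)
    (hb : 0 < b 0) : ∀ᶠ n in F, y n 1 ≤ 1 := by
  filter_upwards [h.lt_root_zero le_rfl ((seriesSum_zero b).symm ▸ hb)] with n hn
  have := pos_of_mul_pos_right hn (sq_nonneg _)
  linarith

lemma AlternatingLimit.tendsto_mul_sqrt_abs (h : AlternatingLimit F p (rescaledRoots y) b C)
    (hb : b 0 = 0) : Tendsto (fun n : ℕ => (n : ℝ) * √(2 * |1 - y n 1|)) F (𝓝 0) := by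
  have hsqrt := (h.tendsto_root_zero hb).abs.sqrt
  simp only [rescaledRoots, abs_mul, abs_pow, Nat.abs_cast, Nat.abs_ofNat, abs_zero,
    Real.sqrt_zero] at hsqrt
  simpa only [Real.sqrt_mul (sq_nonneg _), Real.sqrt_sq (Nat.cast_nonneg _)] using hsqrt

end RescaledZeros

section Main

variable {α β : ℝ} {j : ℕ} {m : ℕ → ℝ} {Q : ℕ → ℝ[X]}

lemma exists_isZeroList_alternatingLimit (hα : -1 < α) (hβ : -1 < β) (hj : 0 < j)
    (hm : ∀ n, 0 ≤ m n) (hQ : ∀ n, IsJacobiSobolevOP α β j (m n) n (Q n)) :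
    ∃ y : ℕ → ℕ → ℝ, (∀ n, IsZeroList (Q n) n (y n)) ∧
      ∀ c, Tendsto (fun n => relativeMass α β j (m n) n) atTop (𝓝 c) →
        ∃ C, AlternatingLimit atTop (fun n => scaledPoly α β j (scaledMass α β j (m n)) n)
          (rescaledRoots y) (limitSeries α j c) C := by
  choose t hmono hpos a ha heval using fun n => (hQ n).exists_roots hα hβ hj
  refine ⟨fun n i => 1 - 2 * t n (i - 1),
    fun n => isZeroList_of_eval_comp_eq (hmono n) (ha n) (heval n), fun c hc => ?_⟩
  have hroots : rescaledRoots (fun n i => 1 - 2 * t n (i - 1))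
      = fun (n : ℕ) k => 4 * (n : ℝ) ^ 2 * t n k := by
    ext n k
    rw [rescaledRoots, Nat.add_sub_cancel]
    ring
  have hn : ∀ᶠ n : ℕ in atTop, (0 : ℝ) < 4 * n ^ 2 := by
    filter_upwards [eventually_gt_atTop 0] with n hn
    have : (0 : ℝ) < n := Nat.cast_pos.2 hn
    positivity
  rw [hroots]
  refine alternatingLimit_scaledPoly hα hβ hj hc ?_ ?_ ?_
  · filter_upwards [eventually_gt_atTop j] with n hn
    exact (hQ n).exists_eval_scaledPoly_eq hα hβ hj hn (hm n) (heval n)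
  · filter_upwards [hn] with n hn k hk l hl hkl
    exact mul_lt_mul_of_pos_left (hmono n hk hl hkl) hn
  · filter_upwards [hn] with n hn k hk hkn
    exact mul_pos hn (hpos n k hk hkn)

end Main

end

theorem proposition4 (α β γ M : ℝ) (hα : -1 < α) (hβ : -1 < β) (hM : 0 < M)
    (j : ℕ) (hj : 0 < j)
    (m : ℕ → ℝ) (hm : ∀ n, 0 ≤ m n)
    (hlim : Tendsto (fun n : ℕ => m n * (n : ℝ) ^ γ) atTop (𝓝 M))
    (Q : ℕ → ℝ[X]) (hQ : ∀ n, IsJacobiSobolevOP α β j (m n) n (Q n)) :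
    ∃ y : ℕ → ℕ → ℝ, (∀ n, IsZeroList (Q n) n (y n)) ∧
      (γ > 2 * (α + 2 * j + 1) →
        ∀ i ≥ 1, ∃ z, IsNthPosZero (besselJ α) i z ∧
          Tendsto (fun n : ℕ => (n : ℝ) * √(2 * (1 - y n i))) atTop (𝓝 z)) ∧
      (γ < 2 * (α + 2 * j + 1) →
        Tendsto (fun n : ℕ => y n 1) atTop (𝓝 1) ∧
        ∀ i ≥ 2, ∃ s, IsNthPosZero (varphiFun α j) (i - 1) s ∧
          Tendsto (fun n : ℕ => (n : ℝ) * √(2 * (1 - y n i))) atTop (𝓝 s)) ∧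
      (γ = 2 * (α + 2 * j + 1) →
        (M < massThreshold α β j →
          (∀ᶠ n : ℕ in atTop, y n 1 ≤ 1) ∧
          ∀ i ≥ 1, ∃ t, IsNthPosZero (psiFun α β j M) i t ∧
            Tendsto (fun n : ℕ => (n : ℝ) * √(2 * (1 - y n i))) atTop (𝓝 t)) ∧
        (M = massThreshold α β j →
          Tendsto (fun n : ℕ => (n : ℝ) * √(2 * |1 - y n 1|)) atTop (𝓝 0) ∧
          ∀ i ≥ 2, ∃ t, IsNthPosZero (psiFun α β j M) (i - 1) t ∧
            Tendsto (fun n : ℕ => (n : ℝ) * √(2 * (1 - y n i))) atTop (𝓝 t)) ∧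
        (M > massThreshold α β j →
          Tendsto (fun n : ℕ => y n 1) atTop (𝓝 1) ∧
          ∀ i ≥ 2, ∃ t, IsNthPosZero (psiFun α β j M) (i - 1) t ∧
            Tendsto (fun n : ℕ => (n : ℝ) * √(2 * (1 - y n i))) atTop (𝓝 t))) := by
  obtain ⟨y, hy, hlimit⟩ := exists_isZeroList_alternatingLimit hα hβ hj hm hQ
  refine ⟨y, hy, fun hγ => ?_, fun hγ => ?_, fun hγ => ?_⟩
  · obtain ⟨C, h⟩ := hlimit 0 (tendsto_relativeMass_of_gt hα hβ hlim hγ)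
    exact h.exists_isNthPosZero_of_pos limitSeries_zero_zero_pos fun x => besselJ_eq_zero_iff hα
  · obtain ⟨C, h⟩ := hlimit 1 (tendsto_relativeMass_of_lt hα hβ hM hlim hγ)
    exact ⟨h.tendsto_zero_one, h.exists_isNthPosZero_of_nonpos (limitSeries_one_zero_neg hα hj).le
      fun x => varphiFun_eq_zero_iff hα⟩
  · obtain ⟨C, h⟩ := hlimit _ (tendsto_relativeMass_of_eq hα hβ hM hlim hγ)
    have hzero (x : ℝ) (hx : 0 < x) := psiFun_eq_zero_iff (β := β) (j := j) hα hM hx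
    obtain ⟨κ, hκ, hb⟩ := exists_limitSeries_massConst_zero_eq (β := β) hα hj hM
    refine ⟨fun hlt => ?_, fun heq => ?_, fun hgt => ?_⟩
    · have hpos := hb ▸ mul_pos (sub_pos.2 hlt) hκ
      exact ⟨h.eventually_le_one hpos, h.exists_isNthPosZero_of_pos hpos hzero⟩
    · have hb0 := hb.trans (mul_eq_zero_of_left (sub_eq_zero.2 heq.symm) κ)
      exact ⟨h.tendsto_mul_sqrt_abs hb0, h.exists_isNthPosZero_of_nonpos hb0.le hzero⟩
    · have hneg := hb ▸ mul_neg_of_neg_of_pos (sub_neg.2 hgt) hκ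
      exact ⟨h.tendsto_zero_one, h.exists_isNthPosZero_of_nonpos hneg.le hzero⟩
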